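/- **Setting.** Let $d\in\{5,6\}$ and $k\ge 7-d$. Let $\Omega\subset\mathbb R^2$ be a connected union of $P\ge 2$ strictly convex quadrangular patches $\Omega^{(\ell)}=\mathbf G^{(\ell)}([0,1]^2)$ with injective, regular bilinear maps $\mathbf G^{(\ell)}$, such that any two patches are disjoint, or meet in exactly one common vertex, or share a whole common edge, and such that deleting a vertex does not disconnect $\Omega$. Let $\mathcal S^d_k$ be the tensor-product spline space of bidegree $(d,d)$ on $[0,1]^2$ with open knot vectors whose inner knots $\frac{i}{k+1}$, $i=1,\dots,k$, have multiplicity $d-2$, with B-splines $N_{\mathbf i}$, $\mathbf i\in\{0,\dots,d+k(d-2)\}^2$. Let $V^{(k)}$ be the space of all $w\in C^2(\Omega)$ with $w\circ\mathbf G^{(\ell)}=\sum_{\mathbf i}b^{(\ell)}_{\mathbf i}N_{\mathbf i}\in\mathcal S^d_k$ for all $\ell$. For a non-boundary edge $\Gamma$ (a common edge of two patches) let $\mathcal I_\Gamma$ be the set of indices $(\ell,\mathbf i)$ of the coefficients on $\Gamma$ and in the two neighbouring columns in the two adjacent patches, without the first three and the last three in each column. A minimal determining set $M_\Gamma\subseteq\mathcal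 I_\Gamma$ is a set of the smallest possible cardinality such that every coefficient vector of a function in $V^{(k)}$ that vanishes outside $\mathcal I_\Gamma$ and on $M_\Gamma$ is zero. For a vertex $\mathbf v$ let $\mathcal I_{\mathbf v}$ be the set of the indices $(\ell,\mathbf i)$ such that $\mathbf v$ is a corner of $\Omega^{(\ell)}$ and both entries of $\mathbf i$ differ by at most $2$ from those of the index belonging to that corner. Given minimal determining sets $M_\Gamma$ for all non-boundary edges, the vertex space $V_{\mathbf v}$ consists of the functions in $V^{(k)}$ all of whose coefficients with index outside $\mathcal I_{\mathbf v}\cup\bigcup_{\Gamma\ni\mathbf v}(\mathcal I_\Gamma\setminus M_\Gamma)$ vanish. Let $\mathbf v^{(0)}$ be an inner vertex of valency $4$, placed at the origin. Label the surrounding patches $\Omega^{(0)},\dots,\Omega^{(3)}$ counterclockwise, with labels modulo $4$, where $\Omega^{(j)}$ has the vertices $\mathbf v^{(0)},\mathbf v^{(j)},\widetilde{\mathbf v}^{(j)},\mathbf v^{(j+1)}$ in cyclic order; here the neighbouring vertices are $\mathbf v^{(1)},\dots,\mathbf v^{(4)}$, $\mathbf v^{(5)}:=\mathbf v^{(1)}$,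 and $\Omega^{(4)}:=\Omega^{(0)}$ has the vertices $\mathbf v^{(0)},\mathbf v^{(4)},\widetilde{\mathbf v}^{(4)},\mathbf v^{(1)}$. Assume that $\mathbf v^{(0)}$ is of type $4$, i.e. $\mathbf v^{(j-1)},\mathbf v^{(0)},\mathbf v^{(j+1)}$ are collinear for each of the four $j$, neighbours being taken cyclically. For $m$ modulo $16$ let $b_{8+m}$ be the second ring of spline coefficients around $\mathbf v^{(0)}$: for $m=4j,4j+1,4j+2$ it is the coefficient of $\Omega^{(j)}$ that is $(2,1),(2,2),(1,2)$ index steps away from $\mathbf v^{(0)}$ in the directions of $(\mathbf v^{(j)},\mathbf v^{(j+1)})$, and for $m=4j+3$ the one two steps away on the edge to $\mathbf v^{(j+1)}$. Let $\Xi_1$ consist of the coefficient at $\mathbf v^{(0)}$, the first ring, and the coefficients $b_{8+4j+3}$. Put $[\mathbf x,\mathbf y]=x_1y_2-x_2y_1$, $\psi_{i,j}=[\mathbf v^{(i)},\mathbf v^{(j)}]$, $\kappa=\frac{1}{(d-1)(k+1)}$, $X_j=[\mathbf v^{(j)},\widetilde{\mathbf v}^{(j)}]$, and, for $j=1,2,3,4$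 (all labels cyclic), $$\tilde e^{(j)}=\tfrac12\psi_{j,j+1}b_{8+4j-2}+\tfrac12\psi_{j-1,j}b_{8+4j},\qquad \bar e^{(j)}=\psi_{j-1,j}^2\psi_{j+1,j}b_{8+4j+2}+\psi_{j,j+1}^3b_{8+4j-4},$$ $$\hat e^{(j)}=(3X_j+7\psi_{j+1,j})\psi_{j+1,j}^2b_{8+4j-4}-2\psi_{j+1,j}^3b_{8+4j-3}+4\psi_{j+1,j}^3b_{8+4j-2}+2\psi_{j,j-1}^2\psi_{j+1,j}b_{8+4j+1}+C_1^{(j)}b_{8+4j}+C_2^{(j)}b_{8+4j+2},$$ $$C_1^{(j)}=-4\psi_{j+1,j}\psi_{j-1,j}^2+8\kappa\,\psi_{j-1,j}\psi_{j,j+1}\big([\widetilde{\mathbf v}^{(j-1)},\mathbf v^{(j+1)}]+[\mathbf v^{(j-1)},\widetilde{\mathbf v}^{(j)}]-\psi_{j,j+1}-\psi_{j-1,j}\big),$$ $$C_2^{(j)}=-4\psi_{j+1,j}\psi_{j-1,j}^2+8\kappa\,\psi_{j-1,j}\big(\psi_{j,j+1}[\mathbf v^{(j)},\widetilde{\mathbf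 v}^{(j-1)}]+\psi_{j-1,j}X_j\big)-3(X_j+\psi_{j+1,j})\psi_{j-1,j}^2 .$$ **Claim.** The twelve equations $\tilde e^{(j)}=\bar e^{(j)}=\hat e^{(j)}=0$, $j=1,\dots,4$, hold for every function in $V^{(k)}$ whose coefficients in $\Xi_1$ vanish. The linear forms $\tilde e^{(j)},\bar e^{(j)},\hat e^{(j)}$ with $j=1,2,3$ are linearly independent, and all twelve forms span a space of dimension $9$. The dimension $N_4^{(4)}$ of the vertex space $V_{\mathbf v^{(0)}}$ is $9$, for every choice of the minimal determining sets. Moreover $$\bar e^{(4)}=\alpha_1\tilde e^{(1)}+\alpha_2\bar e^{(2)}+\alpha_3\tilde e^{(3)},\qquad \tilde e^{(4)}=\beta_1\bar e^{(1)}+\beta_2\tilde e^{(2)}+\beta_3\bar e^{(3)},$$ $$\hat e^{(4)}=\gamma_1\tilde e^{(1)}+\gamma_2\bar e^{(1)}+\gamma_3\hat e^{(1)}+\gamma_4\tilde e^{(2)}+\gamma_5\bar e^{(2)}+\gamma_6\hat e^{(2)}+\gamma_7\tilde e^{(3)}+\gamma_8\bar e^{(3)}+\gamma_9\hat e^{(3)},$$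 where $\alpha_i,\beta_i$ are functions of the vertices $\mathbf v^{(r)},\widetilde{\mathbf v}^{(r)}$, $r=1,2,3,4$, only, and $\gamma_1,\dots,\gamma_9$ are functions of these vertices only once $d$ and $k$ are fixed. -/

import Mathlib

open Set

noncomputable section

/-! ### Bilinear quadrangular patches -/

/-- The four corners of a bilinear patch; the corner `q (a, b)` is the image of the parameter
`(ξ₁, ξ₂)` with `ξ₁ = 1` iff `a = true` and `ξ₂ = 1` iff `b = true`. -/
abbrev Quad : Type := Bool × Bool → ℝ × ℝ

/-- The determinant of two plane vectors. -/
def cross (x y : ℝ × ℝ) : ℝ := x.1 * y.2 - x.2 * y.1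

/-- The closed unit square. -/
def unitSquare : Set (ℝ × ℝ) := Icc (0 : ℝ) 1 ×ˢ Icc (0 : ℝ) 1

namespace Quad

/-- The bilinear geometry mapping with corners `q`. -/
def map (q : Quad) (ξ : ℝ × ℝ) : ℝ × ℝ :=
  ((1 - ξ.1) * (1 - ξ.2)) • q (false, false) + (ξ.1 * (1 - ξ.2)) • q (true, false)
    + ((1 - ξ.1) * ξ.2) • q (false, true) + (ξ.1 * ξ.2) • q (true, true)

/-- The (closed) patch. -/
def patch (q : Quad) : Set (ℝ × ℝ) := q.map '' unitSquare

/-- The four sides of the patch: `(false, e)` is the side `ξ₁ = e`, `(true, e)` the side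
`ξ₂ = e`. -/
def side (q : Quad) : Bool × Bool → Set (ℝ × ℝ)
  | (false, e) => segment ℝ (q (e, false)) (q (e, true))
  | (true, e) => segment ℝ (q (false, e)) (q (true, e))

end Quad

/-- A bilinearly parameterized planar multi-patch domain. -/
structure MultiPatchDomain where
  /-- the number of patches -/
  P : ℕ
  two_le_P : 2 ≤ P
  /-- the corners of the patches -/
  quad : Fin P → Quad
  /-- every patch is a strictly convex quadrangle -/
  strictlyConvex : ∀ ℓ, ConvexIndependent ℝ (quad ℓ)
  /-- the geometry mappings are injective -/
  injOn : ∀ ℓ, InjOn (quad ℓ).map unitSquare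
  /-- the geometry mappings are regular -/
  regular : ∀ ℓ, ∀ ξ ∈ unitSquare, (fderiv ℝ (quad ℓ).map ξ).det ≠ 0
  /-- two patches are disjoint, or meet in exactly one common vertex, or share a whole edge -/
  inter : ∀ ℓ ℓ', ℓ ≠ ℓ' →
    (quad ℓ).patch ∩ (quad ℓ').patch = ∅ ∨
    (∃ c c', quad ℓ c = quad ℓ' c' ∧ (quad ℓ).patch ∩ (quad ℓ').patch = {quad ℓ c}) ∨
    (∃ s s', (quad ℓ).side s = (quad ℓ').side s' ∧
      (quad ℓ).patch ∩ (quad ℓ').patch = (quad ℓ).side s)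
  /-- the domain is connected -/
  connected : IsConnected (⋃ ℓ, (quad ℓ).patch)
  /-- deleting a vertex does not disconnect the domain -/
  connected_diff : ∀ ℓ c, IsConnected ((⋃ ℓ', (quad ℓ').patch) \ {quad ℓ c})

/-! ### Tensor-product splines -/

/-- The largest index of a univariate B-spline of degree `d` with `k` inner knots of
multiplicity `d - 2`. -/
def maxIndex (d k : ℕ) : ℕ := d + k * (d - 2)

/-- The open knot vector on `[0,1]`: `0` and `1` occur `d + 1` times, each of the inner knots
`i / (k + 1)`, `1 ≤ i ≤ k`, occurs `d - 2` times. -/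
def knot (d k : ℕ) (i : ℕ) : ℝ :=
  if i ≤ d then 0
  else if i ≤ maxIndex d k then (((i - d - 1) / (d - 2) + 1 : ℕ) : ℝ) / ((k : ℝ) + 1)
  else 1

open Classical in
/-- B-splines for a knot sequence `t` on `[0,1]` by the Cox-de Boor recursion
(`bspline t p i` has degree `p`; quotients with denominator `0` are `0`). The last nonempty knot
interval is closed at `1`. -/
def bspline (t : ℕ → ℝ) : ℕ → ℕ → ℝ → ℝ
  | 0, i, x => if (t i ≤ x ∧ x < t (i + 1)) ∨ (x = 1 ∧ t i < 1 ∧ t (i + 1) = 1) then 1 else 0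
  | p + 1, i, x =>
      (x - t i) / (t (i + p + 1) - t i) * bspline t p i x
        + (t (i + p + 2) - x) / (t (i + p + 2) - t (i + 1)) * bspline t p (i + 1) x

/-- Indices of the tensor-product B-splines. -/
abbrev SplineIndex (d k : ℕ) : Type := Fin (maxIndex d k + 1) × Fin (maxIndex d k + 1)

/-- The tensor-product spline with coefficients `c`. -/
def splineFun (d k : ℕ) (c : SplineIndex d k → ℝ) (ξ : ℝ × ℝ) : ℝ :=
  ∑ i, c i * (bspline (knot d k) d i.1 ξ.1 * bspline (knot d k) d i.2 ξ.2)

namespace MultiPatchDomain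

variable (D : MultiPatchDomain) (d k : ℕ)

/-- The domain `Ω`, the union of the patches. -/
def Omega : Set (ℝ × ℝ) := ⋃ ℓ, (D.quad ℓ).patch

/-- The index space of all spline coefficients. -/
abbrev Index : Type := Fin D.P × SplineIndex d k

/-- `w` restricted to each patch is the isogeometric function with spline coefficients `b`. -/
def Represents (w : ℝ × ℝ → ℝ) (b : D.Index d k → ℝ) : Prop :=
  ∀ ℓ, ∀ ξ ∈ unitSquare, w ((D.quad ℓ).map ξ) = splineFun d k (fun i => b (ℓ, i)) ξ

/-- The globally `C²`-smooth isogeometric functions on `Ω` all of whose spline coefficients with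
index outside `S` vanish. A function on `Ω` is identified with its extension by zero to the
plane. -/
def supportedSpace (S : Set (D.Index d k)) : Submodule ℝ (ℝ × ℝ → ℝ) where
  carrier := {w | ContDiffOn ℝ 2 w D.Omega ∧ (∀ x ∉ D.Omega, w x = 0) ∧
    ∃ b, D.Represents d k w b ∧ ∀ i ∉ S, b i = 0}
  zero_mem' := by
    refine ⟨contDiffOn_const, fun _ _ => rfl, 0, ?_, fun _ _ => rfl⟩
    intro ℓ ξ _
    simp [splineFun]
  add_mem' := by
    rintro w w' ⟨h, h0, b, hb, hS⟩ ⟨h', h0', b', hb', hS'⟩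
    refine ⟨h.add h', fun x hx => by simp [h0 x hx, h0' x hx], b + b', ?_, ?_⟩
    · intro ℓ ξ hξ
      simp only [Pi.add_apply, hb ℓ ξ hξ, hb' ℓ ξ hξ, splineFun, add_mul, Finset.sum_add_distrib]
    · intro i hi
      simp [hS i hi, hS' i hi]
  smul_mem' := by
    rintro a w ⟨h, h0, b, hb, hS⟩
    refine ⟨h.const_smul a, fun x hx => by simp [h0 x hx], a • b, ?_, ?_⟩
    · intro ℓ ξ hξ
      simp only [Pi.smul_apply, smul_eq_mul, hb ℓ ξ hξ, splineFun, mul_assoc, Finset.mul_sum]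
    · intro i hi
      simp [hS i hi]

/-- The space `V^{(k)}` of all globally `C²`-smooth isogeometric functions on `Ω`. -/
def isoSpace : Submodule ℝ (ℝ × ℝ → ℝ) := D.supportedSpace d k univ

/-! ### Index spaces of edges and vertices, minimal determining sets, vertex spaces -/

end MultiPatchDomain

/-- The index `i` is at distance at most two from the end `e` (`false`: first index, `true`:
last index) of the index range `0, …, n`. -/
def nearEnd {n : ℕ} (e : Bool) (i : Fin (n + 1)) : Prop :=
  if e then n ≤ (i : ℕ) + 2 else (i : ℕ) ≤ 2

/-- The index `i` is neither among the first three nor among the last three of `0, …, n`. -/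
def awayFromEnds {n : ℕ} (i : Fin (n + 1)) : Prop := 3 ≤ (i : ℕ) ∧ (i : ℕ) + 3 ≤ n

/-- The three columns of coefficients next to a side of a patch, without the first three and the
last three coefficients of each column. -/
def sideStrip (d k : ℕ) : Bool × Bool → Set (SplineIndex d k)
  | (false, e) => {i | nearEnd e i.1 ∧ awayFromEnds i.2}
  | (true, e) => {i | nearEnd e i.2 ∧ awayFromEnds i.1}

namespace MultiPatchDomain

variable (D : MultiPatchDomain) (d k : ℕ)

/-- The non-boundary edges: the common sides of two different patches. -/
def innerEdges : Set (Set (ℝ × ℝ)) :=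
  {Γ | ∃ ℓ ℓ' s s', ℓ ≠ ℓ' ∧ (D.quad ℓ).side s = Γ ∧ (D.quad ℓ').side s' = Γ}

/-- The index space of an edge. -/
def edgeIndices (Γ : Set (ℝ × ℝ)) : Set (D.Index d k) :=
  {x | ∃ s, (D.quad x.1).side s = Γ ∧ x.2 ∈ sideStrip d k s}

/-- The index space of a vertex. -/
def vertexIndices (v : ℝ × ℝ) : Set (D.Index d k) :=
  {x | ∃ c : Bool × Bool, D.quad x.1 c = v ∧ nearEnd c.1 x.2.1 ∧ nearEnd c.2 x.2.2}

/-- `M` determines the coefficients of the edge `Γ`: a coefficient vector of a `C²`-smooth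
isogeometric function which vanishes outside the index space of `Γ` and on `M` is zero. -/
def IsDeterminingSet (Γ : Set (ℝ × ℝ)) (M : Set (D.Index d k)) : Prop :=
  M ⊆ D.edgeIndices d k Γ ∧
    ∀ w ∈ D.isoSpace d k, ∀ b, D.Represents d k w b →
      (∀ x ∉ D.edgeIndices d k Γ, b x = 0) → (∀ x ∈ M, b x = 0) → b = 0

/-- Minimal determining sets: determining sets with the smallest number of elements. -/
def IsMinimalDeterminingSet (Γ : Set (ℝ × ℝ)) (M : Set (D.Index d k)) : Prop :=
  D.IsDeterminingSet d k Γ M ∧ ∀ M', D.IsDeterminingSet d k Γ M' → M.ncard ≤ M'.ncard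

/-- The vertex space of the vertex `v`, for a choice `M` of minimal determining sets of the
edges: the functions in `V^{(k)}` whose coefficients vanish outside the index space of `v` and
outside the sets `I_Γ \ M_Γ` for the non-boundary edges `Γ` containing `v`. -/
def vertexSpace (M : Set (ℝ × ℝ) → Set (D.Index d k)) (v : ℝ × ℝ) :
    Submodule ℝ (ℝ × ℝ → ℝ) :=
  D.supportedSpace d k
    (D.vertexIndices d k v ∪
      ⋃ Γ ∈ {Γ | Γ ∈ D.innerEdges ∧ v ∈ Γ}, D.edgeIndices d k Γ \ M Γ)

end MultiPatchDomain

/-! ### Inner vertices of valency four -/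

/-- An inner vertex `v0` of valency four of the domain `D`, with the surrounding patches labelled
in counterclockwise order. All labels are in `Fin 4`, i.e. modulo `4`, so that the label `0` also
plays the role of the label `4`. The patch `Ω^{(j)}` has the corner `v0` at parameter corner
`corner j`; its edges at `v0` are its first leg (in parameter direction `ξ₁`, or `ξ₂` if
`swap j = true`) and its second leg (in the other direction). -/
structure InnerVertexFour (D : MultiPatchDomain) where
  v0 : ℝ × ℝ
  patch : Fin 4 → Fin D.P
  corner : Fin 4 → Bool × Bool
  swap : Fin 4 → Bool
  /-- `v0` is an inner vertex -/
  inner : v0 ∈ interior D.Omega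
  corner_eq : ∀ j, D.quad (patch j) (corner j) = v0
  patch_injective : Function.Injective patch
  /-- there are no further patches at `v0` -/
  exhaustive : ∀ ℓ, v0 ∈ (D.quad ℓ).patch → ∃ j, patch j = ℓ
  /-- the second leg of `Ω^{(j)}` is the first leg of `Ω^{(j+1)}` -/
  legs : ∀ j,
    D.quad (patch j) (if swap j then (!(corner j).1, (corner j).2)
      else ((corner j).1, !(corner j).2)) =
    D.quad (patch (j + 1)) (if swap (j + 1) then ((corner (j + 1)).1, !(corner (j + 1)).2)
      else (!(corner (j + 1)).1, (corner (j + 1)).2))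
  /-- the patches are labelled counterclockwise -/
  ccw : ∀ j, 0 < cross
    (D.quad (patch j) (if swap j then ((corner j).1, !(corner j).2)
      else (!(corner j).1, (corner j).2)) - v0)
    (D.quad (patch j) (if swap j then (!(corner j).1, (corner j).2)
      else ((corner j).1, !(corner j).2)) - v0)

namespace InnerVertexFour

variable {D : MultiPatchDomain} (L : InnerVertexFour D)

/-- The neighbouring vertex `v^{(j)}` relative to `v0`: the end point of the first leg of
`Ω^{(j)}`, which is also the end point of the second leg of `Ω^{(j-1)}`. -/
def v (j : Fin 4) : ℝ × ℝ :=
  D.quad (L.patch j) (if L.swap j then ((L.corner j).1, !(L.corner j).2)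
    else (!(L.corner j).1, (L.corner j).2)) - L.v0

/-- The vertex `ṽ^{(j)}` of `Ω^{(j)}` opposite to `v0`, relative to `v0`. -/
def vt (j : Fin 4) : ℝ × ℝ :=
  D.quad (L.patch j) (!(L.corner j).1, !(L.corner j).2) - L.v0

/-- The type of the vertex: the number of two-patch domains `Ω^{(j-1)} ∪ Ω^{(j)}` for which
`v^{(j-1)}`, `v0`, `v^{(j+1)}` are collinear. -/
def type : ℕ :=
  Set.ncard {j : Fin 4 | Collinear ℝ {L.v (j - 1) + L.v0, L.v0, L.v (j + 1) + L.v0}}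

/-- The `i`-th index counted from the end `e` of the index range. -/
def stepIndex {n : ℕ} (e : Bool) (i : ℕ) : Fin (n + 1) :=
  if e then Fin.rev (Fin.ofNat (n + 1) i) else Fin.ofNat (n + 1) i

/-- The index of the spline coefficient of `Ω^{(j)}` which is `i` steps from `v0` in the
direction of `v^{(j)}` and `i'` steps in the direction of `v^{(j+1)}`. -/
def localIndex (d k : ℕ) (j : Fin 4) (i i' : ℕ) : D.Index d k :=
  (L.patch j,
    if L.swap j then (stepIndex (L.corner j).1 i', stepIndex (L.corner j).2 i)
    else (stepIndex (L.corner j).1 i, stepIndex (L.corner j).2 i'))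

/-- The coefficients in `Ξ₁` vanish: `b₀`, the first ring around `v0`, and the coefficients of the
second ring on the edges. -/
def XiOneVanishes (d k : ℕ) (b : D.Index d k → ℝ) : Prop :=
  ∀ j : Fin 4, ∀ i ≤ 2, ∀ i' ≤ 2, (i, i') ≠ (2, 1) → (i, i') ≠ (1, 2) → (i, i') ≠ (2, 2) →
    b (L.localIndex d k j i i') = 0

/-- The second ring of coefficients `b_{2ν+m}`, `ν = 4`, `m = 1, …, 16` modulo `16`, in
counterclockwise order starting in the middle of `Ω^{(0)}`: for `m = 4j, 4j+1, 4j+2` these are the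
coefficients of `Ω^{(j)}` which are `(2,1)`, `(2,2)`, `(1,2)` steps from `v0` in the directions of
`v^{(j)}` and `v^{(j+1)}`, and for `m = 4j+3` the coefficient two steps from `v0` on the edge to
`v^{(j+1)}`. -/
def secondRing (d k : ℕ) (b : D.Index d k → ℝ) (m : ZMod 16) : ℝ :=
  match m.val % 4 with
  | 0 => b (L.localIndex d k (Fin.ofNat 4 (m.val / 4)) 2 1)
  | 1 => b (L.localIndex d k (Fin.ofNat 4 (m.val / 4)) 2 2)
  | 2 => b (L.localIndex d k (Fin.ofNat 4 (m.val / 4)) 1 2)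
  | _ => b (L.localIndex d k (Fin.ofNat 4 (m.val / 4)) 0 2)

end InnerVertexFour

/-! ### The twelve local constraint equations

They are linear forms in the coefficients `b_{2ν+m}`, `m` modulo `16`, of the second ring, and
depend on the vertices `v^{(j)}`, `ṽ^{(j)}` relative to `v0` only. -/

namespace TypeFour

/-- Linear forms in the coefficients of the second ring. -/
abbrev Form : Type := (ZMod 16 → ℝ) →ₗ[ℝ] ℝ

/-- The coefficient `b_{2ν+m}` as a linear form. -/
def coeff (m : ZMod 16) : Form := LinearMap.proj m

/-- The label `4 j` of the second ring. -/
def pos (j : Fin 4) : ZMod 16 := 4 * ((j : ℕ) : ZMod 16)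

/-- `ψ_{i,j} = p_i q_j - p_j q_i`. -/
def psi (v : Fin 4 → ℝ × ℝ) (i j : Fin 4) : ℝ := cross (v i) (v j)

/-- The equation `ẽ^{(j)}`. -/
def eTilde (v : Fin 4 → ℝ × ℝ) (j : Fin 4) : Form :=
  (1 / 2 * psi v j (j + 1)) • coeff (pos j - 2) + (1 / 2 * psi v (j - 1) j) • coeff (pos j)

/-- The equation `ē^{(j)}`. -/
def eBar (v : Fin 4 → ℝ × ℝ) (j : Fin 4) : Form :=
  (psi v (j - 1) j ^ 2 * psi v (j + 1) j) • coeff (pos j + 2)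
    + (psi v j (j + 1) ^ 3) • coeff (pos j - 4)

/-- The constant `C₁^{(j)}` of the equation `ê^{(j)}`. -/
def C1 (d k : ℕ) (v vt : Fin 4 → ℝ × ℝ) (j : Fin 4) : ℝ :=
  -4 * psi v (j + 1) j * psi v (j - 1) j ^ 2
    + 8 / (((d : ℝ) - 1) * ((k : ℝ) + 1)) * psi v (j - 1) j * psi v j (j + 1)
      * (cross (vt (j - 1)) (v (j + 1)) + cross (v (j - 1)) (vt j)
          - psi v j (j + 1) - psi v (j - 1) j)

/-- The constant `C₂^{(j)}` of the equation `ê^{(j)}`. -/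
def C2 (d k : ℕ) (v vt : Fin 4 → ℝ × ℝ) (j : Fin 4) : ℝ :=
  -4 * psi v (j + 1) j * psi v (j - 1) j ^ 2
    + 8 / (((d : ℝ) - 1) * ((k : ℝ) + 1)) * psi v (j - 1) j
      * (psi v j (j + 1) * cross (v j) (vt (j - 1)) + psi v (j - 1) j * cross (v j) (vt j))
    - 3 * (cross (v j) (vt j) + psi v (j + 1) j) * psi v (j - 1) j ^ 2

/-- The equation `ê^{(j)}`. -/
def eHat (d k : ℕ) (v vt : Fin 4 → ℝ × ℝ) (j : Fin 4) : Form :=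
  ((3 * cross (v j) (vt j) + 7 * psi v (j + 1) j) * psi v (j + 1) j ^ 2) • coeff (pos j - 4)
    - (2 * psi v (j + 1) j ^ 3) • coeff (pos j - 3)
    + (4 * psi v (j + 1) j ^ 3) • coeff (pos j - 2)
    + (2 * psi v j (j - 1) ^ 2 * psi v (j + 1) j) • coeff (pos j + 1)
    + C1 d k v vt j • coeff (pos j)
    + C2 d k v vt j • coeff (pos j + 2)

/-- The equations `ẽ^{(j)}`, `ē^{(j)}`, `ê^{(j)}` of the edge from `v0` to `v^{(j)}`. -/
def edgeEquations (d k : ℕ) (v vt : Fin 4 → ℝ × ℝ) (j : Fin 4) : Fin 3 → Form :=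
  ![eTilde v j, eBar v j, eHat d k v vt j]

/-- The twelve equations; the edges are numbered `1, 2, 3, 4`, with `4` written as `0`. -/
def equations (d k : ℕ) (v vt : Fin 4 → ℝ × ℝ) (x : Fin 4 × Fin 3) : Form :=
  edgeEquations d k v vt x.1 x.2

/-- The first nine equations, those of the edges `1, 2, 3`. -/
def firstNine (d k : ℕ) (v vt : Fin 4 → ℝ × ℝ) : Fin 9 → Form :=
  ![eTilde v 1, eBar v 1, eHat d k v vt 1,
    eTilde v 2, eBar v 2, eHat d k v vt 2,
    eTilde v 3, eBar v 3, eHat d k v vt 3]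

end TypeFour

end

/-! Write the patch `Ω^{(j)}` as `(s, t) ↦ v0 + s (1 + η t) v^{(j)} + t (1 + μ s) v^{(j+1)}`. Its
nine spline coefficients nearest to `v0` are equivalent to the mixed parameter derivatives of orders
`≤ 2` in `s` and in `t` at the corner. These are in turn equivalent to nine numbers `J^{(j)}_{m,i}`,
`m, i ≤ 2`, the formal derivatives of order `m` along `v^{(j)}` and `i` along `v^{(j+1)}`.

Type 4 means that `v^{(j+2)} = -ν_j v^{(j)}` with `ν_j > 0`, and then `ν_0 ν_2 = ν_1 ν_3 = 1`.
Across a leg the transversal direction is only rescaled, so `C²`-smoothness forces `J^{(j+1)}_{m,i}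
= (-ν_j)^i J^{(j)}_{i,m}`. For the orders (2,1), (1,2), (2,2) this is not plain continuity of
derivatives, because `w` is only `C²`. The vanishing of these data is carried across a leg by
comparing orders of vanishing along it (`leg_transfer`). After one turn around `v0` the four rules
compose to the identity, so the nine numbers of one patch are free.

Existence for arbitrary `J` is `exists_of_jets`. On each leg one takes `W₀(X) + Y W₁(X) + Y²
W₂(X)/2`, where `W₀, W₁, W₂` are combinations of truncated powers with exponents at least 5, 4, 3
and at most `d`, `d - 1`, `d - 2`. Composition with the bilinear maps multiplies by polynomials of
degree at most 0, 1, 2, so the rows next to the leg remain splines of degree `d`. Prescribing three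
derivatives at `v0` needs `(d - 4)(k + 1) ≥ 3`, which is the condition `k ≥ 7 - d`. Subtracting such
a function from a given one shows that every smooth function obeys the rules (`exists_jets`).

If the coefficients in `Ξ₁` vanish, only `J_{2,1}, J_{1,2}, J_{2,2}` remain, and the three equations
of an edge say exactly how these transform across it (`edgeEquations_iff`). Three edges imply the
fourth, and the nine forms of three edges are independent by a triangular evaluation, so the rank is
9. For the vertex space, the map to the nine coefficients of `Ω^{(0)}` is injective because the sets
`M_Γ` determine. It is surjective because a determining set of minimal size also admits arbitrary
values (`exists_eqOn_of_minimal`). -/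

noncomputable section

/-! ### B-splines on a knot sequence -/

namespace BSpline

open Polynomial

lemma eq_zero_of_lt {t : ℕ → ℝ} (ht : Monotone t) {x : ℝ} :
    ∀ p i, x < t i → bspline t p i x = 0 := by
  intro p
  induction p with
  | zero =>
    intro i h
    rw [bspline, if_neg]
    rintro (⟨h1, -⟩ | ⟨h1, h2, -⟩) <;> linarith
  | succ p ih =>
    intro i h
    rw [bspline, ih i h, ih (i + 1) (h.trans_le (ht (Nat.le_succ i)))]
    simp

lemma eq_zero_of_le {t : ℕ → ℝ} (ht : Monotone t) {x : ℝ} :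
    ∀ p i, t (i + p + 1) ≤ x → (t (i + p + 1) < 1 ∨ x ≠ 1) → bspline t p i x = 0 := by
  intro p
  induction p with
  | zero =>
    intro i h h'
    rw [bspline, if_neg]
    rintro (⟨-, h1⟩ | ⟨h1, -, h3⟩)
    · exact absurd h (not_le.2 h1)
    · rcases h' with h' | h'
      · exact h'.ne h3
      · exact h' h1
  | succ p ih =>
    intro i h h'
    have e : i + 1 + p + 1 = i + (p + 1) + 1 := by ring
    have hm : t (i + p + 1) ≤ t (i + (p + 1) + 1) := ht (by omega)
    rw [bspline, ih i (hm.trans h) (h'.imp_left hm.trans_lt),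
      ih (i + 1) (by rwa [e]) (by rwa [e])]
    simp

lemma eq_zero_of_eq {t : ℕ → ℝ} (ht : Monotone t) {x : ℝ} :
    ∀ p i, t i = t (i + p + 1) → bspline t p i x = 0 := by
  intro p
  induction p with
  | zero =>
    intro i h
    rw [bspline, if_neg]
    simp only [add_zero] at h
    rintro (⟨h1, h2⟩ | ⟨-, h1, h2⟩) <;> linarith
  | succ p ih =>
    intro i h
    have h1 : t i ≤ t (i + 1) := ht (by omega)
    have h2 : t (i + 1) ≤ t (i + p + 1) := ht (by omega)
    have h3 : t (i + p + 1) ≤ t (i + (p + 1) + 1) := ht (by omega)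
    have e : i + 1 + p + 1 = i + (p + 1) + 1 := by ring
    rw [bspline, ih i (by linarith), ih (i + 1) (by rw [e]; linarith)]
    simp

/-- The B-splines of degree `0` form a partition of unity. -/
lemma sum_degree_zero {t : ℕ → ℝ} (ht : Monotone t) {n : ℕ} (h0 : t 0 = 0) (h1 : ∀ i, t i ≤ 1)
    (hn : t (n + 1) = 1) {x : ℝ} (hx : x ∈ Icc (0 : ℝ) 1) :
    ∑ i ∈ Finset.range (n + 1), bspline t 0 i x = 1 := by
  classical
  -- `ind i` records that the knot `t i` has been passed. Degree-zero B-splines are its differences,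
  -- so the sum telescopes. At `x = 1` the strict inequality matches the closed last interval.
  let ind : ℕ → ℝ := fun i => if (if x = 1 then t i < 1 else t i ≤ x) then 1 else 0
  have key : ∀ i, bspline t 0 i x = ind i - ind (i + 1) := by
    intro i
    have hm : t i ≤ t (i + 1) := ht (Nat.le_succ i)
    have := h1 (i + 1)
    simp only [bspline, ind]
    by_cases hx1 : x = 1
    · subst hx1
      rcases this.lt_or_eq with h | h
      · simp [h, h.ne, hm.trans_lt h, h.le]
      · simp [h]
    · simp only [hx1, false_and, or_false, if_false]
      by_cases ha : t i ≤ x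
      · by_cases hb : t (i + 1) ≤ x
        · simp [ha, hb, not_lt.2 hb]
        · simp [ha, hb, not_le.1 hb]
      · have hb : ¬ t (i + 1) ≤ x := fun h => ha (hm.trans h)
        simp [ha, hb]
  simp only [key]
  rw [Finset.sum_range_sub']
  have e0 : ind 0 = 1 := by
    simp only [ind, h0]
    by_cases hx1 : x = 1 <;> simp [hx1, hx.1]
  have e1 : ind (n + 1) = 0 := by
    simp only [ind, hn]
    by_cases hx1 : x = 1
    · simp [hx1]
    · have : ¬ (1 : ℝ) ≤ x := fun h => hx1 (le_antisymm hx.2 h)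
      simp [hx1, this]
  rw [e0, e1, sub_zero]

/-- Marsden's identity, as an identity of polynomials in a variable centered at `c`. -/
lemma marsden {t : ℕ → ℝ} (ht : Monotone t) {n d : ℕ} (h0 : ∀ i ≤ d, t i = 0)
    (h1 : ∀ i, t i ≤ 1) (hn : ∀ i, n < i → t i = 1) {x : ℝ} (hx : x ∈ Icc (0 : ℝ) 1) (c : ℝ) :
    ∀ p ≤ d, ∑ i ∈ Finset.range (n + 1), C (bspline t p i x) *
      ∏ r ∈ Finset.range p, (X + C (c - t (i + r + 1))) = (X + C (c - x)) ^ p := by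
  intro p
  induction p with
  | zero =>
    intro _
    have := sum_degree_zero ht (h0 0 (Nat.zero_le _)) h1 (hn (n + 1) (Nat.lt_succ_self n)) hx
    simp only [Finset.range_zero, Finset.prod_empty, mul_one, pow_zero]
    rw [← map_sum, this, map_one]
  | succ p ih =>
    intro hp
    have ih := ih (by omega)
    -- `G (i + 1)` is the second Cox-de Boor term of index `i`. The clamped knots make `G` vanish at
    -- both ends of the index range, so the summation can be shifted without boundary terms.
    set G : ℕ → ℝ[X] := fun i =>
      C ((t (i + p + 1) - x) / (t (i + p + 1) - t i) * bspline t p i x) *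
        ∏ r ∈ Finset.range (p + 1), (X + C (c - t (i + r))) with hG
    have hG0 : G 0 = 0 := by
      have : bspline t p 0 x = 0 :=
        eq_zero_of_eq ht p 0 (by rw [h0 0 (by omega), h0 _ (by omega)])
      simp [hG, this]
    have hG1 : G (n + 1) = 0 := by
      have : bspline t p (n + 1) x = 0 :=
        eq_zero_of_eq ht p (n + 1) (by rw [hn _ (by omega), hn _ (by omega)])
      simp [hG, this]
    have hshift : ∑ i ∈ Finset.range (n + 1), G (i + 1) = ∑ i ∈ Finset.range (n + 1), G i := by
      have e1 := Finset.sum_range_succ' G (n + 1)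
      have e2 := Finset.sum_range_succ G (n + 1)
      rw [hG0, add_zero] at e1
      rw [hG1, add_zero] at e2
      rw [← e1, e2]
    have hsplit : ∀ i, C (bspline t (p + 1) i x) *
          ∏ r ∈ Finset.range (p + 1), (X + C (c - t (i + r + 1))) =
        C ((x - t i) / (t (i + p + 1) - t i) * bspline t p i x) *
          ∏ r ∈ Finset.range (p + 1), (X + C (c - t (i + r + 1))) + G (i + 1) := by
      intro i
      have e : ∀ r, i + r + 1 = i + 1 + r := fun r => by ring
      have e' : i + 1 + p + 1 = i + p + 2 := by ring
      simp only [hG, e', bspline, e, map_add, add_mul]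
    rw [Finset.sum_congr rfl fun i _ => hsplit i, Finset.sum_add_distrib, hshift,
      ← Finset.sum_add_distrib, pow_succ, ← ih, Finset.sum_mul]
    refine Finset.sum_congr rfl fun i _ => ?_
    by_cases he : t i = t (i + p + 1)
    · simp [hG, eq_zero_of_eq ht p i he]
    · have hne : t (i + p + 1) - t i ≠ 0 := fun h => he (by linarith)
      simp only [hG]
      rw [Finset.prod_range_succ, Finset.prod_range_succ']
      simp only [add_zero, ← add_assoc]
      -- The two Cox-de Boor weights are the barycentric coordinates of `x` with respect to `t i`
      -- and `t (i + p + 1)`. The two linear factors therefore average to the factor with root shift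
      -- `x`.
      have a1 : C ((x - t i) / (t (i + p + 1) - t i) * bspline t p i x) *
            (X + C (c - t (i + p + 1))) +
          C ((t (i + p + 1) - x) / (t (i + p + 1) - t i) * bspline t p i x) * (X + C (c - t i)) =
          C (bspline t p i x) * (X + C (c - x)) := by
        have b1 : (x - t i) / (t (i + p + 1) - t i) * bspline t p i x +
            (t (i + p + 1) - x) / (t (i + p + 1) - t i) * bspline t p i x =
              bspline t p i x := by
          field_simp; ring
        have b2 : (x - t i) / (t (i + p + 1) - t i) * bspline t p i x * (c - t (i + p + 1)) +
            (t (i + p + 1) - x) / (t (i + p + 1) - t i) * bspline t p i x * (c - t i) =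
              bspline t p i x * (c - x) := by
          field_simp; ring
        rw [mul_add, mul_add, mul_add, ← C_mul, ← C_mul, ← C_mul, ← b2, C_add]
        nth_rewrite 5 [← b1]
        rw [C_add]
        ring
      linear_combination (∏ r ∈ Finset.range p, (X + C (c - t (i + r + 1)))) * a1

/-- Reversal of the knots. -/
lemma reverse {t : ℕ → ℝ} {N : ℕ} (ht : ∀ i j, i + j = N + 1 → t i + t j = 1) {x : ℝ}
    (hx : x ∈ Ioo (0 : ℝ) 1) (hk : ∀ i, t i ≠ x) :
    ∀ p i j, i + j + p = N → bspline t p j (1 - x) = bspline t p i x := by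
  intro p
  induction p with
  | zero =>
    intro i j h
    have e1 := ht i (j + 1) (by omega)
    have e2 := ht (i + 1) j (by omega)
    have n1 : x ≠ 1 := hx.2.ne
    have n2 : 1 - x ≠ 1 := by linarith [hx.1]
    -- Since `x` is not a knot, the half-open knot intervals can be reflected without regard to
    -- which end is closed.
    have l1 := hk i
    have l2 := hk (i + 1)
    simp only [bspline, n1, n2, false_and, or_false]
    congr 1
    rw [eq_iff_iff]
    constructor
    · rintro ⟨a, b⟩
      exact ⟨by linarith, lt_of_le_of_ne (by linarith) (Ne.symm l2)⟩
    · rintro ⟨a, b⟩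
      have : t i < x := lt_of_le_of_ne a l1
      exact ⟨by linarith, by linarith⟩
  | succ p ih =>
    intro i j h
    rw [bspline, bspline, ih (i + 1) j (by omega), ih i (j + 1) (by omega)]
    have e1 := ht i (j + p + 2) (by omega)
    have e2 := ht (i + 1) (j + p + 1) (by omega)
    have e3 := ht (i + p + 1) (j + 1) (by omega)
    have e4 := ht (i + p + 2) j (by omega)
    rw [show t (j + p + 1) = 1 - t (i + 1) by linarith, show t j = 1 - t (i + p + 2) by linarith,
      show t (j + p + 2) = 1 - t i by linarith, show t (j + 1) = 1 - t (i + p + 1) by linarith]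
    ring

/-- The first B-splines on the first knot interval modulo `x ^ 3`. -/
lemma expansion_at_zero {t : ℕ → ℝ} (ht : Monotone t) {d : ℕ} {τ : ℝ} (hτ0 : 0 < τ)
    (hτ1 : τ ≤ 1) (h0 : ∀ i ≤ d, t i = 0) (h1 : ∀ i, d < i → i ≤ d + 3 → t i = τ) :
    ∀ p i m, i + p = d + m → ∃ Q : ℝ[X], ∀ x ∈ Ico 0 τ, bspline t p i x =
      (if m = 0 then 1 - p * (x / τ) + p * (p - 1) / 2 * (x / τ) ^ 2
        else if m = 1 then p * (x / τ) - p * (p - 1) * (x / τ) ^ 2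
        else if m = 2 then p * (p - 1) / 2 * (x / τ) ^ 2 else 0) + x ^ 3 * Q.eval x := by
  have hd1 : ∀ i, d < i → τ ≤ t i := fun i hi => by
    rw [← h1 (d + 1) (by omega) (by omega)]; exact ht (by omega)
  intro p
  induction p with
  | zero =>
    intro i m him
    refine ⟨0, fun x hx => ?_⟩
    have hx1 : x ≠ 1 := (hx.2.trans_le hτ1).ne
    simp only [add_zero] at him
    subst him
    rcases Nat.eq_zero_or_pos m with rfl | hm
    · simp [bspline, hx1, h0, hx.1, h1 (d + 1) (by omega) (by omega), hx.2]
    · rw [eq_zero_of_lt ht _ _ (hx.2.trans_le (hd1 _ (by omega)))]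
      simp [hm.ne']
  | succ p ih =>
    intro i m him
    have hτ := hτ0.ne'
    rcases lt_or_ge 2 m with hm | hm
    · have m0 : m ≠ 0 := by omega
      have m1 : m ≠ 1 := by omega
      have m2 : m ≠ 2 := by omega
      simp only [m0, m1, m2, if_false, zero_add]
      rcases Nat.lt_or_ge d i with hi | hi
      · exact ⟨0, fun x hx => by
          rw [eq_zero_of_lt ht _ _ (hx.2.trans_le (hd1 _ hi))]; simp⟩
      · obtain ⟨Q1, hQ1⟩ := ih i (m - 1) (by omega)
        obtain ⟨Q2, hQ2⟩ := ih (i + 1) m (by omega)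
        simp only [m0, m1, m2, if_false, zero_add] at hQ2
        have m3 : m - 1 ≠ 0 := by omega
        have m4 : m - 1 ≠ 1 := by omega
        simp only [m3, m4, if_false] at hQ1
        -- Here `t i = 0`, so the first term carries a factor `x`. Only for `m - 1 = 2` does the
        -- lower-degree spline have a term below `x ^ 3`, namely a multiple of `x ^ 2`, which now
        -- enters the remainder.
        refine ⟨C (1 / (t (i + p + 1) - t i)) * (C (if m - 1 = 2 then p * (p - 1) / 2 / τ ^ 2 else 0)
          + X * Q1) + C (1 / (t (i + p + 2) - t (i + 1))) * (C (t (i + p + 2)) - X) * Q2,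
          fun x hx => ?_⟩
        rw [bspline, hQ1 x hx, hQ2 x hx, h0 i hi]
        simp only [eval_add, eval_mul, eval_C, eval_X, eval_sub]
        split_ifs <;> ring
    -- For `m ≤ 2` the right end knot has index `d + m + 1 ≤ d + 3`, hence equals `τ`, and the
    -- recursion is that of the Bernstein polynomials on `[0, τ]`. This is where three coinciding
    -- inner knots are needed.
    · have f2 : ∀ x ∈ Ico 0 τ, (t (i + p + 2) - x) / (t (i + p + 2) - t (i + 1)) *
          bspline t p (i + 1) x = (1 - x / τ) * bspline t p (i + 1) x := by
        intro x hx
        rcases Nat.lt_or_ge d (i + 1) with hi | hi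
        · rw [eq_zero_of_lt ht _ _ (hx.2.trans_le (hd1 _ hi))]; simp
        · rw [h0 _ hi, h1 (i + p + 2) (by omega) (by omega)]
          field_simp
          ring
      obtain ⟨Q2, hQ2⟩ := ih (i + 1) m (by omega)
      rcases Nat.eq_zero_or_pos m with rfl | hm0
      · simp only [if_true] at hQ2 ⊢
        refine ⟨C (- (p * (p - 1) / 2 / τ ^ 3)) + (1 - C (1 / τ) * X) * Q2, fun x hx => ?_⟩
        rw [bspline, eq_zero_of_eq ht p i (by rw [h0 _ (by omega), h0 _ (by omega)]), f2 x hx,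
          hQ2 x hx]
        simp only [eval_add, eval_mul, eval_C, eval_X, eval_sub, eval_one]
        push_cast
        field_simp
        ring
      · have f1 : ∀ x ∈ Ico 0 τ, (x - t i) / (t (i + p + 1) - t i) * bspline t p i x
            = x / τ * bspline t p i x := by
          intro x hx
          rcases Nat.lt_or_ge d i with hi | hi
          · rw [eq_zero_of_lt ht _ _ (hx.2.trans_le (hd1 _ hi))]; simp
          · rw [h0 _ hi, h1 (i + p + 1) (by omega) (by omega)]
            simp
        obtain ⟨Q1, hQ1⟩ := ih i (m - 1) (by omega)
        obtain rfl | rfl : m = 1 ∨ m = 2 := by omega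
        · norm_num at hQ1 hQ2 ⊢
          refine ⟨C (p * (p - 1) / 2 / τ ^ 3 + p * (p - 1) / τ ^ 3) + C (1 / τ) * X * Q1
            + (1 - C (1 / τ) * X) * Q2, fun x hx hx' => ?_⟩
          rw [bspline, f1 x ⟨hx, hx'⟩, f2 x ⟨hx, hx'⟩, hQ1 x hx hx',
            hQ2 x hx hx']
          simp only [eval_add, eval_mul, eval_C, eval_X, eval_sub, eval_one]
          field_simp
          ring
        · norm_num at hQ1 hQ2 ⊢
          refine ⟨C (- (p * (p - 1) / τ ^ 3) - p * (p - 1) / 2 / τ ^ 3) + C (1 / τ) * X * Q1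
            + (1 - C (1 / τ) * X) * Q2, fun x hx hx' => ?_⟩
          rw [bspline, f1 x ⟨hx, hx'⟩, f2 x ⟨hx, hx'⟩, hQ1 x hx hx',
            hQ2 x hx hx']
          simp only [eval_add, eval_mul, eval_C, eval_X, eval_sub, eval_one]
          field_simp
          ring

end BSpline

namespace BSpline

open Polynomial

/-! ### The spline space with inner knots of multiplicity `d - 2` -/

/-- The breakpoints `(j + 1) / (k + 1)`. -/
def breakpoint (k j : ℕ) : ℝ := ((j : ℝ) + 1) / ((k : ℝ) + 1)

lemma breakpoint_pos (k j : ℕ) : 0 < breakpoint k j := by unfold breakpoint; positivity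

lemma breakpoint_last (k : ℕ) : breakpoint k k = 1 := by
  unfold breakpoint; exact div_self (by positivity)

lemma breakpoint_strictMono (k : ℕ) : StrictMono (breakpoint k) := fun i j h => by
  unfold breakpoint
  have : (i : ℝ) < j := by exact_mod_cast h
  gcongr

lemma breakpoint_le_one {k j : ℕ} (h : j ≤ k) : breakpoint k j ≤ 1 :=
  (breakpoint_last k) ▸ (breakpoint_strictMono k).monotone h

lemma breakpoint_add {k i j : ℕ} (h : i + j + 1 = k) :
    breakpoint k i + breakpoint k j = 1 := by
  unfold breakpoint
  have : (i : ℝ) + j + 1 = k := by exact_mod_cast h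
  rw [← add_div, ← this]
  exact (div_eq_one_iff_eq (by positivity)).2 (by ring)

variable {d k : ℕ}

lemma knot_of_le {i : ℕ} (h : i ≤ d) : knot d k i = 0 := by simp [knot, h]

lemma knot_of_gt {i : ℕ} (h : maxIndex d k < i) : knot d k i = 1 := by
  have : d ≤ maxIndex d k := Nat.le_add_right _ _
  rw [knot, if_neg (by omega), if_neg (by omega)]

lemma knot_inner {j r : ℕ} (hj : j ≤ k) (hr : r < d - 2) :
    knot d k (d + 1 + j * (d - 2) + r) = breakpoint k j := by
  rcases hj.lt_or_eq with h | rfl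
  · have h1 : (j + 1) * (d - 2) ≤ k * (d - 2) := Nat.mul_le_mul_right _ h
    have h2 : (j + 1) * (d - 2) = j * (d - 2) + (d - 2) := by ring
    rw [knot, if_neg (by omega), if_pos (by rw [maxIndex]; omega)]
    have h3 : d + 1 + j * (d - 2) + r - d - 1 = r + (d - 2) * j := by
      rw [mul_comm (d - 2) j]; omega
    rw [h3, Nat.add_mul_div_left _ _ (by omega), Nat.div_eq_of_lt hr]
    simp [breakpoint]
  · rw [knot_of_gt (by rw [maxIndex]; omega), breakpoint_last]

lemma knot_monotone (d k : ℕ) : Monotone (knot d k) := by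
  intro i j hij
  unfold knot
  split_ifs with h1 h2 h3 h4 h5 h6
  · exact le_rfl
  · positivity
  · exact zero_le_one
  · omega
  · gcongr
  · rw [div_le_one (by positivity)]
    have : (i - d - 1) / (d - 2) < k := by
      apply Nat.div_lt_of_lt_mul
      have : i ≤ d + k * (d - 2) := h4
      rw [mul_comm]
      omega
    exact_mod_cast (by omega : (i - d - 1) / (d - 2) + 1 ≤ k + 1)
  · omega
  · omega
  · exact le_rfl

lemma knot_le_one (d k i : ℕ) : knot d k i ≤ 1 := by
  have h := knot_monotone d k (le_max_left i (maxIndex d k + 1))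
  rwa [knot_of_gt (lt_of_lt_of_le (Nat.lt_succ_self _) (le_max_right _ _))] at h

/-- The indices of the knots between `d` and `maxIndex d k`. -/
lemma exists_inner_index (hd : 3 ≤ d) {i : ℕ} (h1 : d < i) (h2 : i ≤ maxIndex d k) :
    ∃ j r, j < k ∧ r < d - 2 ∧ i = d + 1 + j * (d - 2) + r := by
  refine ⟨(i - d - 1) / (d - 2), (i - d - 1) % (d - 2), ?_, Nat.mod_lt _ (by omega), ?_⟩
  · apply Nat.div_lt_of_lt_mul
    have : i ≤ d + k * (d - 2) := h2
    rw [mul_comm]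
    omega
  · have := Nat.div_add_mod' (i - d - 1) (d - 2)
    omega

lemma knot_reverse (hd : 3 ≤ d) {i j : ℕ} (h : i + j = maxIndex d k + d + 1) :
    knot d k i + knot d k j = 1 := by
  have hn : maxIndex d k = d + k * (d - 2) := rfl
  rcases Nat.lt_or_ge d i with hi | hi
  · rcases Nat.lt_or_ge (maxIndex d k) i with hi' | hi'
    · rw [knot_of_gt hi', knot_of_le (by omega), add_zero]
    · obtain ⟨a, r, ha, hr, rfl⟩ := exists_inner_index hd hi hi'
      obtain ⟨b, rfl⟩ : ∃ b, k = a + b + 1 := ⟨k - a - 1, by omega⟩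
      have e : (a + b + 1) * (d - 2) = a * (d - 2) + b * (d - 2) + (d - 2) := by ring
      have ej : j = d + 1 + b * (d - 2) + (d - 3 - r) := by omega
      rw [ej, knot_inner ha.le hr, knot_inner (by omega) (by omega), breakpoint_add rfl]
  · rw [knot_of_le hi, knot_of_gt (by omega), zero_add]

/-- The functions which agree on `[0,1]` with a linear combination of B-splines. -/
def splineSpace (d k : ℕ) : Submodule ℝ (ℝ → ℝ) where
  carrier := {f | ∃ c : Fin (maxIndex d k + 1) → ℝ,
    ∀ x ∈ Icc (0 : ℝ) 1, f x = ∑ i, c i * bspline (knot d k) d i x}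
  zero_mem' := ⟨0, by simp⟩
  add_mem' := by
    rintro f g ⟨c, hc⟩ ⟨c', hc'⟩
    exact ⟨c + c', fun x hx => by simp [hc x hx, hc' x hx, add_mul, Finset.sum_add_distrib]⟩
  smul_mem' := by
    rintro a f ⟨c, hc⟩
    exact ⟨a • c, fun x hx => by simp [hc x hx, mul_assoc, Finset.mul_sum]⟩

lemma mem_of_eqOn {f g : ℝ → ℝ} (hg : g ∈ splineSpace d k) (h : EqOn f g (Icc 0 1)) :
    f ∈ splineSpace d k := by
  obtain ⟨c, hc⟩ := hg
  exact ⟨c, fun x hx => (h hx).trans (hc x hx)⟩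

lemma mem_of_range {f : ℝ → ℝ} {c : ℕ → ℝ} (h : ∀ x ∈ Icc (0 : ℝ) 1,
    f x = ∑ i ∈ Finset.range (maxIndex d k + 1), c i * bspline (knot d k) d i x) :
    f ∈ splineSpace d k :=
  ⟨fun i => c i, fun x hx => by
    rw [h x hx, Finset.sum_range (fun i => c i * bspline (knot d k) d i x)]⟩

/-- Marsden's identity for the knot vector `knot d k`, in terms of coefficients. -/
lemma marsden_coeff {x : ℝ} (hx : x ∈ Icc (0 : ℝ) 1) (c : ℝ) (l : ℕ) :
    ∑ i ∈ Finset.range (maxIndex d k + 1),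
      (∏ r ∈ Finset.range d, (X + C (c - knot d k (i + r + 1)))).coeff l *
        bspline (knot d k) d i x = (c - x) ^ (d - l) * d.choose l := by
  have := marsden (knot_monotone d k) (fun i hi => knot_of_le (k := k) hi) (knot_le_one d k)
    (fun i => knot_of_gt) hx c d le_rfl
  replace this := congrArg (fun P => coeff P l) this
  simp only [finsetSum_coeff, coeff_C_mul] at this
  rw [coeff_X_add_C_pow] at this
  rw [← this]
  exact Finset.sum_congr rfl fun i _ => mul_comm _ _

lemma one_sub_pow_mem {e : ℕ} (he : e ≤ d) : (fun x : ℝ => (1 - x) ^ e) ∈ splineSpace d k := by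
  have h : (d.choose (d - e) : ℝ) ≠ 0 := by
    exact_mod_cast (Nat.choose_pos (Nat.sub_le d e)).ne'
  refine mem_of_range (c := fun i => (d.choose (d - e) : ℝ)⁻¹ *
    (∏ r ∈ Finset.range d, (X + C (1 - knot d k (i + r + 1)))).coeff (d - e)) fun x hx => ?_
  simp only [mul_assoc]
  rw [← Finset.mul_sum, marsden_coeff hx]
  rw [Nat.sub_sub_self he]
  field_simp

/-- Truncated powers at the inner knots. -/
lemma truncated_pow_mem {e j : ℕ} (he3 : 3 ≤ e) (he : e ≤ d) (hj : j < k) :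
    (fun x : ℝ => (max (breakpoint k j - x) 0) ^ e) ∈ splineSpace d k := by
  set l := d - e with hl
  have hel : e = d - l := by omega
  set τ := breakpoint k j with hτ
  have hτ1 : τ < 1 := by
    rw [hτ, ← breakpoint_last k]; exact breakpoint_strictMono k hj
  have h : (d.choose l : ℝ) ≠ 0 := by
    exact_mod_cast (Nat.choose_pos (Nat.sub_le d e)).ne'
  have hmon := knot_monotone d k
  have hσ : d + 1 + j * (d - 2) + 0 = d + j * (d - 2) + 1 := by ring
  -- These are the Marsden coefficients of `(τ - x) ^ e`, cut off after the last B-spline whose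
  -- support begins before `τ`. To the left of `τ` the discarded B-splines vanish. To the right each
  -- kept summand vanishes.
  refine mem_of_range (c := fun i => if i ≤ d + j * (d - 2) then (d.choose l : ℝ)⁻¹ *
    (∏ r ∈ Finset.range d, (X + C (τ - knot d k (i + r + 1)))).coeff l else 0) fun x hx => ?_
  rcases lt_or_ge x τ with hxτ | hxτ
  · rw [max_eq_left (by linarith)]
    have hz : ∀ i, ¬ i ≤ d + j * (d - 2) → bspline (knot d k) d i x = 0 := fun i hi =>
      eq_zero_of_lt hmon _ _ (hxτ.trans_le (by
        rw [hτ, ← knot_inner hj.le (show 0 < d - 2 by omega)]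
        exact hmon (by omega)))
    have := marsden_coeff (d := d) (k := k) hx τ l
    rw [← hel] at this
    rw [show (τ - x) ^ e = (d.choose l : ℝ)⁻¹ * ((τ - x) ^ e * d.choose l) by field_simp,
      ← this, Finset.mul_sum]
    refine Finset.sum_congr rfl fun i _ => ?_
    split_ifs with hi
    · ring
    · rw [hz i hi]; simp
  · rw [max_eq_right (by linarith), zero_pow (by omega)]
    symm
    refine Finset.sum_eq_zero fun i _ => ?_
    split_ifs with hi
    · rcases Nat.lt_or_ge (d + j * (d - 2) + (d - 2)) (i + d + 1) with h' | h'
      -- If the support of the B-spline reaches beyond `τ`, all `d - 2` copies of `τ` are among its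
      -- inner knots, and each gives a factor `X` when centering at `τ`. The coefficient of order `l
      -- = d - e ≤ d - 3` is then zero.
      · have hdvd : (X : ℝ[X]) ^ (d - 2) ∣
            ∏ r ∈ Finset.range d, (X + C (τ - knot d k (i + r + 1))) := by
          set m0 := d + j * (d - 2) - i with hm0
          have hsub : (Finset.range (d - 2)).image (m0 + ·) ⊆ Finset.range d := by
            intro r hr
            simp only [Finset.mem_image, Finset.mem_range] at hr ⊢
            obtain ⟨a, ha, rfl⟩ := hr
            omega
          refine dvd_trans (dvd_of_eq ?_) (Finset.prod_dvd_prod_of_subset _ _ _ hsub)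
          rw [Finset.prod_image (fun a _ b _ hab => by simpa using hab)]
          rw [Finset.prod_congr rfl (g := fun _ => (X : ℝ[X]))]
          · simp
          · intro r hr
            have hr' : r < d - 2 := Finset.mem_range.1 hr
            rw [show i + (m0 + r) + 1 = d + 1 + j * (d - 2) + r by omega,
              knot_inner hj.le hr', ← hτ]
            simp
        rw [X_pow_dvd_iff.1 hdvd l (by omega)]
        simp
      · have hk : knot d k (i + d + 1) ≤ τ := by
          rw [hτ, ← knot_inner hj.le (show d - 2 - 1 < d - 2 by omega)]
          exact hmon (by omega)
        rw [eq_zero_of_le hmon d i (hk.trans hxτ) (Or.inl (hk.trans_lt hτ1)), mul_zero]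
    · simp

lemma truncated_pow_mem' {e j : ℕ} (he3 : 3 ≤ e) (he : e ≤ d) (hj : j ≤ k) :
    (fun x : ℝ => (max (breakpoint k j - x) 0) ^ e) ∈ splineSpace d k := by
  rcases hj.lt_or_eq with h | rfl
  · exact truncated_pow_mem he3 he h
  · refine mem_of_eqOn (one_sub_pow_mem he) fun x hx => ?_
    simp only [breakpoint_last]
    rw [max_eq_left (by linarith [hx.2])]

/-- Polynomial multiples of truncated powers. -/
lemma truncated_pow_mul_mem {e j : ℕ} (he3 : 3 ≤ e) (hj : j ≤ k) (p : ℝ[X])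
    (hp : e + p.natDegree ≤ d) :
    (fun x : ℝ => (max (breakpoint k j - x) 0) ^ e * p.eval x) ∈ splineSpace d k := by
  set τ := breakpoint k j with hτ
  have hexp : ∀ x, p.eval x = ∑ m ∈ Finset.range (p.natDegree + 1),
      ((-1) ^ m * (taylor τ p).coeff m) * (τ - x) ^ m := by
    intro x
    have h := taylor_eval_sub τ p x
    rw [← h, eval_eq_sum_range, natDegree_taylor]
    refine Finset.sum_congr rfl fun m _ => ?_
    rw [show τ - x = -1 * (x - τ) by ring, mul_pow, ← mul_assoc, mul_right_comm _ _ ((-1 : ℝ) ^ m),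
      ← pow_add, ← two_mul, pow_mul]
    norm_num
  have : (fun x : ℝ => (max (τ - x) 0) ^ e * p.eval x) =
      ∑ m ∈ Finset.range (p.natDegree + 1), ((-1) ^ m * (taylor τ p).coeff m) •
        fun x : ℝ => (max (τ - x) 0) ^ (e + m) := by
    funext x
    simp only [Finset.sum_apply, Pi.smul_apply, smul_eq_mul]
    rw [hexp, Finset.mul_sum]
    refine Finset.sum_congr rfl fun m _ => ?_
    rcases le_total τ x with h | h
    · rw [max_eq_right (by linarith), zero_pow (by omega), zero_pow (by omega)]; simp
    · rw [max_eq_left (by linarith), pow_add]; ring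
  rw [this]
  refine Submodule.sum_mem _ fun m hm => Submodule.smul_mem _ _ ?_
  have := Finset.mem_range.1 hm
  exact truncated_pow_mem' (by omega) (by omega) hj

end BSpline

namespace BSpline

open Polynomial

/-! ### Smoothness and linear independence of the B-splines -/

lemma hasDerivAt_max_pow (e : ℕ) (y : ℝ) :
    HasDerivAt (fun y : ℝ => (max y 0) ^ (e + 2)) ((e + 2) * (max y 0) ^ (e + 1)) y := by
  have hp : HasDerivAt (fun y : ℝ => y ^ (e + 2)) ((e + 2) * y ^ (e + 1)) y := by
    have := hasDerivAt_pow (e + 2) y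
    simpa using this
  rcases lt_trichotomy y 0 with h | rfl | h
  · rw [max_eq_right h.le, zero_pow (by omega), mul_zero]
    refine (hasDerivAt_const y (0 : ℝ)).congr_of_eventuallyEq ?_
    filter_upwards [Iio_mem_nhds h] with z hz
    rw [max_eq_right (mem_Iio.1 hz).le, zero_pow (by omega)]
  · rw [max_self, ← hasDerivWithinAt_univ, ← Iic_union_Ici (a := (0 : ℝ))]
    refine HasDerivWithinAt.union ?_ ?_
    · rw [zero_pow (by omega), mul_zero]
      refine (hasDerivWithinAt_const (0 : ℝ) (Iic 0) (0 : ℝ)).congr (fun z hz => ?_) (by simp)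
      rw [max_eq_right hz, zero_pow (by omega)]
    · refine hp.hasDerivWithinAt.congr (fun z hz => ?_) (by simp)
      rw [max_eq_left hz]
  · rw [max_eq_left h.le]
    refine hp.congr_of_eventuallyEq ?_
    filter_upwards [Ioi_mem_nhds h] with z hz
    rw [max_eq_left (mem_Ioi.1 hz).le]

lemma contDiff_max_pow (n : ℕ) : ∀ e, n < e → ContDiff ℝ n (fun y : ℝ => (max y 0) ^ e) := by
  induction n with
  | zero =>
    intro e _
    exact contDiff_zero.2 (by fun_prop)
  | succ n ih =>
    intro e he
    obtain ⟨e, rfl⟩ : ∃ e', e = e' + 2 := ⟨e - 2, by omega⟩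
    rw [Nat.cast_succ, contDiff_succ_iff_deriv]
    refine ⟨fun y => (hasDerivAt_max_pow e y).differentiableAt, by simp, ?_⟩
    have : deriv (fun y : ℝ => (max y 0) ^ (e + 2)) = fun y => (e + 2 : ℝ) * (max y 0) ^ (e + 1) :=
      funext fun y => (hasDerivAt_max_pow e y).deriv
    rw [this]
    exact contDiff_const.mul (ih _ (by omega))

lemma contDiff_truncated_pow {e : ℕ} (he : 3 ≤ e) (τ : ℝ) :
    ContDiff ℝ 2 (fun x : ℝ => (max (τ - x) 0) ^ e) :=
  (contDiff_max_pow 2 e he).comp (contDiff_const.sub contDiff_id)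

variable {d k : ℕ}

/-- Powers and truncated powers. -/
def powerFamily (d k : ℕ) : Fin (d + 1) ⊕ (Fin k × Fin (d - 2)) → ℝ → ℝ
  | Sum.inl q => fun x => (1 - x) ^ (q : ℕ)
  | Sum.inr jl => fun x => (max (breakpoint k jl.1 - x) 0) ^ (d - (jl.2 : ℕ))

lemma powerFamily_mem (x) : powerFamily d k x ∈ splineSpace d k := by
  rcases x with q | ⟨j, l⟩
  · exact one_sub_pow_mem (Nat.lt_succ_iff.1 q.2)
  · exact truncated_pow_mem (by omega) (by omega) j.2

lemma contDiff_powerFamily (x) : ContDiff ℝ 2 (powerFamily d k x) := by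
  rcases x with q | ⟨j, l⟩
  · exact (contDiff_const.sub contDiff_id).pow _
  · exact contDiff_truncated_pow (by omega) _

lemma poly_eq_zero_of_Ioo {p : ℝ[X]} {a b c : ℝ} (hab : a < b)
    (h : ∀ x ∈ Ioo a b, p.eval (c - x) = 0) : p = 0 := by
  refine Polynomial.eq_zero_of_infinite_isRoot p
    (((Ioo_infinite hab).image (f := fun x => c - x) (fun x _ y _ h => by simpa using h)).mono ?_)
  rintro _ ⟨x, hx, rfl⟩
  exact h x hx

/-- On the last knot interval all truncated powers vanish, which kills the polynomial part. Then the
breakpoints are treated from right to left: on the interval just left of breakpoint `j`, earlier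
truncated powers vanish and later ones already have zero coefficients. -/
lemma powerFamily_independent (g : Fin (d + 1) ⊕ (Fin k × Fin (d - 2)) → ℝ)
    (h : ∀ x ∈ Icc (0 : ℝ) 1, ∑ i, g i * powerFamily d k i x = 0) : g = 0 := by
  simp only [Fintype.sum_sum_type, Fintype.sum_prod_type, powerFamily] at h
  set p : Fin k → ℝ[X] := fun j => ∑ l, C (g (Sum.inr (j, l))) * X ^ (d - (l : ℕ)) with hp
  have hpe : ∀ j (x : ℝ), ∑ l, g (Sum.inr (j, l)) * x ^ (d - (l : ℕ)) = (p j).eval x := by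
    intro j x; simp [hp, eval_finsetSum]
  simp only [hpe] at h
  have hp0 : ∀ j, (p j).eval 0 = 0 := by
    intro j
    rw [← hpe]
    exact Finset.sum_eq_zero fun l _ => by rw [zero_pow (by omega), mul_zero]
  set q : ℝ[X] := ∑ i : Fin (d + 1), C (g (Sum.inl i)) * X ^ (i : ℕ) with hq
  have hqe : ∀ x : ℝ, ∑ i : Fin (d + 1), g (Sum.inl i) * x ^ (i : ℕ) = q.eval x := by
    intro x; simp [hq, eval_finsetSum]
  simp only [hqe] at h
  have hq0 : q = 0 := by
    have hlt : max 0 (breakpoint k k - breakpoint k 0) < 1 := by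
      rw [breakpoint_last]
      have := breakpoint_pos k 0
      exact max_lt one_pos (by linarith)
    refine poly_eq_zero_of_Ioo hlt (c := 1) fun x hx => ?_
    have h1 := h x ⟨(le_max_left _ _).trans hx.1.le, hx.2.le⟩
    rw [Finset.sum_eq_zero, add_zero] at h1
    · exact h1
    · intro j _
      rw [max_eq_right, hp0]
      have h2 := (le_max_right _ _).trans hx.1.le
      have h3 : breakpoint k j + breakpoint k 0 ≤ 1 := by
        rw [← breakpoint_add (show (j : ℕ) + (k - 1 - j) + 1 = k by omega)]
        have := (breakpoint_strictMono k).monotone (Nat.zero_le (k - 1 - (j : ℕ)))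
        linarith
      rw [breakpoint_last] at h2
      linarith
  have hpj : ∀ m (j : Fin k), k - 1 - (j : ℕ) = m → p j = 0 := by
    intro m
    induction m using Nat.strong_induction_on with
    | _ m ih =>
      intro j hj
      set a : ℝ := if (j : ℕ) = 0 then 0 else breakpoint k (j - 1) with ha
      have ha0 : 0 ≤ a := by
        rw [ha]; split_ifs
        · exact le_rfl
        · exact (breakpoint_pos _ _).le
      have hab : a < breakpoint k j := by
        rw [ha]; split_ifs
        · exact breakpoint_pos _ _
        · exact breakpoint_strictMono k (by omega)
      refine poly_eq_zero_of_Ioo hab (c := breakpoint k j) fun x hx => ?_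
      have h1 := h x ⟨ha0.trans hx.1.le, hx.2.le.trans (breakpoint_le_one j.2.le)⟩
      rw [hq0, eval_zero, zero_add, Finset.sum_eq_single j] at h1
      · rwa [max_eq_left (by linarith [hx.2])] at h1
      · intro i _ hij
        rcases lt_or_gt_of_ne (fun h => hij (Fin.ext h) : (i : ℕ) ≠ j) with hlt | hlt
        · rw [max_eq_right, hp0]
          have : breakpoint k i ≤ a := by
            rw [ha, if_neg (by omega)]
            exact (breakpoint_strictMono k).monotone (by omega)
          linarith [hx.1]
        · rw [ih (k - 1 - i) (by omega) i rfl, eval_zero]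
      · simp
  have coeff_eq : ∀ (i : Fin (d + 1)), q.coeff i = g (Sum.inl i) := by
    intro i
    simp only [hq, finsetSum_coeff, coeff_C_mul, coeff_X_pow]
    rw [Finset.sum_eq_single i]
    · simp
    · intro b _ hb
      rw [if_neg (fun h => hb (Fin.ext h.symm)), mul_zero]
    · simp
  have coeff_eq' : ∀ (j : Fin k) (l : Fin (d - 2)), (p j).coeff (d - l) = g (Sum.inr (j, l)) := by
    intro j l
    simp only [hp, finsetSum_coeff, coeff_C_mul, coeff_X_pow]
    rw [Finset.sum_eq_single l]
    · simp
    · intro b _ hb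
      rw [if_neg (fun h => hb (Fin.ext (by omega))), mul_zero]
    · simp
  funext i
  rcases i with i | ⟨j, l⟩
  · rw [← coeff_eq, hq0]; simp
  · rw [← coeff_eq', hpj _ j rfl]; simp

/-- Restrictions of the B-splines and of the powers to `[0,1]`. -/
lemma independent_and_span (d k : ℕ) :
    LinearIndependent ℝ (fun i : Fin (maxIndex d k + 1) =>
      fun x : Icc (0 : ℝ) 1 => bspline (knot d k) d i x) ∧
    Submodule.span ℝ (range fun i : Fin (maxIndex d k + 1) =>
      fun x : Icc (0 : ℝ) 1 => bspline (knot d k) d i x) =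
    Submodule.span ℝ (range fun i => fun x : Icc (0 : ℝ) 1 => powerFamily d k i x) := by
  set B := fun i : Fin (maxIndex d k + 1) =>
      fun x : Icc (0 : ℝ) 1 => bspline (knot d k) d i x with hB
  set T := fun i => fun x : Icc (0 : ℝ) 1 => powerFamily d k i x with hT
  have hTi : LinearIndependent ℝ T := by
    rw [Fintype.linearIndependent_iff]
    intro g hg i
    refine congrFun (powerFamily_independent g fun x hx => ?_) i
    have := congrFun hg ⟨x, hx⟩
    simpa [hT] using this
  have hle : Submodule.span ℝ (range T) ≤ Submodule.span ℝ (range B) := by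
    rw [Submodule.span_le]
    rintro _ ⟨i, rfl⟩
    obtain ⟨c, hc⟩ := powerFamily_mem (d := d) (k := k) i
    have : T i = ∑ j, c j • B j := by
      funext x
      simp [hT, hB, hc x.1 x.2]
    rw [this]
    exact Submodule.sum_mem _ fun j _ => Submodule.smul_mem _ _ (Submodule.subset_span ⟨j, rfl⟩)
  have : FiniteDimensional ℝ (Submodule.span ℝ (range B)) :=
    FiniteDimensional.span_of_finite ℝ (finite_range B)
  -- Dimension count: the power family has as many members as there are B-splines, is independent
  -- and lies in their span. Thus the spans agree and the B-splines are independent too.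
  have hcard : Fintype.card (Fin (d + 1) ⊕ (Fin k × Fin (d - 2))) = maxIndex d k + 1 := by
    simp [maxIndex]; ring
  have h1 : Module.finrank ℝ (Submodule.span ℝ (range T)) = maxIndex d k + 1 := by
    rw [finrank_span_eq_card hTi, hcard]
  have h2 : (range B).finrank ℝ ≤ maxIndex d k + 1 := by
    have := finrank_range_le_card (R := ℝ) B
    simpa using this
  have h3 := Submodule.finrank_mono hle
  have heq := Submodule.eq_of_le_of_finrank_le hle (by rw [h1]; exact h2)
  refine ⟨?_, heq.symm⟩
  rw [linearIndependent_iff_card_eq_finrank_span, Fintype.card_fin]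
  exact le_antisymm (h1.symm.le.trans h3) h2

/-- On `[0,1]` each B-spline is a combination of powers and truncated powers of exponent at least 3,
which are `C²` on the whole line. With such an extension ordinary derivatives can be used at the end
points as well. -/
lemma exists_extension (i : Fin (maxIndex d k + 1)) :
    ∃ f : ℝ → ℝ, ContDiff ℝ 2 f ∧ ∀ x ∈ Icc (0 : ℝ) 1, f x = bspline (knot d k) d i x := by
  have h := (independent_and_span d k).2
  have hi : (fun x : Icc (0 : ℝ) 1 => bspline (knot d k) d i x) ∈
      Submodule.span ℝ (range fun i => fun x : Icc (0 : ℝ) 1 => powerFamily d k i x) := by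
    rw [← h]; exact Submodule.subset_span ⟨i, rfl⟩
  obtain ⟨c, hc⟩ := (Submodule.mem_span_range_iff_exists_fun ℝ).1 hi
  refine ⟨fun x => ∑ j, c j * powerFamily d k j x, ?_, fun x hx => ?_⟩
  · exact ContDiff.sum fun j _ => contDiff_const.mul (contDiff_powerFamily j)
  · have := congrFun hc ⟨x, hx⟩
    simpa using this

/-- A `C²`-smooth extension of the B-spline `N_i` to the real line. -/
def smooth (d k : ℕ) (i : Fin (maxIndex d k + 1)) : ℝ → ℝ := (exists_extension i).choose

lemma contDiff_smooth (i : Fin (maxIndex d k + 1)) : ContDiff ℝ 2 (smooth d k i) :=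
  (exists_extension i).choose_spec.1

lemma smooth_eq (i : Fin (maxIndex d k + 1)) {x : ℝ} (hx : x ∈ Icc (0 : ℝ) 1) :
    smooth d k i x = bspline (knot d k) d i x :=
  (exists_extension i).choose_spec.2 x hx

lemma coeff_eq_zero {c : Fin (maxIndex d k + 1) → ℝ}
    (h : ∀ x ∈ Icc (0 : ℝ) 1, ∑ i, c i * smooth d k i x = 0) : c = 0 := by
  funext i
  refine Fintype.linearIndependent_iff.1 (independent_and_span d k).1 c ?_ i
  funext x
  have := h x.1 x.2
  simp only [smooth_eq _ x.2] at this
  simpa using this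

/-- The recursion can be reflected away from the knots. These points are dense, and both sides are
continuous. -/
lemma smooth_rev (hd : 3 ≤ d) (i : Fin (maxIndex d k + 1)) {x : ℝ} (hx : x ∈ Icc (0 : ℝ) 1) :
    smooth d k i.rev (1 - x) = smooth d k i x := by
  have hcl : IsClosed {x : ℝ | smooth d k i.rev (1 - x) = smooth d k i x} :=
    isClosed_eq ((contDiff_smooth _).continuous.comp (continuous_const.sub continuous_id))
      (contDiff_smooth _).continuous
  have hdense : Dense (range (knot d k))ᶜ := (countable_range _).dense_compl ℝ
  have hsub : Ioo (0 : ℝ) 1 ∩ (range (knot d k))ᶜ ⊆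
      {x : ℝ | smooth d k i.rev (1 - x) = smooth d k i x} := by
    rintro y ⟨hy, hk⟩
    have hy1 : y ∈ Icc (0 : ℝ) 1 := ⟨hy.1.le, hy.2.le⟩
    have hy2 : 1 - y ∈ Icc (0 : ℝ) 1 := ⟨by linarith [hy.2], by linarith [hy.1]⟩
    show smooth d k i.rev (1 - y) = smooth d k i y
    rw [smooth_eq _ hy1, smooth_eq _ hy2]
    refine reverse (N := maxIndex d k + d) (fun i j h => knot_reverse hd h) hy
      (fun j hj => hk ⟨j, hj⟩) d i i.rev ?_
    rw [Fin.val_rev]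
    omega
  have h1 := hdense.open_subset_closure_inter (isOpen_Ioo (a := (0 : ℝ)) (b := 1))
  have h2 := closure_minimal (h1.trans (closure_minimal hsub hcl)) hcl
  rw [closure_Ioo zero_ne_one] at h2
  exact h2 hx

end BSpline

/-! ### One-sided derivatives -/

/-- One-sided derivatives on an interval are unique. This permits reading off derivatives at an end
point when functions are compared only inside the parameter interval. -/
lemma HasDerivAt.eq_zero_of_Icc {F : Type*} [NormedAddCommGroup F] [NormedSpace ℝ F] {h : ℝ → F}
    {h' : F} {x a b : ℝ} (hd : HasDerivAt h h' x) (hab : a < b) (hx : x ∈ Icc a b)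
    (h0 : ∀ y ∈ Icc a b, h y = 0) : h' = 0 := by
  have h1 : HasDerivWithinAt h h' (Icc a b) x := hd.hasDerivWithinAt
  have h2 : HasDerivWithinAt h 0 (Icc a b) x :=
    (hasDerivWithinAt_const x (Icc a b) (0 : F)).congr h0 (h0 x hx)
  exact (uniqueDiffOn_Icc hab x hx).eq_deriv _ h1 h2

lemma ContDiff.differentiable_deriv {h : ℝ → ℝ} (hd : ContDiff ℝ 2 h) :
    Differentiable ℝ (deriv h) := by
  have : ContDiff ℝ (1 + 1) h := by simpa [one_add_one_eq_two] using hd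
  exact ((contDiff_succ_iff_deriv.1 this).2.2).differentiable one_ne_zero

lemma deriv_sum_mul {ι : Type*} (s : Finset ι) (c : ι → ℝ) {f : ι → ℝ → ℝ}
    (hf : ∀ i, Differentiable ℝ (f i)) :
    deriv (fun x => ∑ i ∈ s, c i * f i x) = fun x => ∑ i ∈ s, c i * deriv (f i) x := by
  funext x
  rw [deriv_fun_sum fun i _ => ((hf i x).const_mul (c i))]
  exact Finset.sum_congr rfl fun i _ => deriv_const_mul (c i) (hf i x)

/-- Two `C²`-smooth functions which agree on an interval have the same derivatives there. -/
lemma derivs_eq_of_Icc {f g : ℝ → ℝ} (hf : ContDiff ℝ 2 f) (hg : ContDiff ℝ 2 g) {a b : ℝ}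
    (hab : a < b) (h : ∀ y ∈ Icc a b, f y = g y) {x : ℝ} (hx : x ∈ Icc a b) :
    deriv f x = deriv g x ∧ deriv (deriv f) x = deriv (deriv g) x := by
  have df := hf.differentiable two_ne_zero
  have dg := hg.differentiable two_ne_zero
  have e1 : ∀ y ∈ Icc a b, deriv f y - deriv g y = 0 := fun y hy =>
    ((df y).hasDerivAt.sub (dg y).hasDerivAt).eq_zero_of_Icc hab hy fun z hz => by
      simp [h z hz]
  refine ⟨sub_eq_zero.1 (e1 x hx), sub_eq_zero.1 ?_⟩
  exact ((hf.differentiable_deriv x).hasDerivAt.sub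
    (hg.differentiable_deriv x).hasDerivAt).eq_zero_of_Icc hab hx e1

lemma Fin.sum_eq_first_three {n : ℕ} (hn : 2 ≤ n) (f : Fin (n + 1) → ℝ)
    (h : ∀ i : Fin (n + 1), 3 ≤ (i : ℕ) → f i = 0) :
    ∑ i, f i = f (Fin.ofNat (n + 1) 0) + f (Fin.ofNat (n + 1) 1) + f (Fin.ofNat (n + 1) 2) := by
  have h0 : (Fin.ofNat (n + 1) 0 : Fin (n + 1)).val = 0 := by simp
  have h1 : (Fin.ofNat (n + 1) 1 : Fin (n + 1)).val = 1 := Nat.mod_eq_of_lt (by omega)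
  have h2 : (Fin.ofNat (n + 1) 2 : Fin (n + 1)).val = 2 := Nat.mod_eq_of_lt (by omega)
  have hs : ∑ i, f i = ∑ i ∈ ({Fin.ofNat (n + 1) 0, Fin.ofNat (n + 1) 1,
      Fin.ofNat (n + 1) 2} : Finset (Fin (n + 1))), f i := by
    symm
    refine Finset.sum_subset (Finset.subset_univ _) fun i _ hi => h i ?_
    by_contra hlt
    apply hi
    simp only [Finset.mem_insert, Finset.mem_singleton, Fin.ext_iff, h0, h1, h2]
    omega
  rw [hs, Finset.sum_insert, Finset.sum_insert, Finset.sum_singleton, add_assoc]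
  · rw [Finset.mem_singleton, Fin.ext_iff, h1, h2]; decide
  · simp only [Finset.mem_insert, Finset.mem_singleton, Fin.ext_iff, h0, h1, h2]; decide

namespace BSpline

open Polynomial

variable {d k : ℕ}

/-! ### Values and derivatives of splines at the end points -/

lemma three_le (hd : 5 ≤ d) : 3 ≤ d := by omega

lemma differentiable_smooth (i : Fin (maxIndex d k + 1)) : Differentiable ℝ (smooth d k i) :=
  (contDiff_smooth i).differentiable two_ne_zero

lemma differentiable_deriv_smooth (i : Fin (maxIndex d k + 1)) :
    Differentiable ℝ (deriv (smooth d k i)) :=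
  (contDiff_smooth i).differentiable_deriv

lemma derivs_of_cubic_remainder {f : ℝ → ℝ} (hf : ContDiff ℝ 2 f) {a b c ε : ℝ} (hε : 0 < ε)
    {Q : ℝ[X]} (h : ∀ x ∈ Ico 0 ε, f x = a + b * x + c * x ^ 2 + x ^ 3 * Q.eval x) :
    f 0 = a ∧ deriv f 0 = b ∧ deriv (deriv f) 0 = 2 * c := by
  set P : ℝ[X] := C a + C b * X + C c * X ^ 2 + X ^ 3 * Q with hP
  have h' : ∀ y ∈ Icc 0 (ε / 2), f y = P.eval y := fun y hy => by
    rw [h y ⟨hy.1, by linarith [hy.2]⟩]; simp [hP]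
  have h0 : (0 : ℝ) ∈ Icc 0 (ε / 2) := ⟨le_rfl, by positivity⟩
  obtain ⟨e1, e2⟩ := derivs_eq_of_Icc hf (by simpa using P.contDiff_aeval (R := ℝ) (𝕜 := ℝ) 2) (half_pos hε) h' h0
  have d1 : deriv (fun x => P.eval x) = fun x => (derivative P).eval x := funext fun x => P.deriv
  have d2 : deriv (fun x => (derivative P).eval x) = fun x => (derivative (derivative P)).eval x :=
    funext fun x => (derivative P).deriv
  rw [d1] at e1 e2
  rw [d2] at e2
  refine ⟨by rw [h' 0 h0]; simp [hP], by rw [e1]; simp [hP], by rw [e2]; simp [hP]; ring⟩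

lemma smooth_derivs_zero (hd : 5 ≤ d) (i : Fin (maxIndex d k + 1)) :
    smooth d k i 0 = (if (i : ℕ) = 0 then 1 else 0) ∧
    deriv (smooth d k i) 0 = (if (i : ℕ) = 0 then - (d / breakpoint k 0)
      else if (i : ℕ) = 1 then d / breakpoint k 0 else 0) ∧
    deriv (deriv (smooth d k i)) 0 = (if (i : ℕ) = 0 then d * (d - 1) / breakpoint k 0 ^ 2
      else if (i : ℕ) = 1 then - (2 * (d * (d - 1) / breakpoint k 0 ^ 2))
      else if (i : ℕ) = 2 then d * (d - 1) / breakpoint k 0 ^ 2 else 0) := by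
  have hτ0 := breakpoint_pos k 0
  have hτ1 := breakpoint_le_one (Nat.zero_le k)
  -- The first inner knot has multiplicity `d - 2 ≥ 3`, which supplies the three equal knots. For `k
  -- = 0` they are copies of the end point 1.
  obtain ⟨Q, hQ⟩ := expansion_at_zero (knot_monotone d k) hτ0 hτ1 (fun i hi => knot_of_le hi)
    (fun i hi hi' => by
      have := knot_inner (d := d) (k := k) (j := 0) (r := i - (d + 1)) (Nat.zero_le _) (by omega)
      rwa [show d + 1 + 0 * (d - 2) + (i - (d + 1)) = i by omega] at this) d i i (add_comm _ _)
  have h' : ∀ x ∈ Ico 0 (breakpoint k 0), smooth d k i x = _ := fun x hx =>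
    (smooth_eq i ⟨hx.1, hx.2.le.trans hτ1⟩).trans (hQ x hx)
  have hne := hτ0.ne'
  split_ifs at h' ⊢ with h0 h1 h2
  · obtain ⟨a, b, c⟩ := derivs_of_cubic_remainder (contDiff_smooth i) hτ0 (Q := Q)
      (a := 1) (b := - (d / breakpoint k 0)) (c := d * (d - 1) / 2 / breakpoint k 0 ^ 2)
      fun x hx => by rw [h' x hx]; field_simp; ring
    exact ⟨a, b, c.trans (by ring)⟩
  · obtain ⟨a, b, c⟩ := derivs_of_cubic_remainder (contDiff_smooth i) hτ0 (Q := Q)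
      (a := 0) (b := (d / breakpoint k 0)) (c := - (d * (d - 1) / breakpoint k 0 ^ 2))
      fun x hx => by rw [h' x hx]; field_simp; ring
    exact ⟨a, b, c.trans (by ring)⟩
  · obtain ⟨a, b, c⟩ := derivs_of_cubic_remainder (contDiff_smooth i) hτ0 (Q := Q)
      (a := 0) (b := 0) (c := d * (d - 1) / 2 / breakpoint k 0 ^ 2)
      fun x hx => by rw [h' x hx]; field_simp; ring
    exact ⟨a, b, c.trans (by ring)⟩
  · obtain ⟨a, b, c⟩ := derivs_of_cubic_remainder (contDiff_smooth i) hτ0 (Q := Q)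
      (a := 0) (b := 0) (c := 0) fun x hx => by rw [h' x hx]; ring
    exact ⟨a, b, c.trans (by ring)⟩

lemma smooth_derivs_zero_of_three_le (hd : 5 ≤ d) {i : Fin (maxIndex d k + 1)}
    (hi : 3 ≤ (i : ℕ)) : smooth d k i 0 = 0 ∧ deriv (smooth d k i) 0 = 0 ∧
      deriv (deriv (smooth d k i)) 0 = 0 := by
  have := smooth_derivs_zero hd i
  rw [if_neg (by omega), if_neg (by omega), if_neg (by omega), if_neg (by omega),
    if_neg (by omega), if_neg (by omega)] at this
  exact this

lemma contDiff_comp_one_sub {f : ℝ → ℝ} (hf : ContDiff ℝ 2 f) :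
    ContDiff ℝ 2 (fun x => f (1 - x)) := hf.comp (contDiff_const.sub contDiff_id)

lemma derivs_comp_one_sub (f : ℝ → ℝ) (x : ℝ) :
    deriv (fun x => f (1 - x)) x = - deriv f (1 - x) ∧
    deriv (deriv (fun x => f (1 - x))) x = deriv (deriv f) (1 - x) := by
  have h1 : deriv (fun x => f (1 - x)) = fun x => - deriv f (1 - x) := by
    funext y; exact deriv_comp_const_sub f 1 y
  refine ⟨congrFun h1 x, ?_⟩
  rw [h1, deriv.fun_neg, deriv_comp_const_sub, neg_neg]

lemma smooth_derivs_one (hd : 5 ≤ d) {i : Fin (maxIndex d k + 1)}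
    (hi : (i : ℕ) + 3 ≤ maxIndex d k) : smooth d k i 1 = 0 ∧ deriv (smooth d k i) 1 = 0 ∧
      deriv (deriv (smooth d k i)) 1 = 0 := by
  have h1 : (1 : ℝ) ∈ Icc (0 : ℝ) 1 := ⟨zero_le_one, le_rfl⟩
  have hrev : 3 ≤ (i.rev : ℕ) := by rw [Fin.val_rev]; omega
  obtain ⟨a, b, c⟩ := smooth_derivs_zero_of_three_le hd hrev
  obtain ⟨e1, e2⟩ := derivs_eq_of_Icc (contDiff_comp_one_sub (contDiff_smooth i.rev))
    (contDiff_smooth i) one_pos (fun x hx => smooth_rev (three_le hd) i hx) h1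
  obtain ⟨e3, e4⟩ := derivs_comp_one_sub (smooth d k i.rev) 1
  refine ⟨?_, ?_, ?_⟩
  · rw [← smooth_rev (three_le hd) i h1, sub_self, a]
  · rw [← e1, e3, sub_self, b, neg_zero]
  · rw [← e2, e4, sub_self, c]

/-- The spline with coefficients `c`. -/
def spline (d k : ℕ) (c : Fin (maxIndex d k + 1) → ℝ) (x : ℝ) : ℝ := ∑ i, c i * smooth d k i x

lemma contDiff_spline (c : Fin (maxIndex d k + 1) → ℝ) : ContDiff ℝ 2 (spline d k c) :=
  ContDiff.sum fun i _ => contDiff_const.mul (contDiff_smooth i)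

lemma deriv_spline (c : Fin (maxIndex d k + 1) → ℝ) :
    deriv (spline d k c) = fun x => ∑ i, c i * deriv (smooth d k i) x :=
  deriv_sum_mul _ c differentiable_smooth

lemma deriv_deriv_spline (c : Fin (maxIndex d k + 1) → ℝ) :
    deriv (deriv (spline d k c)) = fun x => ∑ i, c i * deriv (deriv (smooth d k i)) x := by
  rw [deriv_spline]
  exact deriv_sum_mul _ c differentiable_deriv_smooth

lemma two_le_maxIndex (hd : 5 ≤ d) : 2 ≤ maxIndex d k := by
  have : d ≤ maxIndex d k := Nat.le_add_right _ _
  omega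

lemma spline_derivs_zero (hd : 5 ≤ d) (c : Fin (maxIndex d k + 1) → ℝ) :
    spline d k c 0 = c (Fin.ofNat _ 0) ∧
    deriv (spline d k c) 0 = d / breakpoint k 0 * (c (Fin.ofNat _ 1) - c (Fin.ofNat _ 0)) ∧
    deriv (deriv (spline d k c)) 0 = d * (d - 1) / breakpoint k 0 ^ 2 *
      (c (Fin.ofNat _ 2) - 2 * c (Fin.ofNat _ 1) + c (Fin.ofNat _ 0)) := by
  have hn := two_le_maxIndex (k := k) hd
  have h1 : (Fin.ofNat (maxIndex d k + 1) 1).val = 1 := Nat.mod_eq_of_lt (by omega)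
  have h2 : (Fin.ofNat (maxIndex d k + 1) 2).val = 2 := Nat.mod_eq_of_lt (by omega)
  have h0 : (Fin.ofNat (maxIndex d k + 1) 0).val = 0 := by simp
  have z := fun i : Fin (maxIndex d k + 1) => smooth_derivs_zero_of_three_le (i := i) hd
  have s := fun i : Fin (maxIndex d k + 1) => smooth_derivs_zero (i := i) hd
  refine ⟨?_, ?_, ?_⟩
  · rw [spline, Fin.sum_eq_first_three hn _ fun i hi => by rw [(z i hi).1, mul_zero],
      (s _).1, (s _).1, (s _).1, h0, h1, h2]
    norm_num
  · rw [deriv_spline]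
    dsimp only
    rw [Fin.sum_eq_first_three hn _ fun i hi => by rw [(z i hi).2.1, mul_zero],
      (s _).2.1, (s _).2.1, (s _).2.1, h0, h1, h2]
    norm_num
    ring
  · rw [deriv_deriv_spline]
    dsimp only
    rw [Fin.sum_eq_first_three hn _ fun i hi => by rw [(z i hi).2.2, mul_zero],
      (s _).2.2, (s _).2.2, (s _).2.2, h0, h1, h2]
    norm_num
    ring

lemma spline_rev (hd : 5 ≤ d) (c : Fin (maxIndex d k + 1) → ℝ) {x : ℝ} (hx : x ∈ Icc (0 : ℝ) 1) :
    spline d k (fun i => c i.rev) x = spline d k c (1 - x) := by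
  unfold spline
  rw [← Equiv.sum_comp Fin.revPerm]
  refine Finset.sum_congr rfl fun i _ => ?_
  have hx' : 1 - x ∈ Icc (0 : ℝ) 1 := ⟨by linarith [hx.2], by linarith [hx.1]⟩
  simp only [Fin.revPerm_apply, Fin.rev_rev]
  rw [← smooth_rev (three_le hd) i hx', sub_sub_cancel]

/-- The first three coefficients of a spline in terms of its derivatives at `0`. -/
lemma coeffs_of_derivs_zero (hd : 5 ≤ d) (c : Fin (maxIndex d k + 1) → ℝ) :
    c (Fin.ofNat _ 0) = spline d k c 0 ∧
    c (Fin.ofNat _ 1) = spline d k c 0 + breakpoint k 0 / d * deriv (spline d k c) 0 ∧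
    c (Fin.ofNat _ 2) = spline d k c 0 + 2 * (breakpoint k 0 / d) * deriv (spline d k c) 0 +
      breakpoint k 0 ^ 2 / (d * (d - 1)) * deriv (deriv (spline d k c)) 0 := by
  obtain ⟨a, b, e⟩ := spline_derivs_zero (k := k) hd c
  have hd0 : (d : ℝ) ≠ 0 := by positivity
  have hd1 : (d : ℝ) - 1 ≠ 0 := by
    have : (5 : ℝ) ≤ d := by exact_mod_cast hd
    linarith
  have hτ := (breakpoint_pos k 0).ne'
  rw [a, b, e]
  refine ⟨rfl, ?_, ?_⟩
  · field_simp; ring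
  · field_simp; ring

/-- A `C²`-smooth function in the spline space which vanishes of order `3` at `1`. -/
lemma exists_coeffs (hd : 5 ≤ d) {f : ℝ → ℝ} (hf : ContDiff ℝ 2 f) (hmem : f ∈ splineSpace d k)
    (h0 : f 1 = 0) (h1 : deriv f 1 = 0) (h2 : deriv (deriv f) 1 = 0) :
    ∃ c : Fin (maxIndex d k + 1) → ℝ, (∀ x ∈ Icc (0 : ℝ) 1, f x = spline d k c x) ∧
      ∀ i : Fin (maxIndex d k + 1), maxIndex d k < i + 3 → c i = 0 := by
  obtain ⟨c, hc⟩ := hmem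
  have hc' : ∀ x ∈ Icc (0 : ℝ) 1, f x = spline d k c x := fun x hx => by
    rw [hc x hx, spline]
    exact Finset.sum_congr rfl fun i _ => by rw [smooth_eq i hx]
  refine ⟨c, hc', fun i hi => ?_⟩
  -- Reversal moves the end point 1 to 0, where the first three coefficients are explicit in the
  -- value and two derivatives.
  have hr : ∀ x ∈ Icc (0 : ℝ) 1, spline d k (fun i => c i.rev) x = f (1 - x) := fun x hx => by
    rw [spline_rev hd c hx, hc' _ ⟨by linarith [hx.2], by linarith [hx.1]⟩]
  have m0 : (0 : ℝ) ∈ Icc (0 : ℝ) 1 := ⟨le_rfl, zero_le_one⟩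
  obtain ⟨e1, e2⟩ := derivs_eq_of_Icc (contDiff_spline (fun i => c i.rev))
    (contDiff_comp_one_sub hf) one_pos hr m0
  obtain ⟨e3, e4⟩ := derivs_comp_one_sub f 0
  rw [e3, sub_zero, h1, neg_zero] at e1
  rw [e4, sub_zero, h2] at e2
  have e0 := hr 0 m0
  rw [sub_zero, h0] at e0
  obtain ⟨c0, c1, c2⟩ := coeffs_of_derivs_zero hd (k := k) fun i => c i.rev
  rw [e0] at c0
  rw [e0, e1] at c1
  rw [e0, e1, e2] at c2
  simp only [mul_zero, add_zero] at c0 c1 c2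
  have hn := two_le_maxIndex (k := k) hd
  have v1 : (Fin.ofNat (maxIndex d k + 1) 1).val = 1 := Nat.mod_eq_of_lt (by omega)
  have v2 : (Fin.ofNat (maxIndex d k + 1) 2).val = 2 := Nat.mod_eq_of_lt (by omega)
  have v0 : (Fin.ofNat (maxIndex d k + 1) 0).val = 0 := by simp
  have hi' := i.2
  rcases (by omega : (i : ℕ) = maxIndex d k ∨ (i : ℕ) + 1 = maxIndex d k ∨
    (i : ℕ) + 2 = maxIndex d k) with h | h | h
  · rwa [show (Fin.ofNat (maxIndex d k + 1) 0).rev = i from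
      Fin.ext (by rw [Fin.val_rev, v0]; omega)] at c0
  · rwa [show (Fin.ofNat (maxIndex d k + 1) 1).rev = i from
      Fin.ext (by rw [Fin.val_rev, v1]; omega)] at c1
  · rwa [show (Fin.ofNat (maxIndex d k + 1) 2).rev = i from
      Fin.ext (by rw [Fin.val_rev, v2]; omega)] at c2

end BSpline

namespace BSpline

open Polynomial

variable {d k : ℕ}

/-! ### Combinations of truncated powers -/

/-- The span of the truncated powers at the breakpoints with exponents between `p` and `q`. -/
def truncSpace (k p q : ℕ) : Submodule ℝ (ℝ → ℝ) :=
  Submodule.span ℝ {f | ∃ e j, p ≤ e ∧ e ≤ q ∧ j ≤ k ∧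
    f = fun x => (max (breakpoint k j - x) 0) ^ e}

lemma truncated_mem_truncSpace {p q e j : ℕ} (h1 : p ≤ e) (h2 : e ≤ q) (h3 : j ≤ k) :
    (fun x => (max (breakpoint k j - x) 0) ^ e) ∈ truncSpace k p q :=
  Submodule.subset_span ⟨e, j, h1, h2, h3, rfl⟩

lemma hasDerivAt_truncated (τ : ℝ) (e : ℕ) (x : ℝ) :
    HasDerivAt (fun x => (max (τ - x) 0) ^ (e + 2)) (-((e + 2) * (max (τ - x) 0) ^ (e + 1))) x := by
  have := (hasDerivAt_max_pow e (τ - x)).comp x ((hasDerivAt_id x).const_sub τ)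
  simpa [Function.comp_def] using this

lemma deriv_truncated (τ : ℝ) (e : ℕ) : deriv (fun x => (max (τ - x) 0) ^ (e + 2)) =
    fun x => (-((e : ℝ) + 2)) * (max (τ - x) 0) ^ (e + 1) :=
  funext fun x => by rw [(hasDerivAt_truncated τ e x).deriv]; ring

lemma deriv_deriv_truncated (τ : ℝ) (e : ℕ) :
    deriv (deriv (fun x => (max (τ - x) 0) ^ (e + 3))) =
      fun x => ((e : ℝ) + 3) * (e + 2) * (max (τ - x) 0) ^ (e + 1) := by
  rw [deriv_truncated τ (e + 1)]
  funext x
  rw [deriv_const_mul _ (hasDerivAt_truncated τ e x).differentiableAt, deriv_truncated]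
  push_cast
  ring

lemma contDiff_of_mem_truncSpace {p q : ℕ} (hp : 3 ≤ p) {f : ℝ → ℝ} (hf : f ∈ truncSpace k p q) :
    ContDiff ℝ 2 f := by
  refine Submodule.span_induction ?_ contDiff_const (fun f g _ _ hf hg => hf.add hg)
    (fun a f _ hf => contDiff_const.mul hf) hf
  rintro _ ⟨e, j, h1, -, -, rfl⟩
  exact contDiff_truncated_pow (by omega) _

/-- Exponent bookkeeping: derivatives of `W₀` and `W₁` occur along a leg, and their exponents must
stay at least 3 for smoothness and small enough to leave room for a polynomial factor. -/
lemma deriv_mem_truncSpace {p q : ℕ} (hp : 1 ≤ p) {f : ℝ → ℝ}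
    (hf : f ∈ truncSpace k (p + 1) (q + 1)) :
    Differentiable ℝ f ∧ deriv f ∈ truncSpace k p q := by
  refine Submodule.span_induction ?_ ⟨differentiable_const _, ?_⟩ ?_ ?_ hf
  · rintro _ ⟨e, j, h1, h2, h3, rfl⟩
    obtain ⟨e, rfl⟩ : ∃ e', e = e' + 2 := ⟨e - 2, by omega⟩
    refine ⟨fun x => (hasDerivAt_truncated _ e x).differentiableAt, ?_⟩
    rw [deriv_truncated]
    exact Submodule.smul_mem _ _ (truncated_mem_truncSpace (by omega) (by omega) h3)
  · rw [show deriv (0 : ℝ → ℝ) = 0 from funext fun x => deriv_const x 0]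
    exact Submodule.zero_mem _
  · rintro f g _ _ ⟨df, hf⟩ ⟨dg, hg⟩
    refine ⟨df.add dg, ?_⟩
    rw [show deriv (f + g) = deriv f + deriv g from funext fun x => deriv_add (df x) (dg x)]
    exact Submodule.add_mem _ hf hg
  · rintro a f _ ⟨df, hf⟩
    refine ⟨df.const_smul a, ?_⟩
    rw [show deriv (a • f) = a • deriv f from funext fun x => deriv_const_smul a (df x)]
    exact Submodule.smul_mem _ _ hf

lemma mul_mem_splineSpace {p q : ℕ} (hp : 3 ≤ p) (P : ℝ[X]) (hq : q + P.natDegree ≤ d) {f : ℝ → ℝ}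
    (hf : f ∈ truncSpace k p q) : (fun x => f x * P.eval x) ∈ splineSpace d k := by
  let m : (ℝ → ℝ) →ₗ[ℝ] (ℝ → ℝ) := LinearMap.mulRight ℝ (fun x => P.eval x)
  have : truncSpace k p q ≤ (splineSpace d k).comap m := by
    refine Submodule.span_le.2 ?_
    rintro _ ⟨e, j, h1, h2, h3, rfl⟩
    exact truncated_pow_mul_mem (by omega) h3 P (by omega)
  exact this hf

/-- Value, first and second derivative. -/
def HasJet (f : ℝ → ℝ) (x a b c : ℝ) : Prop := f x = a ∧ deriv f x = b ∧ deriv (deriv f) x = c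

lemma HasJet.add {f g : ℝ → ℝ} (cf : ContDiff ℝ 2 f) (cg : ContDiff ℝ 2 g) {x a b c a' b' c' : ℝ}
    (hf : HasJet f x a b c) (hg : HasJet g x a' b' c') :
    HasJet (fun x => f x + g x) x (a + a') (b + b') (c + c') := by
  have df := cf.differentiable two_ne_zero
  have dg := cg.differentiable two_ne_zero
  have e : deriv (fun x => f x + g x) = fun x => deriv f x + deriv g x :=
    funext fun x => deriv_fun_add (df x) (dg x)
  refine ⟨by dsimp only; rw [hf.1, hg.1], by rw [e]; dsimp only; rw [hf.2.1, hg.2.1], ?_⟩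
  rw [e, deriv_fun_add (cf.differentiable_deriv x) (cg.differentiable_deriv x), hf.2.2, hg.2.2]

lemma HasJet.mul {f g : ℝ → ℝ} (cf : ContDiff ℝ 2 f) (cg : ContDiff ℝ 2 g) {x a b c a' b' c' : ℝ}
    (hf : HasJet f x a b c) (hg : HasJet g x a' b' c') :
    HasJet (fun x => f x * g x) x (a * a') (b * a' + a * b') (c * a' + 2 * b * b' + a * c') := by
  have df := cf.differentiable two_ne_zero
  have dg := cg.differentiable two_ne_zero
  have e : deriv (fun x => f x * g x) = fun x => deriv f x * g x + f x * deriv g x :=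
    funext fun x => deriv_fun_mul (df x) (dg x)
  refine ⟨by dsimp only; rw [hf.1, hg.1], by rw [e]; dsimp only; rw [hf.1, hg.1, hf.2.1, hg.2.1], ?_⟩
  rw [e, deriv_fun_add ((cf.differentiable_deriv x).fun_mul (dg x))
    ((df x).fun_mul (cg.differentiable_deriv x)), deriv_fun_mul (cf.differentiable_deriv x) (dg x),
    deriv_fun_mul (df x) (cg.differentiable_deriv x), hf.1, hg.1, hf.2.1, hg.2.1, hf.2.2, hg.2.2]
  ring

lemma HasJet.const_mul {f : ℝ → ℝ} (cf : ContDiff ℝ 2 f) {x a b c : ℝ} (r : ℝ)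
    (hf : HasJet f x a b c) : HasJet (fun x => r * f x) x (r * a) (r * b) (r * c) := by
  have h0 : HasJet (fun _ : ℝ => r) x r 0 0 := by simp [HasJet]
  simpa using h0.mul contDiff_const cf hf

lemma hasJet_polynomial (P : ℝ[X]) (x : ℝ) : HasJet (fun x => P.eval x) x (P.eval x)
    ((derivative P).eval x) ((derivative (derivative P)).eval x) := by
  have d1 : deriv (fun x => P.eval x) = fun x => (derivative P).eval x := funext fun x => P.deriv
  refine ⟨rfl, P.deriv, ?_⟩
  rw [d1]
  exact (derivative P).deriv

lemma contDiff_polynomial (P : ℝ[X]) : ContDiff ℝ 2 (fun x => P.eval x) := by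
  simpa using P.contDiff_aeval (R := ℝ) (𝕜 := ℝ) 2

lemma hasJet_truncated (τ : ℝ) (e : ℕ) (x : ℝ) : HasJet (fun x => (max (τ - x) 0) ^ (e + 3)) x
    ((max (τ - x) 0) ^ (e + 3)) (-((e + 3) * (max (τ - x) 0) ^ (e + 2)))
    ((e + 3) * (e + 2) * (max (τ - x) 0) ^ (e + 1)) := by
  refine ⟨rfl, ?_, ?_⟩
  · rw [deriv_truncated τ (e + 1)]; push_cast; ring
  · rw [deriv_deriv_truncated]

lemma hasJet_one_of_mem_truncSpace {p q : ℕ} (hp : 3 ≤ p) {f : ℝ → ℝ}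
    (hf : f ∈ truncSpace k p q) : HasJet f 1 0 0 0 := by
  suffices ContDiff ℝ 2 f ∧ HasJet f 1 0 0 0 from this.2
  refine Submodule.span_induction ?_ ⟨contDiff_const, ?_⟩ ?_ ?_ hf
  · rintro _ ⟨e, j, h1, h2, h3, rfl⟩
    obtain ⟨e, rfl⟩ : ∃ e', e = e' + 3 := ⟨e - 3, by omega⟩
    refine ⟨contDiff_truncated_pow (by omega) _, ?_⟩
    have := hasJet_truncated (breakpoint k j) e 1
    rw [max_eq_right (by linarith [breakpoint_le_one h3])] at this
    simpa using this
  · have := hasJet_polynomial 0 1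
    simp only [Polynomial.eval_zero, derivative_zero] at this
    exact this
  · rintro f g _ _ ⟨cf, hf⟩ ⟨cg, hg⟩
    have := hf.add cf cg hg
    rw [add_zero] at this
    exact ⟨cf.add cg, this⟩
  · rintro a f _ ⟨cf, hf⟩
    have := hf.const_mul cf a
    rw [mul_zero] at this
    exact ⟨contDiff_const.mul cf, this⟩

lemma breakpoint_eq_mul (k j : ℕ) : breakpoint k j = (j + 1) * breakpoint k 0 := by
  unfold breakpoint; push_cast; ring

/-- Hermite interpolation at `0` by truncated powers. -/
lemma exists_truncSpace_jet (hd : d = 5 ∨ d = 6) (hk : 7 ≤ d + k) {p : ℕ} (hp : 3 ≤ p)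
    (w0 w1 w2 : ℝ) : ∃ f ∈ truncSpace k p (p + (d - 5)), HasJet f 0 w0 w1 w2 := by
  obtain ⟨p, rfl⟩ : ∃ p', p = p' + 3 := ⟨p - 3, by omega⟩
  set τ := breakpoint k 0 with hτ
  have hτ0 : 0 < τ := breakpoint_pos k 0
  have e1 : breakpoint k 1 = 2 * τ := by rw [breakpoint_eq_mul]; push_cast; ring
  have e2 : breakpoint k 2 = 3 * τ := by rw [breakpoint_eq_mul]; push_cast; ring
  have jet : ∀ (j e : ℕ), HasJet (fun x => (max (breakpoint k j - x) 0) ^ (e + 3)) 0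
      (breakpoint k j ^ (e + 3)) (-((e + 3) * breakpoint k j ^ (e + 2)))
      ((e + 3) * (e + 2) * breakpoint k j ^ (e + 1)) := fun j e => by
    have := hasJet_truncated (breakpoint k j) e 0
    rwa [sub_zero, max_eq_left (breakpoint_pos k j).le] at this
  have cd : ∀ (j e : ℕ) (c : ℝ), ContDiff ℝ 2
      (fun x => c * (max (breakpoint k j - x) 0) ^ (e + 3)) := fun j e c =>
    contDiff_const.mul (contDiff_truncated_pow (by omega) _)
  have main : ∀ (j0 j1 j2 a0 a1 a2 : ℕ) (c0 c1 c2 : ℝ), j0 ≤ k → j1 ≤ k → j2 ≤ k →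
      p ≤ a0 → p ≤ a1 → p ≤ a2 → a0 ≤ p + (d - 5) → a1 ≤ p + (d - 5) → a2 ≤ p + (d - 5) →
      c0 * breakpoint k j0 ^ (a0 + 3) + c1 * breakpoint k j1 ^ (a1 + 3)
        + c2 * breakpoint k j2 ^ (a2 + 3) = w0 →
      c0 * (-((a0 + 3) * breakpoint k j0 ^ (a0 + 2))) +
        c1 * (-((a1 + 3) * breakpoint k j1 ^ (a1 + 2))) +
        c2 * (-((a2 + 3) * breakpoint k j2 ^ (a2 + 2))) = w1 →
      c0 * ((a0 + 3) * (a0 + 2) * breakpoint k j0 ^ (a0 + 1)) +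
        c1 * ((a1 + 3) * (a1 + 2) * breakpoint k j1 ^ (a1 + 1)) +
        c2 * ((a2 + 3) * (a2 + 2) * breakpoint k j2 ^ (a2 + 1)) = w2 →
      ∃ f ∈ truncSpace k (p + 3) (p + 3 + (d - 5)), HasJet f 0 w0 w1 w2 := by
    intro j0 j1 j2 a0 a1 a2 c0 c1 c2 h0 h1 h2 g0 g1 g2 g3 g4 g5 v0 v1 v2
    refine ⟨fun x => c0 * (max (breakpoint k j0 - x) 0) ^ (a0 + 3) +
      c1 * (max (breakpoint k j1 - x) 0) ^ (a1 + 3) +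
      c2 * (max (breakpoint k j2 - x) 0) ^ (a2 + 3), ?_, ?_⟩
    · exact Submodule.add_mem _ (Submodule.add_mem _
        (Submodule.smul_mem _ c0 (truncated_mem_truncSpace (by omega) (by omega) h0))
        (Submodule.smul_mem _ c1 (truncated_mem_truncSpace (by omega) (by omega) h1)))
        (Submodule.smul_mem _ c2 (truncated_mem_truncSpace (by omega) (by omega) h2))
    · have := (((jet j0 a0).const_mul (by simpa using cd j0 a0 1) c0).add (cd _ _ _) (cd _ _ _)
        ((jet j1 a1).const_mul (by simpa using cd j1 a1 1) c1)).add
        ((cd _ _ _).add (cd _ _ _)) (cd _ _ _)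
        ((jet j2 a2).const_mul (by simpa using cd j2 a2 1) c2)
      rwa [v0, v1, v2] at this
  have hp3 : (p : ℝ) + 3 ≠ 0 := by positivity
  have hp2 : (p : ℝ) + 2 ≠ 0 := by positivity
  -- For `d = 5` one exponent is available, so three breakpoints `τ, 2τ, 3τ` are used, which needs
  -- `k ≥ 2`. After removing the factor `((j + 1) τ) ^ (p + 1)` the system is a Vandermonde system
  -- with right-hand sides `m0, m1, w0`, and the witnesses are its Lagrange weights.
  rcases hd with rfl | rfl
  · set m1 : ℝ := - w1 / (p + 3) with hm1
    set m0 : ℝ := w2 / ((p + 3) * (p + 2)) with hm0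
    have r1 : w1 = - ((p + 3) * m1) := by rw [hm1]; field_simp
    have r2 : w2 = (p + 3) * (p + 2) * m0 := by rw [hm0]; field_simp
    refine main 0 1 2 p p p ((w0 - 5 * τ * m1 + 6 * τ ^ 2 * m0) / (2 * τ ^ 2) / τ ^ (p + 1))
      (- (w0 - 4 * τ * m1 + 3 * τ ^ 2 * m0) / τ ^ 2 / (2 * τ) ^ (p + 1))
      ((w0 - 3 * τ * m1 + 2 * τ ^ 2 * m0) / (2 * τ ^ 2) / (3 * τ) ^ (p + 1))
      (by omega) (by omega) (by omega) le_rfl le_rfl le_rfl (by omega) (by omega) (by omega)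
      ?_ ?_ ?_
    · rw [e1, e2, ← hτ]
      simp only [pow_succ (_ : ℝ) (p + 1 + 1), pow_succ (_ : ℝ) (p + 1)]
      field_simp
      ring
    · rw [e1, e2, ← hτ, r1]
      simp only [pow_succ (_ : ℝ) (p + 1)]
      field_simp
      ring
    · rw [e1, e2, ← hτ, r2]
      field_simp
      ring
  -- For `d = 6` two consecutive exponents are available, so the breakpoint `τ` is used twice and
  -- `2τ` once, which needs only `k ≥ 1`. The data are scaled by powers of `τ`, and the system is
  -- solved by elimination for `f'`, `e'`, `c'`.
  · set q : ℝ := p + 3 with hq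
    have hq0 : 0 < q := by positivity
    set M0 : ℝ := w0 / τ ^ 2 with hM0
    set M1 : ℝ := - w1 / τ with hM1
    have r0 : w0 = τ ^ 2 * M0 := by rw [hM0]; field_simp
    have r1 : w1 = - (τ * M1) := by rw [hM1]; field_simp
    set f' : ℝ := (w2 - 2 * q * M1 + q * (q + 1) * M0) / (q * (q + 3)) with hf'
    have r2 : w2 = q * (q + 3) * f' + 2 * q * M1 - q * (q + 1) * M0 := by
      rw [hf']; field_simp; ring
    set e' : ℝ := M1 - q * M0 + 2 * q * f' with he'
    set c' : ℝ := M0 - 4 * f' - e' with hc'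
    refine main 0 0 1 p (p + 1) p (c' / τ ^ (p + 1)) (e' / τ ^ (p + 2)) (f' / (2 * τ) ^ (p + 1))
      (by omega) (by omega) (by omega) le_rfl (by omega) le_rfl (by omega) (by omega) (by omega)
      ?_ ?_ ?_
    · rw [e1, ← hτ, r0, hc']
      simp only [pow_succ (_ : ℝ) (p + 1 + 1 + 1), pow_succ (_ : ℝ) (p + 1 + 1),
        pow_succ (_ : ℝ) (p + 1)]
      field_simp
      ring
    · rw [e1, ← hτ, r1]
      have s1 : (p : ℝ) + 3 = q := rfl
      push_cast
      have s2 : (p : ℝ) + 1 + 3 = q + 1 := by rw [← s1]; ring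
      rw [s1, s2]
      simp only [pow_succ (_ : ℝ) (p + 1 + 1), pow_succ (_ : ℝ) (p + 1)]
      field_simp
      rw [hc', he']
      ring
    · rw [e1, ← hτ, r2]
      have s1 : (p : ℝ) + 3 = q := rfl
      push_cast
      have s2 : (p : ℝ) + 1 + 3 = q + 1 := by rw [← s1]; ring
      have s3 : (p : ℝ) + 2 = q - 1 := by rw [← s1]; ring
      have s4 : (p : ℝ) + 1 + 2 = q := by rw [← s1]; ring
      rw [s1, s2, s3, s4]
      simp only [pow_succ (_ : ℝ) (p + 1)]
      field_simp
      rw [hc', he']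
      ring

end BSpline

namespace BSpline

open Polynomial

variable {d k : ℕ}

/-! ### Splines along a leg -/

/-- The first three spline coefficients in terms of the derivatives at `0`. -/
def endCoeff (d k : ℕ) (f : ℕ → ℝ) : ℕ → ℝ
  | 0 => f 0
  | 1 => f 0 + breakpoint k 0 / d * f 1
  | _ => f 0 + 2 * (breakpoint k 0 / d) * f 1 + breakpoint k 0 ^ 2 / (d * (d - 1)) * f 2

/-- The mixed derivatives of orders `(m, m')` at the origin of the composition of a function with
the bilinear mapping `(s, t) ↦ (s (1 + η t), t (1 + μ s))`, where `J m m'` are the mixed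
derivatives of the function. -/
def bilinearJet (J : ℕ → ℕ → ℝ) (μ η : ℝ) (m : ℕ) : ℕ → ℝ
  | 0 => J m 0
  | 1 => J m 1 + m * μ * J (m - 1) 1 + m * η * J m 0
  | _ => J m 2 + 2 * m * μ * J (m - 1) 2 + m * (m - 1) * μ ^ 2 * J (m - 2) 2
      + 2 * m * η * J m 1 + 2 * m * (m - 1) * η * μ * J (m - 1) 1 + m * (m - 1) * η ^ 2 * J m 0

/-- The spline coefficients near a corner of a patch. -/
def cornerCoeff (d k : ℕ) (J : ℕ → ℕ → ℝ) (μ η : ℝ) (i i' : ℕ) : ℝ :=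
  endCoeff d k (fun m' => endCoeff d k (fun m => bilinearJet J μ η m m') i) i'

/-- The same corner block is produced from either of the two legs of a patch. Hence the rows
constructed along the two legs fit together where they overlap. -/
lemma cornerCoeff_swap (J : ℕ → ℕ → ℝ) (μ η : ℝ) {i i' : ℕ} (hi : i ≤ 2) (hi' : i' ≤ 2) :
    cornerCoeff d k (fun m m' => J m' m) η μ i' i = cornerCoeff d k J μ η i i' := by
  interval_cases i <;> interval_cases i' <;>
    norm_num [cornerCoeff, endCoeff, bilinearJet] <;> ring

/-- Functions which are splines and vanish of order three at the end point `1`. -/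
structure IsLegSpline (d k : ℕ) (f : ℝ → ℝ) : Prop where
  contDiff : ContDiff ℝ 2 f
  mem : f ∈ splineSpace d k
  one : HasJet f 1 0 0 0

lemma IsLegSpline.add {f g : ℝ → ℝ} (hf : IsLegSpline d k f) (hg : IsLegSpline d k g) :
    IsLegSpline d k (fun x => f x + g x) := by
  refine ⟨hf.contDiff.add hg.contDiff, Submodule.add_mem _ hf.mem hg.mem, ?_⟩
  have := hf.one.add hf.contDiff hg.contDiff hg.one
  rwa [add_zero] at this

lemma isLegSpline_mul {p q : ℕ} (hp : 3 ≤ p) (P : ℝ[X]) (hq : q + P.natDegree ≤ d) {f : ℝ → ℝ}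
    (hf : f ∈ truncSpace k p q) : IsLegSpline d k (fun x => f x * P.eval x) := by
  have cf := contDiff_of_mem_truncSpace hp hf
  refine ⟨cf.mul (contDiff_polynomial P), mul_mem_splineSpace hp P hq hf, ?_⟩
  have := (hasJet_one_of_mem_truncSpace hp hf).mul cf (contDiff_polynomial P) (hasJet_polynomial P 1)
  simpa using this

lemma IsLegSpline.exists_coeffs (hd : 5 ≤ d) {f : ℝ → ℝ} (hf : IsLegSpline d k f) {a b c : ℝ}
    (h0 : HasJet f 0 a b c) : ∃ C : Fin (maxIndex d k + 1) → ℝ,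
      (∀ x ∈ Icc (0 : ℝ) 1, spline d k C x = f x) ∧
      (∀ i : Fin (maxIndex d k + 1), maxIndex d k < i + 3 → C i = 0) ∧
      ∀ i ≤ 2, C (Fin.ofNat _ i) = endCoeff d k (fun m => if m = 0 then a else if m = 1 then b
        else c) i := by
  obtain ⟨C, h1, h2⟩ := BSpline.exists_coeffs hd hf.contDiff hf.mem hf.one.1 hf.one.2.1 hf.one.2.2
  have m0 : (0 : ℝ) ∈ Icc (0 : ℝ) 1 := ⟨le_rfl, zero_le_one⟩
  obtain ⟨e1, e2⟩ := derivs_eq_of_Icc hf.contDiff (contDiff_spline C) one_pos h1 m0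
  obtain ⟨c0, c1, c2⟩ := coeffs_of_derivs_zero (k := k) hd C
  rw [← h1 0 m0, h0.1] at c0
  rw [← h1 0 m0, ← e1, h0.1, h0.2.1] at c1
  rw [← h1 0 m0, ← e1, ← e2, h0.1, h0.2.1, h0.2.2] at c2
  refine ⟨C, fun x hx => (h1 x hx).symm, h2, fun i hi => ?_⟩
  interval_cases i
  · simpa [endCoeff] using c0
  · simpa [endCoeff] using c1
  · simpa [endCoeff] using c2

/-- Functions `W₀, W₁, W₂` on a leg with prescribed derivatives at the end point `0`, which are
combinations of truncated powers. -/
structure IsLegData (d k : ℕ) (J : ℕ → ℕ → ℝ) (W0 W1 W2 : ℝ → ℝ) : Prop where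
  mem0 : W0 ∈ truncSpace k 5 (5 + (d - 5))
  mem1 : W1 ∈ truncSpace k 4 (4 + (d - 5))
  mem2 : W2 ∈ truncSpace k 3 (3 + (d - 5))
  jet0 : HasJet W0 0 (J 0 0) (J 1 0) (J 2 0)
  jet1 : HasJet W1 0 (J 0 1) (J 1 1) (J 2 1)
  jet2 : HasJet W2 0 (J 0 2) (J 1 2) (J 2 2)

lemma exists_isLegData (hd : d = 5 ∨ d = 6) (hk : 7 ≤ d + k) (J : ℕ → ℕ → ℝ) :
    ∃ W0 W1 W2 : ℝ → ℝ, IsLegData d k J W0 W1 W2 := by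
  obtain ⟨W0, m0, j0⟩ := exists_truncSpace_jet hd hk (p := 5) (by omega) (J 0 0) (J 1 0) (J 2 0)
  obtain ⟨W1, m1, j1⟩ := exists_truncSpace_jet hd hk (p := 4) (by omega) (J 0 1) (J 1 1) (J 2 1)
  obtain ⟨W2, m2, j2⟩ := exists_truncSpace_jet hd hk (p := 3) (by omega) (J 0 2) (J 1 2) (J 2 2)
  exact ⟨W0, W1, W2, m0, m1, m2, j0, j1, j2⟩

namespace IsLegData

variable {J : ℕ → ℕ → ℝ} {W0 W1 W2 : ℝ → ℝ}

lemma contDiff (h : IsLegData d k J W0 W1 W2) :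
    ContDiff ℝ 2 W0 ∧ ContDiff ℝ 2 W1 ∧ ContDiff ℝ 2 W2 :=
  ⟨contDiff_of_mem_truncSpace (by omega) h.mem0, contDiff_of_mem_truncSpace (by omega) h.mem1,
    contDiff_of_mem_truncSpace (by omega) h.mem2⟩

/-- This is the substitution `Y ↦ r Y`. It lets the same functions on a leg serve the patch on its
other side, where the transversal direction is a multiple of the first one. -/
lemma scale (h : IsLegData d k J W0 W1 W2) (r : ℝ) : IsLegData d k (fun m i => r ^ i * J m i) W0
    (fun x => r * W1 x) (fun x => r ^ 2 * W2 x) where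
  mem0 := h.mem0
  mem1 := Submodule.smul_mem _ r h.mem1
  mem2 := Submodule.smul_mem _ (r ^ 2) h.mem2
  jet0 := by simpa using h.jet0
  jet1 := by simpa using h.jet1.const_mul h.contDiff.2.1 r
  jet2 := h.jet2.const_mul h.contDiff.2.2 (r ^ 2)

/-- Every function `W₀(X) + Y W₁(X) + Y² W₂(X) / 2` composed with a bilinear mapping agrees up to
second order on the leg with a tensor-product spline. -/
lemma exists_coeffs (hd5 : 5 ≤ d) (h : IsLegData d k J W0 W1 W2) (μ η : ℝ) :
    ∃ C : ℕ → Fin (maxIndex d k + 1) → ℝ,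
      (∀ x ∈ Icc (0 : ℝ) 1, spline d k (C 0) x = W0 x) ∧
      (∀ x ∈ Icc (0 : ℝ) 1, d / breakpoint k 0 * (spline d k (C 1) x - spline d k (C 0) x) =
        (1 + x * μ) * W1 x + x * η * deriv W0 x) ∧
      (∀ x ∈ Icc (0 : ℝ) 1, d * (d - 1) / breakpoint k 0 ^ 2 *
        (spline d k (C 2) x - 2 * spline d k (C 1) x + spline d k (C 0) x) =
        (1 + x * μ) ^ 2 * W2 x + 2 * (1 + x * μ) * (x * η) * deriv W1 x
          + (x * η) ^ 2 * deriv (deriv W0) x) ∧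
      (∀ i' (i : Fin (maxIndex d k + 1)), maxIndex d k < i + 3 → C i' i = 0) ∧
      ∀ i ≤ 2, ∀ i' ≤ 2, C i' (Fin.ofNat _ i) = cornerCoeff d k J μ η i i' := by
  obtain ⟨m0, m1, m2, j0, j1, j2⟩ := h
  obtain ⟨s, hs⟩ : ∃ s, d = s + 5 := ⟨d - 5, by omega⟩
  have es : d - 5 = s := by omega
  rw [es] at m0 m1 m2
  -- With `d = s + 5`, the functions `W₀`, `W₁, W₀'` and `W₂, W₁', W₀''` have exponents at most `d`,
  -- `d - 1`, `d - 2`. They are multiplied by polynomials of degree at most 0, 1, 2 respectively, so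
  -- the degree never exceeds `d`.
  have m0' : deriv W0 ∈ truncSpace k 4 (4 + s) :=
    (deriv_mem_truncSpace (p := 4) (by omega) (by convert m0 using 1; ring)).2
  have m0'' : deriv (deriv W0) ∈ truncSpace k 3 (3 + s) :=
    (deriv_mem_truncSpace (p := 3) (by omega) (by convert m0' using 1; ring)).2
  have m1' : deriv W1 ∈ truncSpace k 3 (3 + s) :=
    (deriv_mem_truncSpace (p := 3) (by omega) (by convert m1 using 1; ring)).2
  have c0 := contDiff_of_mem_truncSpace (by omega) m0
  have c0' := contDiff_of_mem_truncSpace (by omega) m0'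
  have c0'' := contDiff_of_mem_truncSpace (by omega) m0''
  have c1 := contDiff_of_mem_truncSpace (by omega) m1
  have c1' := contDiff_of_mem_truncSpace (by omega) m1'
  have c2 := contDiff_of_mem_truncSpace (by omega) m2
  have l0 : IsLegSpline d k W0 := by
    have := isLegSpline_mul (d := d) (by omega) (1 : ℝ[X]) (by rw [natDegree_one]; omega) m0
    simpa using this
  set P1 : ℝ[X] := 1 + C μ * X with hP1
  set P2 : ℝ[X] := C η * X with hP2
  have n1 : P1.natDegree ≤ 1 := by rw [hP1]; compute_degree
  have n2 : P2.natDegree ≤ 1 := by rw [hP2]; compute_degree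
  have n3 : (P1 * P1).natDegree ≤ 2 := by rw [hP1]; compute_degree
  have n4 : (C 2 * P1 * P2).natDegree ≤ 2 := by rw [hP1, hP2]; compute_degree
  have n5 : (P2 * P2).natDegree ≤ 2 := by rw [hP2]; compute_degree
  have l1 := (isLegSpline_mul (d := d) (by omega) P1 (by omega) m1).add
    (isLegSpline_mul (d := d) (by omega) P2 (by omega) m0')
  have l2 := ((isLegSpline_mul (d := d) (by omega) (P1 * P1) (by omega) m2).add
    (isLegSpline_mul (d := d) (by omega) (C 2 * P1 * P2) (by omega) m1')).add
    (isLegSpline_mul (d := d) (by omega) (P2 * P2) (by omega) m0'')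
  have cp := contDiff_polynomial
  have jp := fun P => hasJet_polynomial P 0
  have t1 := (j1.mul c1 (cp P1) (jp P1)).add (c1.mul (cp P1)) (c0'.mul (cp P2))
    (HasJet.mul c0' (cp P2) ⟨j0.2.1, j0.2.2, rfl⟩ (jp P2))
  have t2 := ((j2.mul c2 (cp (P1 * P1)) (jp _)).add (c2.mul (cp _)) (c1'.mul (cp _))
    (HasJet.mul c1' (cp (C 2 * P1 * P2)) ⟨j1.2.1, j1.2.2, rfl⟩ (jp _))).add
    ((c2.mul (cp _)).add (c1'.mul (cp _))) (c0''.mul (cp _))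
    (HasJet.mul c0'' (cp (P2 * P2)) ⟨j0.2.2, rfl, rfl⟩ (jp _))
  obtain ⟨A0, a1, a2, a3⟩ := l0.exists_coeffs hd5 j0
  obtain ⟨A1, b1, b2, b3⟩ := l1.exists_coeffs hd5 t1
  obtain ⟨A2, e1, e2, e3⟩ := l2.exists_coeffs hd5 t2
  have hsum : ∀ (x u v : ℝ) (B B' B'' : Fin (maxIndex d k + 1) → ℝ),
      spline d k (fun i => B i + u * B' i + v * B'' i) x =
        spline d k B x + u * spline d k B' x + v * spline d k B'' x := by
    intro x u v B B' B''
    simp only [spline, Finset.mul_sum, ← Finset.sum_add_distrib]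
    exact Finset.sum_congr rfl fun i _ => by ring
  have hd0 : (d : ℝ) ≠ 0 := by positivity
  have hd1 : (d : ℝ) - 1 ≠ 0 := by
    have : (5 : ℝ) ≤ d := by exact_mod_cast hd5
    linarith
  have hτ := (breakpoint_pos k 0).ne'
  -- `A0`, `A1`, `A2` are the coefficients of the transversal derivatives of orders 0, 1, 2 along
  -- the leg. `endCoeff` converts them into the first three rows of tensor-product coefficients.
  refine ⟨fun i' i => endCoeff d k (fun m => if m = 0 then A0 i else if m = 1 then A1 i else A2 i)
    i', ?_, ?_, ?_, ?_, ?_⟩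
  · intro x hx
    simpa [endCoeff] using a1 x hx
  · intro x hx
    have q1 := hsum x (breakpoint k 0 / d) 0 A0 A1 A1
    simp only [zero_mul, add_zero] at q1
    simp only [endCoeff, if_true, if_neg one_ne_zero]
    rw [q1]
    have q2 := a1 x hx
    have q3 := b1 x hx
    simp only [hP1, hP2, eval_add, eval_mul, eval_C, eval_X, eval_one] at q3
    rw [show (fun i => A0 i) = A0 from rfl, q3]
    field_simp
    ring
  · intro x hx
    have q1 := hsum x (breakpoint k 0 / d) 0 A0 A1 A1
    simp only [zero_mul, add_zero] at q1
    have q1' := hsum x (2 * (breakpoint k 0 / d)) (breakpoint k 0 ^ 2 / (d * (d - 1))) A0 A1 A2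
    simp only [endCoeff, if_true, if_neg one_ne_zero, if_neg two_ne_zero]
    norm_num
    rw [q1, q1', show (fun i => A0 i) = A0 from rfl]
    have q3 := e1 x hx
    simp only [hP1, hP2, eval_add, eval_mul, eval_C, eval_X, eval_one] at q3
    rw [q3]
    field_simp
    ring
  · intro i' i hi
    have z0 := a2 i hi
    have z1 := b2 i hi
    have z2 := e2 i hi
    rcases i' with _ | _ | i' <;> simp [endCoeff, z0, z1, z2]
  · intro i hi i' hi'
    dsimp only
    rw [a3 i hi, b3 i hi, e3 i hi]
    rw [cornerCoeff]
    congr 1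
    funext m'
    simp only [hP1, hP2]
    rcases m' with _ | _ | m' <;> interval_cases i <;>
      norm_num [endCoeff, bilinearJet, -mul_eq_mul_left_iff, -add_right_inj] <;> ring

end IsLegData

end BSpline

/-! ### Gluing of `C²`-smooth functions -/

section Gluing

open Topology

variable {E F : Type*} [NormedAddCommGroup E] [NormedSpace ℝ E] [NormedAddCommGroup F]
  [NormedSpace ℝ F]

/-- Value, first and second derivative of a function within a set. -/
def jet2 (f : E → F) (s : Set E) (x : E) : F × (E →L[ℝ] F) × (E →L[ℝ] E →L[ℝ] F) :=
  (f x, fderivWithin ℝ f s x, fderivWithin ℝ (fderivWithin ℝ f s) s x)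

/-- The neighbourhood filter of a finite union is the supremum of those of its members. A closed
member not containing `x` does not come near `x` and imposes no condition. -/
lemma hasFDerivWithinAt_iUnion_of_isClosed {ι : Type*} [Finite ι] {s : ι → Set E}
    (hs : ∀ i, IsClosed (s i)) {f : E → F} {f' : E →L[ℝ] F} {x : E}
    (h : ∀ i, x ∈ s i → HasFDerivWithinAt f f' (s i) x) :
    HasFDerivWithinAt f f' (⋃ i, s i) x := by
  have h' : ∀ i, HasFDerivWithinAt f f' (s i) x := fun i => by
    by_cases hx : x ∈ s i
    · exact h i hx
    · exact .of_notMem_closure (by rwa [(hs i).closure_eq])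
  rw [hasFDerivWithinAt_iff_isLittleO, nhdsWithin_iUnion, Asymptotics.isLittleO_iff]
  intro c hc
  rw [Filter.eventually_iSup]
  exact fun i => Asymptotics.isLittleO_iff.1 (hasFDerivWithinAt_iff_isLittleO.1 (h' i)) hc

open Classical in
/-- The function which is `f i` on `s i` and zero outside of all `s i`. -/
def glue {ι : Type*} (s : ι → Set E) (f : ι → E → F) (x : E) : F :=
  if h : ∃ i, x ∈ s i then f h.choose x else 0

omit [NormedAddCommGroup E] [NormedSpace ℝ E] [NormedSpace ℝ F] in
lemma glue_eq {ι : Type*} {s : ι → Set E} {f : ι → E → F}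
    (h : ∀ i j x, x ∈ s i → x ∈ s j → f i x = f j x) {i : ι} {x : E} (hx : x ∈ s i) :
    glue s f x = f i x := by
  have hex : ∃ i, x ∈ s i := ⟨i, hx⟩
  rw [glue, dif_pos hex]
  exact h _ _ x hex.choose_spec hx

lemma contDiffOn_two_differentiable {f : E → F} {s : Set E} (hs : UniqueDiffOn ℝ s)
    (hf : ContDiffOn ℝ 2 f s) : DifferentiableOn ℝ f s ∧
      DifferentiableOn ℝ (fderivWithin ℝ f s) s ∧
      ContinuousOn (fderivWithin ℝ (fderivWithin ℝ f s) s) s := by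
  have h1 : ContDiffOn ℝ (1 + 1) f s := by simpa [one_add_one_eq_two] using hf
  obtain ⟨a, -, b⟩ := (contDiffOn_succ_iff_fderivWithin hs).1 h1
  exact ⟨a, b.differentiableOn one_ne_zero, b.continuousOn_fderivWithin hs le_rfl⟩

/-- Gluing of `C²`-smooth functions on closed sets whose derivatives agree. -/
lemma contDiffOn_glue {ι : Type*} [Finite ι] {s : ι → Set E} (hs : ∀ i, IsClosed (s i))
    (hu : ∀ i, UniqueDiffOn ℝ (s i)) {f : ι → E → F} (hf : ∀ i, ContDiffOn ℝ 2 (f i) (s i))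
    (hj : ∀ i j x, x ∈ s i → x ∈ s j → jet2 (f i) (s i) x = jet2 (f j) (s j) x) :
    ContDiffOn ℝ 2 (glue s f) (⋃ i, s i) := by
  have e0 : ∀ {i x}, x ∈ s i → glue s f x = f i x := fun {i x} hx =>
    glue_eq (fun i j x h h' => congrArg Prod.fst (hj i j x h h')) hx
  have e1 : ∀ {i x}, x ∈ s i → glue s (fun i => fderivWithin ℝ (f i) (s i)) x =
      fderivWithin ℝ (f i) (s i) x := fun {i x} hx =>
    glue_eq (fun i j x h h' => congrArg (fun p => p.2.1) (hj i j x h h')) hx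
  have e2 : ∀ {i x}, x ∈ s i →
      glue s (fun i => fderivWithin ℝ (fderivWithin ℝ (f i) (s i)) (s i)) x =
      fderivWithin ℝ (fderivWithin ℝ (f i) (s i)) (s i) x := fun {i x} hx =>
    glue_eq (fun i j x h h' => congrArg (fun p => p.2.2) (hj i j x h h')) hx
  have hd := fun i => contDiffOn_two_differentiable (hu i) (hf i)
  have U : UniqueDiffOn ℝ (⋃ i, s i) := fun x hx => by
    obtain ⟨i, hi⟩ := mem_iUnion.1 hx
    exact (hu i x hi).mono (subset_iUnion s i)
  -- The glued piecewise derivatives are well defined because the jets agree, and they serve as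
  -- first and second derivatives of the glued function.
  have d0 : ∀ x ∈ ⋃ i, s i, HasFDerivWithinAt (glue s f)
      (glue s (fun i => fderivWithin ℝ (f i) (s i)) x) (⋃ i, s i) x := fun x _ =>
    hasFDerivWithinAt_iUnion_of_isClosed hs fun i hi => by
      rw [e1 hi]
      exact ((hd i).1 x hi).hasFDerivWithinAt.congr (fun y hy => e0 hy) (e0 hi)
  have d1 : ∀ x ∈ ⋃ i, s i, HasFDerivWithinAt (glue s (fun i => fderivWithin ℝ (f i) (s i)))
      (glue s (fun i => fderivWithin ℝ (fderivWithin ℝ (f i) (s i)) (s i)) x) (⋃ i, s i) x :=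
    fun x _ => hasFDerivWithinAt_iUnion_of_isClosed hs fun i hi => by
      rw [e2 hi]
      exact ((hd i).2.1 x hi).hasFDerivWithinAt.congr (fun y hy => e1 hy) (e1 hi)
  have c2 : ContinuousOn (glue s (fun i => fderivWithin ℝ (fderivWithin ℝ (f i) (s i)) (s i)))
      (⋃ i, s i) := (locallyFinite_of_finite s).continuousOn_iUnion hs fun i =>
    (hd i).2.2.congr fun x hx => e2 hx
  have h1 : ContDiffOn ℝ (0 + 1) (glue s (fun i => fderivWithin ℝ (f i) (s i))) (⋃ i, s i) :=
    (contDiffOn_succ_iff_hasFDerivWithinAt_of_uniqueDiffOn U).2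
      ⟨by simp, _, contDiffOn_zero.2 c2, d1⟩
  rw [zero_add] at h1
  have h2 : ContDiffOn ℝ (1 + 1) (glue s f) (⋃ i, s i) :=
    (contDiffOn_succ_iff_hasFDerivWithinAt_of_uniqueDiffOn U).2 ⟨by simp, _, h1, d0⟩
  simpa [one_add_one_eq_two] using h2

lemma jet2_subset {f : E → F} {s t : Set E} (hst : s ⊆ t) (hs : UniqueDiffOn ℝ s)
    (ht : UniqueDiffOn ℝ t) (hf : ContDiffOn ℝ 2 f t) {x : E} (hx : x ∈ s) :
    jet2 f s x = jet2 f t x := by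
  obtain ⟨d0, d1, -⟩ := contDiffOn_two_differentiable ht hf
  have e : ∀ y ∈ s, fderivWithin ℝ f s y = fderivWithin ℝ f t y := fun y hy =>
    fderivWithin_subset hst (hs y hy) (d0 y (hst hy))
  rw [jet2, jet2, e x hx, fderivWithin_congr e (e x hx),
    fderivWithin_subset hst (hs x hx) (d1 x (hst hx))]

lemma jet2_congr {f g : E → F} {s : Set E} (h : EqOn f g s) {x : E} (hx : x ∈ s) :
    jet2 f s x = jet2 g s x := by
  have e : ∀ y ∈ s, fderivWithin ℝ f s y = fderivWithin ℝ g s y := fun y hy =>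
    fderivWithin_congr h (h hy)
  rw [jet2, jet2, h hx, e x hx, fderivWithin_congr e (e x hx)]

lemma jet2_eq_of_sub {f g : E → F} {s : Set E} (hs : UniqueDiffOn ℝ s) (hf : ContDiffOn ℝ 2 f s)
    (hg : ContDiffOn ℝ 2 g s) {x : E} (hx : x ∈ s) (h : jet2 (fun y => f y - g y) s x = 0) :
    jet2 f s x = jet2 g s x := by
  obtain ⟨f0, f1, -⟩ := contDiffOn_two_differentiable hs hf
  obtain ⟨g0, g1, -⟩ := contDiffOn_two_differentiable hs hg
  have e : ∀ y ∈ s, fderivWithin ℝ (fun y => f y - g y) s y =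
      fderivWithin ℝ f s y - fderivWithin ℝ g s y := fun y hy =>
    fderivWithin_fun_sub (hs y hy) (f0 y hy) (g0 y hy)
  have e' : fderivWithin ℝ (fderivWithin ℝ (fun y => f y - g y) s) s x =
      fderivWithin ℝ (fderivWithin ℝ f s) s x - fderivWithin ℝ (fderivWithin ℝ g s) s x := by
    rw [fderivWithin_congr e (e x hx)]
    exact fderivWithin_fun_sub (hs x hx) (f1 x hx) (g1 x hx)
  simp only [jet2, e x hx, e', Prod.mk_eq_zero] at h
  simp only [jet2, Prod.mk.injEq]
  exact ⟨sub_eq_zero.1 h.1, sub_eq_zero.1 h.2.1, sub_eq_zero.1 h.2.2⟩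

/-- A function which vanishes together with its first and second derivative. -/
def Flat (f : E → F) (x : E) : Prop := f x = 0 ∧ fderiv ℝ f x = 0 ∧ fderiv ℝ (fderiv ℝ f) x = 0

/-- A function is flat at the points of a line segment in direction `u` if it vanishes there
together with the first and second derivatives in a transversal direction `v`. -/
lemma flat_of_directional {f : E → ℝ} (hf : ContDiff ℝ 2 f) {u v p : E}
    (huv : ∀ w : E, ∃ a b : ℝ, w = a • u + b • v)
    (h0 : ∀ s ∈ Icc (0 : ℝ) 1, f (p + s • u) = 0)
    (h1 : ∀ s ∈ Icc (0 : ℝ) 1, fderiv ℝ f (p + s • u) v = 0)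
    (h2 : ∀ s ∈ Icc (0 : ℝ) 1, fderiv ℝ (fderiv ℝ f) (p + s • u) v v = 0) :
    ∀ s ∈ Icc (0 : ℝ) 1, Flat f (p + s • u) := by
  have df : Differentiable ℝ f := hf.differentiable two_ne_zero
  have h' : ContDiff ℝ (1 + 1) f := by simpa [one_add_one_eq_two] using hf
  have ddf : Differentiable ℝ (fderiv ℝ f) :=
    ((contDiff_succ_iff_fderiv.1 h').2.2).differentiable one_ne_zero
  have line : ∀ s : ℝ, HasDerivAt (fun s : ℝ => p + s • u) u s := fun s => by
    have := ((hasDerivAt_id s).smul_const u).const_add p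
    simpa using this
  have g1 : ∀ s ∈ Icc (0 : ℝ) 1, fderiv ℝ f (p + s • u) = 0 := fun s hs => by
    have hu : fderiv ℝ f (p + s • u) u = 0 :=
      HasDerivAt.eq_zero_of_Icc (h := fun s => f (p + s • u))
        ((df _).hasFDerivAt.comp_hasDerivAt s (line s)) zero_lt_one hs h0
    ext w
    obtain ⟨a, b, rfl⟩ := huv w
    simp [hu, h1 s hs]
  intro s hs
  refine ⟨h0 s hs, g1 s hs, ?_⟩
  have hu : fderiv ℝ (fderiv ℝ f) (p + s • u) u = 0 :=
    HasDerivAt.eq_zero_of_Icc (h := fun s => fderiv ℝ f (p + s • u))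
      ((ddf _).hasFDerivAt.comp_hasDerivAt s (line s)) zero_lt_one hs g1
  -- The gradient vanishes along the segment, so the second derivative with first argument `u` is
  -- zero. Symmetry covers the pair `(v, u)`, and `(v, v)` is the hypothesis.
  have hsymm : fderiv ℝ (fderiv ℝ f) (p + s • u) v u = fderiv ℝ (fderiv ℝ f) (p + s • u) u v :=
    (hf.contDiffAt.isSymmSndFDerivAt (by simp)) v u
  ext w z
  obtain ⟨a, b, rfl⟩ := huv w
  obtain ⟨a', b', rfl⟩ := huv z
  simp [hu, hsymm, h2 s hs]

variable [FiniteDimensional ℝ E]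

/-- Local inverses of an injective regular mapping on a compact set. -/
lemma exists_local_inverse {G : E → E} (hG : ContDiff ℝ 2 G) {K : Set E} (hK : IsCompact K)
    (hinj : InjOn G K) {ξ : E} (hξ : ξ ∈ K) (hreg : (fderiv ℝ G ξ).det ≠ 0) :
    ∃ ψ : E → E, ContDiffAt ℝ 2 ψ (G ξ) ∧ ψ (G ξ) = ξ ∧
      ∀ᶠ y in 𝓝[G '' K] (G ξ), ψ y ∈ K ∧ G (ψ y) = y := by
  have : CompleteSpace E := FiniteDimensional.complete ℝ E
  have hdet : IsUnit ((fderiv ℝ G ξ : E →L[ℝ] E) : E →ₗ[ℝ] E).det := isUnit_iff_ne_zero.2 hreg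
  let e : E ≃L[ℝ] E :=
    (LinearEquiv.ofIsUnitDet (f := ((fderiv ℝ G ξ : E →L[ℝ] E) : E →ₗ[ℝ] E))
      (v := Module.finBasis ℝ E) (v' := Module.finBasis ℝ E)
      (by rwa [LinearMap.det_toMatrix])).toContinuousLinearEquiv
  have he : (e : E →L[ℝ] E) = fderiv ℝ G ξ := by
    ext x
    simp [e]
  have hd : HasFDerivAt G (e : E →L[ℝ] E) ξ := by
    rw [he]; exact (hG.differentiable two_ne_zero ξ).hasFDerivAt
  set Φ := hG.contDiffAt.toOpenPartialHomeomorph G hd two_ne_zero with hΦ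
  have hΦG : ∀ x, Φ x = G x := fun _ => rfl
  have hsrc : ξ ∈ Φ.source := ContDiffAt.mem_toOpenPartialHomeomorph_source _ hd two_ne_zero
  refine ⟨Φ.symm, hG.contDiffAt.to_localInverse hd two_ne_zero, Φ.left_inv hsrc, ?_⟩
  -- Points of `K` outside the domain of the local inverse have a compact image, which misses `G ξ`
  -- by injectivity. Near `G ξ` every point of `G '' K` therefore has its preimage inside that
  -- domain.
  have hcl : IsClosed (G '' (K \ Φ.source)) :=
    ((hK.diff Φ.open_source).image hG.continuous).isClosed
  have hnot : G ξ ∉ G '' (K \ Φ.source) := by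
    rintro ⟨η, ⟨hη, hη'⟩, h⟩
    exact hη' (by rw [hinj hη hξ h]; exact hsrc)
  filter_upwards [self_mem_nhdsWithin, mem_nhdsWithin_of_mem_nhds (hcl.isOpen_compl.mem_nhds hnot)]
  rintro _ ⟨η, hη, rfl⟩ h
  have hη' : η ∈ Φ.source := by
    by_contra hc
    exact h ⟨η, ⟨hη, hc⟩, rfl⟩
  have : Φ.symm (G η) = η := Φ.left_inv hη'
  rw [this]
  exact ⟨hη, rfl⟩

lemma uniqueDiffOn_image_of_det_ne_zero {G : E → E} (hG : ContDiff ℝ 2 G) {K : Set E}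
    (hu : UniqueDiffOn ℝ K) (hreg : ∀ ξ ∈ K, (fderiv ℝ G ξ).det ≠ 0) :
    UniqueDiffOn ℝ (G '' K) := by
  rintro _ ⟨ξ, hξ, rfl⟩
  refine HasFDerivWithinAt.uniqueDiffWithinAt
    (hG.differentiable two_ne_zero ξ).hasFDerivAt.hasFDerivWithinAt (hu ξ hξ) ?_
  have hdet : IsUnit ((fderiv ℝ G ξ : E →L[ℝ] E) : E →ₗ[ℝ] E).det :=
    isUnit_iff_ne_zero.2 (hreg ξ hξ)
  have hs : Function.Surjective ((fderiv ℝ G ξ : E →L[ℝ] E) : E →ₗ[ℝ] E) :=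
    LinearMap.range_eq_top.1 (LinearMap.range_eq_top.2
      ((LinearEquiv.ofIsUnitDet (f := ((fderiv ℝ G ξ : E →L[ℝ] E) : E →ₗ[ℝ] E))
      (v := Module.finBasis ℝ E) (v' := Module.finBasis ℝ E)
      (by rwa [LinearMap.det_toMatrix])).surjective))
  exact hs.denseRange

lemma contDiffOn_of_comp {G : E → E} (hG : ContDiff ℝ 2 G) {K : Set E} (hK : IsCompact K)
    (hinj : InjOn G K) (hreg : ∀ ξ ∈ K, (fderiv ℝ G ξ).det ≠ 0) {h δ : E → F}
    (hδ : ContDiff ℝ 2 δ) (hh : ∀ ξ ∈ K, h (G ξ) = δ ξ) : ContDiffOn ℝ 2 h (G '' K) := by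
  rintro _ ⟨ξ, hξ, rfl⟩
  obtain ⟨ψ, h1, h2, h3⟩ := exists_local_inverse hG hK hinj hξ (hreg ξ hξ)
  have hc : ContDiffAt ℝ 2 (δ ∘ ψ) (G ξ) := hδ.contDiffAt.comp _ h1
  refine hc.contDiffWithinAt.congr_of_eventuallyEq ?_ ?_
  · filter_upwards [h3] with y hy
    rw [Function.comp_apply, ← hh _ hy.1, hy.2]
  · rw [Function.comp_apply, h2, hh ξ hξ]

/-- Locally `h = δ ∘ ψ` with a smooth inverse `ψ`. Every term of the chain rule up to second order
contains `δ` or one of its first two derivatives at `ξ`. -/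
lemma jet2_eq_zero_of_flat {G : E → E} (hG : ContDiff ℝ 2 G) {K : Set E} (hK : IsCompact K)
    (hu : UniqueDiffOn ℝ K)
    (hinj : InjOn G K) (hreg : ∀ ξ ∈ K, (fderiv ℝ G ξ).det ≠ 0) {h δ : E → F}
    (hδ : ContDiff ℝ 2 δ) (hh : ∀ ξ ∈ K, h (G ξ) = δ ξ) {ξ : E} (hξ : ξ ∈ K) (hflat : Flat δ ξ) :
    jet2 h (G '' K) (G ξ) = 0 := by
  obtain ⟨ψ, h1, h2, h3⟩ := exists_local_inverse hG hK hinj hξ (hreg ξ hξ)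
  have hU := uniqueDiffOn_image_of_det_ne_zero hG hu hreg
  have hmem : G ξ ∈ G '' K := mem_image_of_mem G hξ
  have dδ : Differentiable ℝ δ := hδ.differentiable two_ne_zero
  have h' : ContDiff ℝ (1 + 1) δ := by simpa [one_add_one_eq_two] using hδ
  have ddδ : Differentiable ℝ (fderiv ℝ δ) :=
    ((contDiff_succ_iff_fderiv.1 h').2.2).differentiable one_ne_zero
  have heq : h =ᶠ[𝓝[G '' K] (G ξ)] (δ ∘ ψ) := by
    filter_upwards [h3] with y hy
    rw [Function.comp_apply, ← hh _ hy.1, hy.2]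
  have hψd : ∀ᶠ y in 𝓝 (G ξ), DifferentiableAt ℝ ψ y :=
    (h1.eventually (by simp)).mono fun y hy => hy.differentiableAt two_ne_zero
  have e1 : fderivWithin ℝ h (G '' K) =ᶠ[𝓝[G '' K] (G ξ)]
      fun y => (fderiv ℝ δ (ψ y)).comp (fderiv ℝ ψ y) := by
    filter_upwards [eventually_eventually_nhdsWithin.2 heq, self_mem_nhdsWithin,
      mem_nhdsWithin_of_mem_nhds hψd] with y hy hy' hy''
    have hy0 : h y = (δ ∘ ψ) y := hy.self_of_nhdsWithin hy'
    rw [Filter.EventuallyEq.fderivWithin_eq hy hy0,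
      ((dδ _).comp y hy'').fderivWithin (hU y hy')]
    exact fderiv_comp y (dδ _) hy''
  have ddψ : DifferentiableAt ℝ (fderiv ℝ ψ) (G ξ) :=
    (h1.fderiv_right (m := 1) (by norm_num)).differentiableAt one_ne_zero
  have e2 : HasFDerivAt (fun y => (fderiv ℝ δ (ψ y)).comp (fderiv ℝ ψ y))
      (0 : E →L[ℝ] E →L[ℝ] F) (G ξ) := by
    have hc : HasFDerivAt (fun y => fderiv ℝ δ (ψ y)) (0 : E →L[ℝ] E →L[ℝ] F) (G ξ) := by
      have := (ddδ (ψ (G ξ))).hasFDerivAt.comp (G ξ) hψd.self_of_nhds.hasFDerivAt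
      rw [h2, hflat.2.2, ContinuousLinearMap.zero_comp] at this
      exact this
    have := hc.clm_comp ddψ.hasFDerivAt
    rw [h2, hflat.2.1] at this
    simpa using this
  have e1x : fderivWithin ℝ h (G '' K) (G ξ) = 0 := by
    rw [e1.self_of_nhdsWithin hmem]
    dsimp only
    rw [h2, hflat.2.1, ContinuousLinearMap.zero_comp]
  rw [jet2, hh ξ hξ, hflat.1, e1x, e1.fderivWithin_eq (e1.self_of_nhdsWithin hmem),
    e2.hasFDerivWithinAt.fderivWithin (hU _ hmem)]
  rfl

end Gluing

/-! ### Smoothness across a leg at its end point -/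

section EdgeTransfer

open Topology Filter BSpline

/-- Functions which vanish of order three at `0`. -/
lemma tendsto_div_of_hasJet {f : ℝ → ℝ} (hf : ContDiff ℝ 2 f) (h : HasJet f 0 0 0 0) :
    Tendsto (fun t => f t / t ^ 2) (𝓝[>] 0) (𝓝 0) ∧ Tendsto (fun t => deriv f t / t) (𝓝[>] 0) (𝓝 0) ∧
      Tendsto (deriv (deriv f)) (𝓝[>] 0) (𝓝 0) := by
  have df : Differentiable ℝ f := hf.differentiable two_ne_zero
  have c0 := df.continuous
  have ddf := hf.differentiable_deriv
  have h' : ContDiff ℝ (1 + 1) f := by simpa [one_add_one_eq_two] using hf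
  have c2 : Continuous (deriv (deriv f)) :=
    ((contDiff_succ_iff_deriv.1 h').2.2).continuous_deriv le_rfl
  have t2 : Tendsto (deriv (deriv f)) (𝓝[>] 0) (𝓝 0) := by
    have := (c2.tendsto 0).mono_left (nhdsWithin_le_nhds (s := Ioi 0))
    rwa [h.2.2] at this
  have t1 : Tendsto (fun t => deriv f t / t) (𝓝[>] 0) (𝓝 0) := by
    have := (ddf 0).hasDerivAt.tendsto_slope_zero_right
    rw [h.2.2] at this
    refine this.congr fun t => ?_
    rw [zero_add, h.2.1, sub_zero, smul_eq_mul, inv_mul_eq_div]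
  refine ⟨?_, t1, t2⟩
  have hpos : ∀ᶠ t : ℝ in 𝓝[>] 0, 0 < t := self_mem_nhdsWithin
  refine HasDerivAt.lhopital_zero_nhdsGT (f' := deriv f) (g' := fun t => 2 * t)
    (Eventually.of_forall fun t => (df t).hasDerivAt)
    (Eventually.of_forall fun t => by simpa using hasDerivAt_pow 2 t)
    (hpos.mono fun t ht => by positivity) ?_ ?_ ?_
  · have := (c0.tendsto 0).mono_left (nhdsWithin_le_nhds (s := Ioi 0))
    rwa [h.1] at this
  · have : Tendsto (fun t : ℝ => t ^ 2) (𝓝 0) (𝓝 (0 ^ 2)) := (continuous_pow 2).tendsto 0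
    rw [zero_pow two_ne_zero] at this
    exact this.mono_left nhdsWithin_le_nhds
  · have := t1.div_const 2
    rw [zero_div] at this
    refine this.congr fun t => ?_
    rw [div_div, mul_comm t 2]

lemma tendsto_id_right : Tendsto (fun t : ℝ => t) (𝓝[>] 0) (𝓝 0) :=
  tendsto_id.mono_left nhdsWithin_le_nhds

/-- After subtraction of the quadratic Taylor polynomial the remainder is `o(t ^ 2)`. Hence the
polynomial is `o(t ^ 2)` as well, and its three coefficients vanish in turn. -/
lemma hasJet_of_tendsto_div {f : ℝ → ℝ} (hf : ContDiff ℝ 2 f)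
    (h : Tendsto (fun t => f t / t ^ 2) (𝓝[>] 0) (𝓝 0)) : HasJet f 0 0 0 0 := by
  set a := f 0 with ha
  set b := deriv f 0 with hb
  set c := deriv (deriv f) 0 with hc
  set q : Polynomial ℝ := Polynomial.C a + Polynomial.C b * Polynomial.X +
    Polynomial.C (c / 2) * (Polynomial.X * Polynomial.X) with hq
  have cq := contDiff_polynomial q
  have jq : HasJet (fun t => q.eval t) 0 a b c := by
    have := hasJet_polynomial q 0
    simpa [hq, ← two_mul, mul_div_cancel₀] using this
  have jf : HasJet f 0 a b c := ⟨rfl, rfl, rfl⟩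
  have j := jf.add hf (contDiff_const.mul cq) (jq.const_mul cq (-1))
  have ej : HasJet (fun t => f t + -1 * q.eval t) 0 0 0 0 := by
    convert j using 1 <;> ring
  have t0 := (tendsto_div_of_hasJet (hf.add (contDiff_const.mul cq)) ej).1
  have t1 : Tendsto (fun t => q.eval t / t ^ 2) (𝓝[>] 0) (𝓝 0) := by
    have := h.sub t0
    rw [sub_zero] at this
    refine this.congr fun t => ?_
    ring
  have hqe : ∀ t, q.eval t = a + b * t + c / 2 * t ^ 2 := fun t => by
    simp only [hq, Polynomial.eval_add, Polynomial.eval_mul, Polynomial.eval_C, Polynomial.eval_X]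
    ring
  have hpos : ∀ᶠ t : ℝ in 𝓝[>] 0, t ≠ 0 := by
    filter_upwards [self_mem_nhdsWithin] with t ht using (mem_Ioi.1 ht).ne'
  have id := tendsto_id_right
  have a0 : a = 0 := by
    have s1 := t1.mul (id.pow 2)
    have s2 : Tendsto (fun t => a + b * t + c / 2 * t ^ 2) (𝓝[>] 0)
        (𝓝 (a + b * 0 + c / 2 * 0 ^ 2)) :=
      ((tendsto_const_nhds.add (id.const_mul b)).add ((id.pow 2).const_mul _))
    have := tendsto_nhds_unique (s1.congr' (hpos.mono fun t ht => by
      rw [hqe]; field_simp)) s2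
    simpa using this.symm
  have b0 : b = 0 := by
    have s1 := t1.mul id
    have s2 : Tendsto (fun t => b + c / 2 * t) (𝓝[>] 0) (𝓝 (b + c / 2 * 0)) :=
      tendsto_const_nhds.add (id.const_mul _)
    have := tendsto_nhds_unique (s1.congr' (hpos.mono fun t ht => by
      rw [hqe, a0]; field_simp; ring)) s2
    simpa using this.symm
  have c0 : c = 0 := by
    have s2 : Tendsto (fun _ : ℝ => c / 2) (𝓝[>] 0) (𝓝 (c / 2)) := tendsto_const_nhds
    have := tendsto_nhds_unique (t1.congr' (hpos.mono fun t ht => by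
      rw [hqe, a0, b0]; field_simp; ring)) s2
    linarith
  rwa [a0, b0, c0] at jf

variable {E : Type*} [NormedAddCommGroup E] [NormedSpace ℝ E]

lemma hasDerivAt_line (x V : E) (t : ℝ) : HasDerivAt (fun t : ℝ => x + t • V) V t := by
  have := ((hasDerivAt_id t).smul_const V).const_add x
  simpa using this

lemma hasDerivAt_comp_line {w : E → ℝ} {x V : E} {t : ℝ} (dw : DifferentiableAt ℝ w (x + t • V)) :
    HasDerivAt (fun y : ℝ => w (x + y • V)) (fderiv ℝ w (x + t • V) V) t :=
  dw.hasFDerivAt.comp_hasDerivAt t (hasDerivAt_line x V t)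

lemma hasDerivAt_fderiv_line {w : E → ℝ} {x V : E} {t : ℝ}
    (dd : DifferentiableAt ℝ (fderiv ℝ w) (x + t • V)) {P : ℝ → E} {P' : E}
    (hP : HasDerivAt P P' t) :
    HasDerivAt (fun y : ℝ => fderiv ℝ w (x + y • V) (P y))
      (fderiv ℝ (fderiv ℝ w) (x + t • V) V (P t) + fderiv ℝ w (x + t • V) P') t := by
  have e : HasDerivAt (fun y : ℝ => fderiv ℝ w (x + y • V))
      (fderiv ℝ (fderiv ℝ w) (x + t • V) V) t :=
    dd.hasFDerivAt.comp_hasDerivAt t (hasDerivAt_line x V t)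
  exact e.clm_apply hP

/-- Derivatives of a `C²`-smooth function in a direction, computed on one side. -/
lemma directional_derivs {w : E → ℝ} {x P : E} (hw : ContDiffAt ℝ 2 w x) {g : ℝ → ℝ}
    (hg : ContDiff ℝ 2 g) (h : ∀ r ∈ Icc (0 : ℝ) 1, w (x + r • P) = g r) :
    fderiv ℝ w x P = deriv g 0 ∧ fderiv ℝ (fderiv ℝ w) x P P = deriv (deriv g) 0 := by
  have ht : Tendsto (fun r : ℝ => x + r • P) (𝓝 0) (𝓝 x) := by
    have := (hasDerivAt_line x P 0).continuousAt.tendsto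
    simpa using this
  obtain ⟨ε, hε, hball⟩ := Metric.eventually_nhds_iff.1 (ht.eventually (hw.eventually (by simp)))
  set a := min (ε / 2) 1 with ha
  have ha0 : 0 < a := lt_min (half_pos hε) one_pos
  have hwa : ∀ r ∈ Icc 0 a, ContDiffAt ℝ 2 w (x + r • P) := fun r hr => hball (by
    rw [Real.dist_0_eq_abs, abs_of_nonneg hr.1]
    have : a ≤ ε / 2 := min_le_left _ _
    linarith [hr.2])
  have d1 : ∀ r ∈ Icc 0 a, fderiv ℝ w (x + r • P) P - deriv g r = 0 := fun r hr => by
    have e1 := hasDerivAt_comp_line ((hwa r hr).differentiableAt two_ne_zero)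
    refine (e1.sub (hg.differentiable two_ne_zero r).hasDerivAt).eq_zero_of_Icc ha0 hr ?_
    intro y hy
    have : w (x + y • P) = g y := h y ⟨hy.1, hy.2.trans (min_le_right _ _)⟩
    simp [this]
  have m0 : (0 : ℝ) ∈ Icc 0 a := ⟨le_rfl, ha0.le⟩
  have hx0 : x + (0 : ℝ) • P = x := by simp
  constructor
  · have := d1 0 m0
    rw [hx0] at this
    exact sub_eq_zero.1 this
  · have dd : DifferentiableAt ℝ (fderiv ℝ w) (x + (0 : ℝ) • P) :=
      ((hwa 0 m0).fderiv_right (m := 1) (by norm_num)).differentiableAt one_ne_zero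
    have e2 := hasDerivAt_fderiv_line dd (hasDerivAt_const (0 : ℝ) P)
    have := (e2.sub (hg.differentiable_deriv 0).hasDerivAt).eq_zero_of_Icc ha0 m0 d1
    rw [hx0] at this
    simpa [sub_eq_zero] using this

/-- Let `w` be `C²`-smooth at the end point `v₀` of a leg with direction `V`, and consider bilinear
mappings on both sides of the leg whose transversal directions at `v₀` are collinear. If the
composition of `w` with one of them vanishes of order three in both variables at `v₀`, then so
does the composition with the other one. -/
lemma leg_transfer {w : E → ℝ} {v₀ V n : E} (hw : ContDiffAt ℝ 2 w v₀)
    {μ η lam μ' η' : ℝ} {g g' : ℝ → ℝ → ℝ} {r0 r1 r2 l0 l1 l2 : ℝ → ℝ}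
    (hg : ∀ t, ContDiff ℝ 2 (g t)) (hg' : ∀ t, ContDiff ℝ 2 (g' t))
    (hr : ∀ t, g t 0 = r0 t ∧ deriv (g t) 0 = r1 t ∧ deriv (deriv (g t)) 0 = r2 t)
    (hl : ∀ t, g' t 0 = l0 t ∧ deriv (g' t) 0 = l1 t ∧ deriv (deriv (g' t)) 0 = l2 t)
    (cr0 : ContDiff ℝ 2 r0) (cr1 : ContDiff ℝ 2 r1) (cr2 : ContDiff ℝ 2 r2)
    (cl0 : ContDiff ℝ 2 l0) (cl1 : ContDiff ℝ 2 l1) (cl2 : ContDiff ℝ 2 l2)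
    (hgw : ∀ t ∈ Icc (0 : ℝ) 1, ∀ r ∈ Icc (0 : ℝ) 1,
      w (v₀ + t • V + r • (n + t • (μ • n + η • V))) = g t r)
    (hgw' : ∀ t ∈ Icc (0 : ℝ) 1, ∀ r ∈ Icc (0 : ℝ) 1,
      w (v₀ + t • V + r • (lam • n + t • (μ' • (lam • n) + η' • V))) = g' t r)
    (j0 : HasJet r0 0 0 0 0) (j1 : HasJet r1 0 0 0 0) (j2 : HasJet r2 0 0 0 0) :
    HasJet l0 0 0 0 0 ∧ HasJet l1 0 0 0 0 ∧ HasJet l2 0 0 0 0 := by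
  have ht : Tendsto (fun t : ℝ => v₀ + t • V) (𝓝 0) (𝓝 v₀) := by
    have := (hasDerivAt_line v₀ V 0).continuousAt.tendsto
    simpa using this
  have m0 : (0 : ℝ) ∈ Icc (0 : ℝ) 1 := ⟨le_rfl, zero_le_one⟩
  have hw0 : ∀ t ∈ Icc (0 : ℝ) 1, w (v₀ + t • V) = r0 t := fun t ht => by
    rw [← (hr t).1, ← hgw t ht 0 m0]; simp
  have hw0' : ∀ t ∈ Icc (0 : ℝ) 1, w (v₀ + t • V) = l0 t := fun t ht => by
    rw [← (hl t).1, ← hgw' t ht 0 m0]; simp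
  -- At a point of the leg near `v₀`, both sides are expressed by the same derivatives of `w`: `W1 =
  -- ∂_n w`, `H1 = ∂_V ∂_n w`, `H2 = ∂_n ∂_n w`. Nothing beyond order two of `w` is used.
  have key : ∀ᶠ t in 𝓝[>] (0 : ℝ), 0 < t ∧ ∃ W1 H1 H2 : ℝ,
      r1 t = (1 + t * μ) * W1 + t * η * deriv r0 t ∧
      deriv r1 t = (1 + t * μ) * H1 + t * η * deriv (deriv r0) t + μ * W1 + η * deriv r0 t ∧
      r2 t = (1 + t * μ) ^ 2 * H2 + 2 * (1 + t * μ) * (t * η) * H1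
        + (t * η) ^ 2 * deriv (deriv r0) t ∧
      l1 t = (1 + t * μ') * lam * W1 + t * η' * deriv r0 t ∧
      l2 t = (1 + t * μ') ^ 2 * lam ^ 2 * H2 + 2 * (1 + t * μ') * lam * (t * η') * H1
        + (t * η') ^ 2 * deriv (deriv r0) t := by
    have ev : ∀ᶠ t in 𝓝 (0 : ℝ), ContDiffAt ℝ 2 w (v₀ + t • V) :=
      ht.eventually (hw.eventually (by simp))
    have hlt : ∀ᶠ t in 𝓝[>] (0 : ℝ), t < 1 :=
      mem_nhdsWithin_of_mem_nhds (Iio_mem_nhds one_pos)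
    filter_upwards [self_mem_nhdsWithin, hlt, mem_nhdsWithin_of_mem_nhds (ev.eventually_nhds)]
      with t ht0 ht1 hev
    have ht0 : 0 < t := ht0
    have htI : t ∈ Icc (0 : ℝ) 1 := ⟨ht0.le, ht1.le⟩
    have hwt : ContDiffAt ℝ 2 w (v₀ + t • V) := hev.self_of_nhds
    set x := v₀ + t • V with hx
    have hsymm : ∀ a b, fderiv ℝ (fderiv ℝ w) x a b = fderiv ℝ (fderiv ℝ w) x b a := fun a b =>
      hwt.isSymmSndFDerivAt (by simp) a b
    have hI : ∀ᶠ y in 𝓝 t, y ∈ Icc (0 : ℝ) 1 := Icc_mem_nhds ht0 ht1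
    have dd : DifferentiableAt ℝ (fderiv ℝ w) x :=
      (hwt.fderiv_right (m := 1) (by norm_num)).differentiableAt one_ne_zero
    have e0 : ∀ᶠ y in 𝓝 t, fderiv ℝ w (v₀ + y • V) V = deriv r0 y := by
      filter_upwards [hev, hI.eventually_nhds] with y hy hy'
      have e1 := hasDerivAt_comp_line (hy.differentiableAt two_ne_zero)
      have e2 : (fun t : ℝ => w (v₀ + t • V)) =ᶠ[𝓝 y] r0 := by
        filter_upwards [hy'] with z hz using hw0 z hz
      rw [← e2.deriv_eq, e1.deriv]
    have e0' : fderiv ℝ (fderiv ℝ w) x V V = deriv (deriv r0) t := by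
      have e1 := hasDerivAt_fderiv_line dd (hasDerivAt_const t V)
      have e2 : (fun y => fderiv ℝ w (v₀ + y • V) V) =ᶠ[𝓝 t] deriv r0 := e0
      rw [← e2.deriv_eq]
      simpa using e1.deriv.symm
    have hP : ∀ y ∈ Icc (0 : ℝ) 1, ContDiffAt ℝ 2 w (v₀ + y • V) →
        fderiv ℝ w (v₀ + y • V) (n + y • (μ • n + η • V)) = r1 y ∧
        fderiv ℝ (fderiv ℝ w) (v₀ + y • V) (n + y • (μ • n + η • V))
          (n + y • (μ • n + η • V)) = r2 y := fun y hy hwy => by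
      have := directional_derivs hwy (hg y) (hgw y hy)
      rwa [(hr y).2.1, (hr y).2.2] at this
    have hP' := directional_derivs hwt (hg' t) (hgw' t htI)
    rw [(hl t).2.1, (hl t).2.2] at hP'
    have e1' : fderiv ℝ (fderiv ℝ w) x V (n + t • (μ • n + η • V)) +
        fderiv ℝ w x (μ • n + η • V) = deriv r1 t := by
      have lP : HasDerivAt (fun y : ℝ => n + y • (μ • n + η • V)) (μ • n + η • V) t := by
        have := ((hasDerivAt_id t).smul_const (μ • n + η • V)).const_add n
        simpa using this
      have e1 := hasDerivAt_fderiv_line dd lP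
      have e2 : (fun y => fderiv ℝ w (v₀ + y • V) (n + y • (μ • n + η • V))) =ᶠ[𝓝 t] r1 := by
        filter_upwards [hI, hev] with y hy hy' using (hP y hy hy').1
      rw [← e2.deriv_eq]
      exact e1.deriv.symm
    obtain ⟨p1, p2⟩ := hP t htI hwt
    have e0t := e0.self_of_nhds
    refine ⟨ht0, fderiv ℝ w x n, fderiv ℝ (fderiv ℝ w) x V n, fderiv ℝ (fderiv ℝ w) x n n,
      ?_, ?_, ?_, ?_, ?_⟩
    · rw [← p1, ← e0t]
      simp only [map_add, map_smul, smul_eq_mul]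
      ring
    · rw [← e1', ← e0t, ← e0']
      simp only [map_add, map_smul, smul_eq_mul]
      ring
    · rw [← p2, ← e0', ← hx]
      simp only [map_add, map_smul, smul_eq_mul, _root_.add_apply,
        _root_.smul_apply, hsymm n V]
      ring
    · rw [← hP'.1, ← e0t]
      simp only [map_add, map_smul, smul_eq_mul]
      ring
    · rw [← hP'.2, ← e0']
      simp only [map_add, map_smul, smul_eq_mul, _root_.add_apply,
        _root_.smul_apply, hsymm n V]
      ring
  obtain ⟨a0, a1, a2⟩ := tendsto_div_of_hasJet cr0 j0
  obtain ⟨b0, b1, -⟩ := tendsto_div_of_hasJet cr1 j1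
  obtain ⟨c0, -, -⟩ := tendsto_div_of_hasJet cr2 j2
  have id := tendsto_id_right
  have tA : ∀ μ : ℝ, Tendsto (fun t : ℝ => 1 + t * μ) (𝓝[>] 0) (𝓝 1) := fun μ => by
    have := tendsto_const_nhds (x := (1 : ℝ)).add (id.mul_const μ)
    simpa using this
  have hAne : ∀ᶠ t in 𝓝[>] (0 : ℝ), 1 + t * μ ≠ 0 := (tA μ).eventually_ne one_ne_zero
  -- `w1`, `h1`, `h2` are `W1 / t ^ 2`, `H1 / t`, `H2 / t ^ 2`, obtained by solving the equations of
  -- the known side. The rate `o(t)` suffices for `H1`, since it enters second transversal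
  -- derivatives with a factor `t`.
  set w1 : ℝ → ℝ := fun t => (r1 t / t ^ 2 - η * (deriv r0 t / t)) / (1 + t * μ) with hw1
  have tw1 : Tendsto w1 (𝓝[>] 0) (𝓝 0) := by
    have := (b0.sub (a1.const_mul η)).div (tA μ) one_ne_zero
    rw [show (0 - η * 0) / 1 = (0 : ℝ) by ring] at this
    exact this
  set h1 : ℝ → ℝ := fun t => (deriv r1 t / t - η * deriv (deriv r0) t - η * (deriv r0 t / t)
    - μ * (t * w1 t)) / (1 + t * μ) with hh1
  have th1 : Tendsto h1 (𝓝[>] 0) (𝓝 0) := by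
    have := (((b1.sub (a2.const_mul η)).sub (a1.const_mul η)).sub
      ((id.mul tw1).const_mul μ)).div (tA μ) one_ne_zero
    rw [show (0 - η * 0 - η * 0 - μ * (0 * 0)) / 1 = (0 : ℝ) by ring] at this
    exact this
  set h2 : ℝ → ℝ := fun t => (r2 t / t ^ 2 - 2 * ((1 + t * μ) * (η * h1 t))
    - η ^ 2 * deriv (deriv r0) t) / (1 + t * μ) ^ 2 with hh2
  have th2 : Tendsto h2 (𝓝[>] 0) (𝓝 0) := by
    have := ((c0.sub (((tA μ).mul (th1.const_mul η)).const_mul 2)).sub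
      (a2.const_mul (η ^ 2))).div ((tA μ).pow 2) (by simp)
    rw [show (0 - 2 * (1 * (η * 0)) - η ^ 2 * 0) / 1 ^ 2 = (0 : ℝ) by ring] at this
    exact this
  refine ⟨?_, hasJet_of_tendsto_div cl1 ?_, hasJet_of_tendsto_div cl2 ?_⟩
  · obtain ⟨q1, q2⟩ := derivs_eq_of_Icc cr0 cl0 one_pos
      (fun t ht => (hw0 t ht).symm.trans (hw0' t ht)) m0
    exact ⟨by rw [← hw0' 0 m0, hw0 0 m0, j0.1], by rw [← q1, j0.2.1], by rw [← q2, j0.2.2]⟩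
  -- The transversal derivative of the other side, divided by `t ^ 2`, is a combination of
  -- quantities tending to zero. As it is itself `C²` along the leg, its jet of order two vanishes.
  · have lim : Tendsto (fun t => (1 + t * μ') * (lam * w1 t) + η' * (deriv r0 t / t))
        (𝓝[>] 0) (𝓝 0) := by
      have := ((tA μ').mul (tw1.const_mul lam)).add (a1.const_mul η')
      simpa using this
    refine lim.congr' ?_
    filter_upwards [key, hAne] with t ht hA
    obtain ⟨ht0, W1, H1, H2, k1, k2, k3, k4, k5⟩ := ht
    have hW : w1 t = W1 / t ^ 2 := by
      simp only [hw1, k1]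
      field_simp
      ring
    rw [hW, k4]
    field_simp
  · have lim : Tendsto (fun t => (1 + t * μ') ^ 2 * (lam ^ 2 * h2 t) + 2 * ((1 + t * μ') *
        (lam * η' * h1 t)) + η' ^ 2 * deriv (deriv r0) t) (𝓝[>] 0) (𝓝 0) := by
      have := ((((tA μ').pow 2).mul (th2.const_mul (lam ^ 2))).add
        (((tA μ').mul (th1.const_mul (lam * η'))).const_mul 2)).add (a2.const_mul (η' ^ 2))
      simpa using this
    refine lim.congr' ?_
    filter_upwards [key, hAne] with t ht hA
    obtain ⟨ht0, W1, H1, H2, k1, k2, k3, k4, k5⟩ := ht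
    have hW : w1 t = W1 / t ^ 2 := by
      simp only [hw1, k1]
      field_simp
      ring
    have hH1 : h1 t = H1 / t := by
      simp only [hh1, hW, k2]
      field_simp
      ring
    have hH2 : h2 t = H2 / t ^ 2 := by
      simp only [hh2, hH1, k3]
      field_simp
      ring
    rw [hH1, hH2, k5]
    field_simp

end EdgeTransfer

namespace BSpline

variable {d k : ℕ}

/-! ### Tensor-product splines as `C²`-smooth functions on the plane -/

/-- The `C²`-smooth extension of a tensor-product spline with coefficients `c`. -/
def tensor (d k : ℕ) (c : Fin (maxIndex d k + 1) → Fin (maxIndex d k + 1) → ℝ) (ξ : ℝ × ℝ) : ℝ :=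
  spline d k (fun i' => spline d k (fun i => c i i') ξ.1) ξ.2

variable {c : Fin (maxIndex d k + 1) → Fin (maxIndex d k + 1) → ℝ}

lemma tensor_eq_sum (ξ : ℝ × ℝ) : tensor d k c ξ =
    ∑ i, ∑ i', c i i' * (smooth d k i ξ.1 * smooth d k i' ξ.2) := by
  rw [Finset.sum_comm]
  simp only [tensor, spline, Finset.sum_mul, mul_assoc]

lemma tensor_swap (s t : ℝ) : tensor d k c (s, t) = tensor d k (fun i i' => c i' i) (t, s) := by
  rw [tensor_eq_sum, tensor_eq_sum, Finset.sum_comm]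
  simp only [mul_comm (smooth d k _ s)]

lemma contDiff_tensor : ContDiff ℝ 2 (tensor d k c) := by
  rw [show tensor d k c = _ from funext tensor_eq_sum]
  exact ContDiff.sum fun i _ => ContDiff.sum fun i' _ => contDiff_const.mul
    (((contDiff_smooth i).comp contDiff_fst).mul ((contDiff_smooth i').comp contDiff_snd))

lemma tensor_sub (c c' : Fin (maxIndex d k + 1) → Fin (maxIndex d k + 1) → ℝ) (ξ : ℝ × ℝ) :
    tensor d k (fun i i' => c i i' - c' i i') ξ = tensor d k c ξ - tensor d k c' ξ := by
  simp only [tensor_eq_sum, sub_mul, Finset.sum_sub_distrib]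

lemma coeff_eq_zero_of_tensor (h : ∀ ξ ∈ unitSquare, tensor d k c ξ = 0) : ∀ i i', c i i' = 0 := by
  have h1 : ∀ s ∈ Icc (0 : ℝ) 1, (fun i' => spline d k (fun i => c i i') s) = 0 := fun s hs =>
    coeff_eq_zero fun t ht => h (s, t) ⟨hs, ht⟩
  intro i i'
  exact congrFun (coeff_eq_zero (c := fun i => c i i') fun s hs => congrFun (h1 s hs) i') i

lemma hasJet_spline (hd : 5 ≤ d) (c : Fin (maxIndex d k + 1) → ℝ) : HasJet (spline d k c) 0
    (c (Fin.ofNat _ 0)) (d / breakpoint k 0 * (c (Fin.ofNat _ 1) - c (Fin.ofNat _ 0)))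
    (d * (d - 1) / breakpoint k 0 ^ 2 *
      (c (Fin.ofNat _ 2) - 2 * c (Fin.ofNat _ 1) + c (Fin.ofNat _ 0))) :=
  spline_derivs_zero hd c

lemma hasJet_spline_of_eq_zero {c : Fin (maxIndex d k + 1) → ℝ} {x : ℝ}
    (h : ∀ i, c i = 0 ∨ HasJet (smooth d k i) x 0 0 0) : HasJet (spline d k c) x 0 0 0 := by
  refine ⟨Finset.sum_eq_zero fun i _ => ?_, ?_, ?_⟩
  · rcases h i with h | h
    · rw [h, zero_mul]
    · rw [h.1, mul_zero]
  · rw [deriv_spline]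
    refine Finset.sum_eq_zero fun i _ => ?_
    rcases h i with h | h
    · rw [h, zero_mul]
    · rw [h.2.1, mul_zero]
  · rw [deriv_deriv_spline]
    refine Finset.sum_eq_zero fun i _ => ?_
    rcases h i with h | h
    · rw [h, zero_mul]
    · rw [h.2.2, mul_zero]

lemma hasJet_spline_zero (hd : 5 ≤ d) {c : Fin (maxIndex d k + 1) → ℝ}
    (h : ∀ i : Fin (maxIndex d k + 1), (i : ℕ) ≤ 2 → c i = 0) : HasJet (spline d k c) 0 0 0 0 :=
  hasJet_spline_of_eq_zero fun i => by
    by_cases hi : (i : ℕ) ≤ 2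
    · exact .inl (h i hi)
    · exact .inr (smooth_derivs_zero_of_three_le hd (by omega))

lemma hasJet_spline_one (hd : 5 ≤ d) {c : Fin (maxIndex d k + 1) → ℝ}
    (h : ∀ i : Fin (maxIndex d k + 1), maxIndex d k < i + 3 → c i = 0) :
    HasJet (spline d k c) 1 0 0 0 :=
  hasJet_spline_of_eq_zero fun i => by
    by_cases hi : maxIndex d k < (i : ℕ) + 3
    · exact .inl (h i hi)
    · exact .inr (smooth_derivs_one hd (by omega))

lemma spline_eq_zero {c : Fin (maxIndex d k + 1) → ℝ} (h : ∀ i, c i = 0) (x : ℝ) :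
    spline d k c x = 0 := Finset.sum_eq_zero fun i _ => by rw [h i, zero_mul]

/-! ### Flatness on the sides of the unit square -/

/-- Along a side, vanishing of the function and its first two transversal derivatives already gives
the full second-order jet. Tangential and mixed derivatives follow by differentiating along the
side. -/
lemma flat_of_hasJet_snd {f : ℝ × ℝ → ℝ} (hf : ContDiff ℝ 2 f) {e : ℝ}
    (h : ∀ s ∈ Icc (0 : ℝ) 1, HasJet (fun r => f (s, r)) e 0 0 0) :
    ∀ s ∈ Icc (0 : ℝ) 1, Flat f (s, e) := by
  have df : Differentiable ℝ f := hf.differentiable two_ne_zero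
  have h' : ContDiff ℝ (1 + 1) f := by simpa [one_add_one_eq_two] using hf
  have ddf : Differentiable ℝ (fderiv ℝ f) :=
    ((contDiff_succ_iff_fderiv.1 h').2.2).differentiable one_ne_zero
  have e0 : ∀ s r : ℝ, ((s, 0) : ℝ × ℝ) + r • ((0, 1) : ℝ × ℝ) = (s, r) := fun s r => by simp
  have e1 : ∀ s r : ℝ, HasDerivAt (fun r => f (s, r)) (fderiv ℝ f (s, r) (0, 1)) r := fun s r => by
    have := hasDerivAt_comp_line (x := (s, 0)) (V := ((0, 1) : ℝ × ℝ)) (t := r) (df _)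
    simpa only [e0] using this
  have e2 : ∀ s r : ℝ, HasDerivAt (fun r => fderiv ℝ f (s, r) (0, 1))
      (fderiv ℝ (fderiv ℝ f) (s, r) (0, 1) (0, 1)) r := fun s r => by
    have := hasDerivAt_fderiv_line (x := (s, 0)) (V := ((0, 1) : ℝ × ℝ)) (t := r) (ddf _)
      (hasDerivAt_const r ((0, 1) : ℝ × ℝ))
    simpa only [e0, map_zero, add_zero] using this
  have e3 : ∀ s : ℝ, ((0, e) : ℝ × ℝ) + s • ((1, 0) : ℝ × ℝ) = (s, e) := fun s => by simp
  have := flat_of_directional hf (u := ((1, 0) : ℝ × ℝ)) (v := ((0, 1) : ℝ × ℝ)) (p := (0, e))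
    (fun w => ⟨w.1, w.2, by simp⟩)
    (fun s hs => by rw [e3]; exact (h s hs).1)
    (fun s hs => by rw [e3, ← (e1 s e).deriv]; exact (h s hs).2.1)
    (fun s hs => by
      rw [e3, ← (e2 s e).deriv, ← (funext fun r => (e1 s r).deriv :
        deriv (fun r => f (s, r)) = fun r => fderiv ℝ f (s, r) (0, 1))]
      exact (h s hs).2.2)
  simpa only [e3] using this

lemma Flat.comp_swap {f : ℝ × ℝ → ℝ} (hf : ContDiff ℝ 2 f) {s t : ℝ}
    (h : Flat (fun ξ : ℝ × ℝ => f (ξ.2, ξ.1)) (t, s)) : Flat f (s, t) := by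
  have df : Differentiable ℝ f := hf.differentiable two_ne_zero
  set A : (ℝ × ℝ) ≃L[ℝ] (ℝ × ℝ) := ContinuousLinearEquiv.prodComm ℝ ℝ ℝ with hA
  have e1 : fderiv ℝ (fun ξ : ℝ × ℝ => f (ξ.2, ξ.1)) = fun ξ =>
      (fderiv ℝ f (A ξ)).comp (A : (ℝ × ℝ) →L[ℝ] (ℝ × ℝ)) := by
    funext ξ
    exact A.comp_right_fderiv (f := f)
  have hA' : A (t, s) = (s, t) := rfl
  obtain ⟨h0, h1, h2⟩ := h
  have h' : ContDiff ℝ (1 + 1) f := by simpa [one_add_one_eq_two] using hf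
  have ddf : Differentiable ℝ (fderiv ℝ f) :=
    ((contDiff_succ_iff_fderiv.1 h').2.2).differentiable one_ne_zero
  rw [e1] at h1 h2
  have hd : HasFDerivAt (fun ξ => (fderiv ℝ f (A ξ)).comp (A : (ℝ × ℝ) →L[ℝ] (ℝ × ℝ))) _ (t, s) :=
    ((ddf (A (t, s))).hasFDerivAt.comp (t, s) A.hasFDerivAt).clm_comp
      (hasFDerivAt_const (A : (ℝ × ℝ) →L[ℝ] (ℝ × ℝ)) (t, s))
  rw [hd.fderiv] at h2
  refine ⟨h0, ?_, ?_⟩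
  · ext
    · have := congrArg (fun L => L (A.symm (1, 0))) h1
      simpa [hA'] using this
    · have := congrArg (fun L => L (A.symm (0, 1))) h1
      simpa [hA'] using this
  · refine ContinuousLinearMap.ext fun u => ContinuousLinearMap.ext fun w => ?_
    have := congrArg (fun L => L (A.symm u) (A.symm w)) h2
    simpa [hA'] using this

lemma flat_of_hasJet_fst {f : ℝ × ℝ → ℝ} (hf : ContDiff ℝ 2 f) {e : ℝ}
    (h : ∀ t ∈ Icc (0 : ℝ) 1, HasJet (fun r => f (r, t)) e 0 0 0) :
    ∀ t ∈ Icc (0 : ℝ) 1, Flat f (e, t) := fun t ht =>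
  Flat.comp_swap hf (flat_of_hasJet_snd (f := fun ξ : ℝ × ℝ => f (ξ.2, ξ.1))
    (hf.comp (contDiff_snd.prodMk contDiff_fst)) h t ht)

end BSpline

/-! ### Reorientation of a patch -/

/-- The index or its reverse. -/
def flipIndex {n : ℕ} (e : Bool) (i : Fin (n + 1)) : Fin (n + 1) := if e then i.rev else i

/-- The parameter or its reverse. -/
def flipParam (e : Bool) (x : ℝ) : ℝ := if e then 1 - x else x

/-- The spline index counted from a corner, with the parameter directions swapped if `sw`. -/
def orientIndex {d k : ℕ} (c : Bool × Bool) (sw : Bool) (x : SplineIndex d k) : SplineIndex d k :=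
  if sw then (flipIndex c.1 x.2, flipIndex c.2 x.1) else (flipIndex c.1 x.1, flipIndex c.2 x.2)

/-- The parameter counted from a corner, with the parameter directions swapped if `sw`. -/
def orientParam (c : Bool × Bool) (sw : Bool) (ξ : ℝ × ℝ) : ℝ × ℝ :=
  if sw then (flipParam c.1 ξ.2, flipParam c.2 ξ.1) else (flipParam c.1 ξ.1, flipParam c.2 ξ.2)

/-- The quadrangle with its corners counted from the corner `c`. -/
def Quad.reorient (q : Quad) (c : Bool × Bool) (sw : Bool) : Quad := fun p =>
  q (if sw then (xor c.1 p.2, xor c.2 p.1) else (xor c.1 p.1, xor c.2 p.2))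

lemma flipIndex_flipIndex {n : ℕ} (e : Bool) (i : Fin (n + 1)) :
    flipIndex e (flipIndex e i) = i := by cases e <;> simp [flipIndex]

lemma flipParam_flipParam (e : Bool) (x : ℝ) : flipParam e (flipParam e x) = x := by
  cases e <;> simp [flipParam]

lemma flipParam_mem {e : Bool} {x : ℝ} (hx : x ∈ Icc (0 : ℝ) 1) : flipParam e x ∈ Icc (0 : ℝ) 1 := by
  cases e
  · exact hx
  · exact ⟨by simpa [flipParam] using hx.2, by simpa [flipParam] using hx.1⟩

lemma orientIndex_injective {d k : ℕ} (c : Bool × Bool) (sw : Bool) :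
    Function.Injective (orientIndex (d := d) (k := k) c sw) := by
  have hf : ∀ e : Bool, Function.Injective (flipIndex (n := maxIndex d k) e) := fun e =>
    Function.Involutive.injective (flipIndex_flipIndex e)
  rintro ⟨i, j⟩ ⟨i', j'⟩ h
  cases sw <;> simp only [orientIndex, if_true, Bool.false_eq_true, if_false, Prod.mk.injEq] at h
  · exact Prod.ext (hf _ h.1) (hf _ h.2)
  · exact Prod.ext (hf _ h.2) (hf _ h.1)

lemma orientIndex_bijective {d k : ℕ} (c : Bool × Bool) (sw : Bool) :
    Function.Bijective (orientIndex (d := d) (k := k) c sw) :=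
  Finite.injective_iff_bijective.1 (orientIndex_injective c sw)

lemma orientParam_orientParam (c : Bool × Bool) (sw : Bool) (ξ : ℝ × ℝ) :
    orientParam c sw (orientParam (if sw then c.swap else c) sw ξ) = ξ ∧
      orientParam (if sw then c.swap else c) sw (orientParam c sw ξ) = ξ := by
  cases sw <;> simp [orientParam, flipParam_flipParam]

lemma orientParam_mem (c : Bool × Bool) (sw : Bool) {ξ : ℝ × ℝ} (hξ : ξ ∈ unitSquare) :
    orientParam c sw ξ ∈ unitSquare := by
  cases sw
  · exact ⟨flipParam_mem hξ.1, flipParam_mem hξ.2⟩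
  · exact ⟨flipParam_mem hξ.2, flipParam_mem hξ.1⟩

lemma orientParam_image (c : Bool × Bool) (sw : Bool) : orientParam c sw '' unitSquare = unitSquare := by
  refine Subset.antisymm (image_subset_iff.2 fun ξ hξ => orientParam_mem c sw hξ) fun ξ hξ => ?_
  exact ⟨_, orientParam_mem _ sw hξ, (orientParam_orientParam c sw ξ).1⟩

lemma contDiff_orientParam (c : Bool × Bool) (sw : Bool) : ContDiff ℝ 2 (orientParam c sw) := by
  have hf : ∀ e : Bool, ContDiff ℝ 2 (flipParam e) := fun e => by
    cases e
    · exact contDiff_id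
    · exact contDiff_const.sub contDiff_id
  cases sw
  · exact ((hf _).comp contDiff_fst).prodMk ((hf _).comp contDiff_snd)
  · exact ((hf _).comp contDiff_snd).prodMk ((hf _).comp contDiff_fst)

namespace Quad

lemma contDiff_map (q : Quad) : ContDiff ℝ 2 q.map := by
  unfold Quad.map
  fun_prop

lemma map_orientParam (q : Quad) (c : Bool × Bool) (sw : Bool) (ξ : ℝ × ℝ) :
    q.map (orientParam c sw ξ) = (q.reorient c sw).map ξ := by
  obtain ⟨c1, c2⟩ := c
  cases c1 <;> cases c2 <;> cases sw <;>
    simp [Quad.map, orientParam, flipParam, Quad.reorient] <;> module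

lemma patch_reorient (q : Quad) (c : Bool × Bool) (sw : Bool) : (q.reorient c sw).patch = q.patch := by
  have h : (q.reorient c sw).map = q.map ∘ orientParam c sw :=
    funext fun ξ => (q.map_orientParam c sw ξ).symm
  rw [Quad.patch, Quad.patch, h, image_comp, orientParam_image]

lemma injOn_reorient {q : Quad} (hq : InjOn q.map unitSquare) (c : Bool × Bool) (sw : Bool) :
    InjOn (q.reorient c sw).map unitSquare := by
  intro ξ hξ ξ' hξ' h
  rw [← map_orientParam, ← map_orientParam] at h
  have := hq (orientParam_mem c sw hξ) (orientParam_mem c sw hξ') h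
  rw [← (orientParam_orientParam c sw ξ).2, this, (orientParam_orientParam c sw ξ').2]

lemma det_fderiv_reorient {q : Quad} (hq : ∀ ξ ∈ unitSquare, (fderiv ℝ q.map ξ).det ≠ 0)
    (c : Bool × Bool) (sw : Bool) : ∀ ξ ∈ unitSquare, (fderiv ℝ (q.reorient c sw).map ξ).det ≠ 0 := by
  intro ξ hξ
  have h : q.map = (q.reorient c sw).map ∘ orientParam (if sw then c.swap else c) sw := by
    funext ξ
    rw [Function.comp_apply, ← map_orientParam, (orientParam_orientParam c sw ξ).1]
  have h1 := hq _ (orientParam_mem c sw hξ)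
  rw [h, fderiv_comp _ ((contDiff_map _).differentiable two_ne_zero _)
    ((contDiff_orientParam _ _).differentiable two_ne_zero _),
    (orientParam_orientParam c sw ξ).2] at h1
  intro h2
  apply h1
  rw [ContinuousLinearMap.det, ContinuousLinearMap.toLinearMap_comp, LinearMap.det_comp]
  rw [ContinuousLinearMap.det] at h2
  rw [h2, zero_mul]

end Quad

/-- The knot vector is symmetric, so reversing a parameter reverses the B-splines. Moving a corner
to the origin and exchanging the parameters thus merely permutes coefficients, and every patch may
be treated in one standard position. -/
lemma splineFun_orientParam {d k : ℕ} (hd : 3 ≤ d) (b : SplineIndex d k → ℝ) (c : Bool × Bool)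
    (sw : Bool) {ξ : ℝ × ℝ} (hξ : ξ ∈ unitSquare) : splineFun d k b (orientParam c sw ξ) =
      BSpline.tensor d k (fun i i' => b (orientIndex c sw (i, i'))) ξ := by
  have hf : ∀ (e : Bool) (i : Fin (maxIndex d k + 1)) (x : ℝ), x ∈ Icc (0 : ℝ) 1 →
      bspline (knot d k) d (flipIndex e i : Fin (maxIndex d k + 1)) (flipParam e x) =
        BSpline.smooth d k i x := fun e i x hx => by
    rw [← BSpline.smooth_eq _ (flipParam_mem hx)]
    cases e
    · rfl
    · exact BSpline.smooth_rev hd i hx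
  rw [splineFun, ← (orientIndex_bijective c sw).sum_comp, Fintype.sum_prod_type,
    BSpline.tensor_eq_sum]
  refine Finset.sum_congr rfl fun i _ => Finset.sum_congr rfl fun i' _ => ?_
  congr 1
  cases sw
  · exact congrArg₂ (· * ·) (hf c.1 i ξ.1 hξ.1) (hf c.2 i' ξ.2 hξ.2)
  · exact (congrArg₂ (· * ·) (hf c.1 i' ξ.2 hξ.2) (hf c.2 i ξ.1 hξ.1)).trans (mul_comm _ _)

/-! ### Sides of a reoriented patch -/

/-- The side of the original patch which is the side `s` of the reoriented patch. -/
def orientSide (c : Bool × Bool) (sw : Bool) (s : Bool × Bool) : Bool × Bool :=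
  (xor sw s.1, xor (if xor sw s.1 then c.2 else c.1) s.2)

lemma orientSide_surjective (c : Bool × Bool) (sw : Bool) : Function.Surjective (orientSide c sw) := by
  revert c sw
  unfold Function.Surjective
  decide

lemma nearEnd_flipIndex {n : ℕ} (c e : Bool) (i : Fin (n + 1)) :
    nearEnd (xor c e) (flipIndex c i) ↔ nearEnd e i := by
  have := i.2
  cases c <;> cases e <;> simp [nearEnd, flipIndex, Fin.val_rev] <;> omega

lemma awayFromEnds_flipIndex {n : ℕ} (c : Bool) (i : Fin (n + 1)) :
    awayFromEnds (flipIndex c i) ↔ awayFromEnds i := by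
  have := i.2
  cases c <;> simp [awayFromEnds, flipIndex, Fin.val_rev]
  omega

lemma orientIndex_mem_sideStrip {d k : ℕ} (c : Bool × Bool) (sw : Bool) (s : Bool × Bool)
    (x : SplineIndex d k) :
    orientIndex c sw x ∈ sideStrip d k (orientSide c sw s) ↔ x ∈ sideStrip d k s := by
  obtain ⟨a, e⟩ := s
  cases a <;> cases sw <;>
    simp [orientIndex, orientSide, sideStrip, nearEnd_flipIndex, awayFromEnds_flipIndex]

namespace Quad

lemma side_reorient (q : Quad) (c : Bool × Bool) (sw : Bool) (s : Bool × Bool) :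
    (q.reorient c sw).side s = q.side (orientSide c sw s) := by
  obtain ⟨c1, c2⟩ := c
  obtain ⟨a, e⟩ := s
  cases c1 <;> cases c2 <;> cases sw <;> cases a <;> cases e <;>
    simp only [Quad.side, Quad.reorient, orientSide, Bool.xor_false, Bool.xor_true,
      Bool.not_false, if_true, if_false, Bool.false_eq_true,
      Bool.xor_self] <;>
    first
      | rfl
      | exact segment_symm _ _ _

/-- The parameter of a corner. -/
def bit (e : Bool) : ℝ := if e then 1 else 0

lemma bit_mem (e : Bool) : bit e ∈ Icc (0 : ℝ) 1 := by cases e <;> simp [bit]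

lemma bit_injective : Function.Injective bit := by
  intro a b h
  cases a <;> cases b <;> simp_all [bit]

lemma map_bit (q : Quad) (c : Bool × Bool) : q.map (bit c.1, bit c.2) = q c := by
  obtain ⟨c1, c2⟩ := c
  cases c1 <;> cases c2 <;> simp [Quad.map, bit]

lemma mem_side_false {q : Quad} {e : Bool} {x : ℝ × ℝ} (hx : x ∈ q.side (false, e)) :
    ∃ t ∈ Icc (0 : ℝ) 1, q.map (bit e, t) = x := by
  rw [Quad.side, segment_eq_image] at hx
  obtain ⟨t, ht, rfl⟩ := hx
  refine ⟨t, ht, ?_⟩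
  cases e <;> simp [Quad.map, bit]

lemma mem_side_true {q : Quad} {e : Bool} {x : ℝ × ℝ} (hx : x ∈ q.side (true, e)) :
    ∃ t ∈ Icc (0 : ℝ) 1, q.map (t, bit e) = x := by
  rw [Quad.side, segment_eq_image] at hx
  obtain ⟨t, ht, rfl⟩ := hx
  refine ⟨t, ht, ?_⟩
  cases e <;> simp [Quad.map, bit]

lemma side_subset_patch (q : Quad) (s : Bool × Bool) : q.side s ⊆ q.patch := by
  obtain ⟨a, e⟩ := s
  intro x hx
  cases a
  · obtain ⟨t, ht, rfl⟩ := mem_side_false hx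
    exact ⟨_, ⟨bit_mem e, ht⟩, rfl⟩
  · obtain ⟨t, ht, rfl⟩ := mem_side_true hx
    exact ⟨_, ⟨ht, bit_mem e⟩, rfl⟩

lemma corner_mem_patch (q : Quad) (c : Bool × Bool) : q c ∈ q.patch :=
  ⟨_, ⟨bit_mem c.1, bit_mem c.2⟩, q.map_bit c⟩

lemma injective_of_injOn {q : Quad} (hq : InjOn q.map unitSquare) : Function.Injective q := by
  intro c c' h
  rw [← map_bit q c, ← map_bit q c'] at h
  have := hq ⟨bit_mem _, bit_mem _⟩ ⟨bit_mem _, bit_mem _⟩ h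
  rw [Prod.mk.injEq] at this
  exact Prod.ext (bit_injective this.1) (bit_injective this.2)

end Quad

lemma isCompact_unitSquare : IsCompact unitSquare := isCompact_Icc.prod isCompact_Icc

lemma uniqueDiffOn_unitSquare : UniqueDiffOn ℝ unitSquare :=
  (uniqueDiffOn_Icc zero_lt_one).prod (uniqueDiffOn_Icc zero_lt_one)

/-! ### Plane vectors -/

lemma eq_smul_add_smul {x y : ℝ × ℝ} (h : cross x y ≠ 0) (z : ℝ × ℝ) :
    z = (cross z y / cross x y) • x + (cross x z / cross x y) • y := by
  ext
  · simp only [Prod.fst_add, Prod.smul_fst, smul_eq_mul]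
    field_simp
    unfold cross
    ring
  · simp only [Prod.snd_add, Prod.smul_snd, smul_eq_mul]
    field_simp
    unfold cross
    ring

lemma cross_smul_left (a : ℝ) (x y : ℝ × ℝ) : cross (a • x) y = a * cross x y := by
  simp [cross]; ring

lemma cross_smul_right (a : ℝ) (x y : ℝ × ℝ) : cross x (a • y) = a * cross x y := by
  simp [cross]; ring

lemma cross_add_left (x y z : ℝ × ℝ) : cross (x + y) z = cross x z + cross y z := by
  simp [cross]; ring

lemma cross_add_right (x y z : ℝ × ℝ) : cross x (y + z) = cross x y + cross x z := by
  simp [cross]; ring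

lemma cross_self_eq_zero (x : ℝ × ℝ) : cross x x = 0 := by simp [cross]; ring

lemma cross_comm (x y : ℝ × ℝ) : cross x y = - cross y x := by simp [cross]; ring

lemma cross_eq_zero_of_collinear {x y z : ℝ × ℝ} (h : Collinear ℝ {x + z, z, y + z}) :
    cross x y = 0 := by
  obtain ⟨w, hw⟩ := (collinear_iff_of_mem (p₀ := z) (by simp)).1 h
  obtain ⟨a, ha⟩ := hw (x + z) (by simp)
  obtain ⟨b, hb⟩ := hw (y + z) (by simp)
  have ha : x = a • w := by simpa using ha
  have hb : y = b • w := by simpa using hb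
  rw [ha, hb, cross_smul_left, cross_smul_right, cross_self_eq_zero]
  ring

/-! ### The patches around an inner vertex of valency four -/

namespace InnerVertexFour

variable {D : MultiPatchDomain} (L : InnerVertexFour D)

/-- The patch `Ω^{(j)}` with the parameter `(0, 0)` at `v0` and its first leg in the first
parameter direction. -/
def star (j : Fin 4) : Quad := (D.quad (L.patch j)).reorient (L.corner j) (L.swap j)

/-- The edge from `v0` to `v^{(j)}`. -/
def leg (j : Fin 4) : Set (ℝ × ℝ) := segment ℝ L.v0 (L.v0 + L.v j)

lemma star_zero (j : Fin 4) : L.star j (false, false) = L.v0 := by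
  rw [← L.corner_eq j, star, Quad.reorient]
  simp

lemma star_first (j : Fin 4) : L.star j (true, false) = L.v0 + L.v j := by
  rw [star, Quad.reorient, v]
  simp

lemma star_second (j : Fin 4) : L.star j (false, true) = L.v0 + L.v (j + 1) := by
  rw [star, Quad.reorient, v, add_sub_cancel, ← L.legs j]
  simp

lemma star_last (j : Fin 4) : L.star j (true, true) = L.v0 + L.vt j := by
  rw [star, Quad.reorient, vt]
  simp

lemma star_map (j : Fin 4) (s t : ℝ) : (L.star j).map (s, t) =
    L.v0 + s • L.v j + t • L.v (j + 1) + (s * t) • (L.vt j - L.v j - L.v (j + 1)) := by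
  rw [Quad.map, star_zero, star_first, star_second, star_last]
  module

lemma star_patch (j : Fin 4) : (L.star j).patch = (D.quad (L.patch j)).patch :=
  Quad.patch_reorient _ _ _

lemma star_injOn (j : Fin 4) : InjOn (L.star j).map unitSquare :=
  Quad.injOn_reorient (D.injOn _) _ _

lemma star_regular (j : Fin 4) : ∀ ξ ∈ unitSquare, (fderiv ℝ (L.star j).map ξ).det ≠ 0 :=
  Quad.det_fderiv_reorient (D.regular _) _ _

lemma star_side_first (j : Fin 4) : (L.star j).side (true, false) = L.leg j := by
  rw [Quad.side, star_zero, star_first, leg]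

lemma star_side_second (j : Fin 4) : (L.star j).side (false, false) = L.leg (j + 1) := by
  rw [Quad.side, star_zero, star_second, leg]

lemma v0_mem_leg (j : Fin 4) : L.v0 ∈ L.leg j := left_mem_segment _ _ _

lemma v0_mem_patch (j : Fin 4) : L.v0 ∈ (D.quad (L.patch j)).patch := by
  rw [← L.corner_eq j]
  exact Quad.corner_mem_patch _ _

/-- A point on an outer side is different from `v0`. -/
lemma v0_notMem_side {j : Fin 4} {a : Bool} : L.v0 ∉ (L.star j).side (a, true) := by
  intro h
  have h0 : (L.star j).map (0, 0) = L.v0 := by rw [star_map]; simp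
  have m0 : ((0, 0) : ℝ × ℝ) ∈ unitSquare := ⟨⟨le_rfl, zero_le_one⟩, ⟨le_rfl, zero_le_one⟩⟩
  cases a
  · obtain ⟨t, ht, h1⟩ := Quad.mem_side_false h
    have := L.star_injOn j ⟨Quad.bit_mem true, ht⟩ m0 (h1.trans h0.symm)
    simp [Quad.bit] at this
  · obtain ⟨t, ht, h1⟩ := Quad.mem_side_true h
    have := L.star_injOn j ⟨ht, Quad.bit_mem true⟩ m0 (h1.trans h0.symm)
    simp [Quad.bit] at this

/-- The sides of the patches around `v0` which contain `v0` are the legs. -/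
lemma side_eq_leg {j : Fin 4} {s : Bool × Bool} (h : L.v0 ∈ (L.star j).side s) :
    (s = (true, false) ∧ (L.star j).side s = L.leg j) ∨
      (s = (false, false) ∧ (L.star j).side s = L.leg (j + 1)) := by
  obtain ⟨a, e⟩ := s
  cases e
  · cases a
    · exact .inr ⟨rfl, L.star_side_second j⟩
    · exact .inl ⟨rfl, L.star_side_first j⟩
  · exact (L.v0_notMem_side h).elim

lemma exists_side (j : Fin 4) (s : Bool × Bool) : ∃ s', s = orientSide (L.corner j) (L.swap j) s' ∧
    (D.quad (L.patch j)).side s = (L.star j).side s' := by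
  obtain ⟨s', rfl⟩ := orientSide_surjective (L.corner j) (L.swap j) s
  exact ⟨s', rfl, (Quad.side_reorient _ _ _ _).symm⟩

lemma cross_pos (j : Fin 4) : 0 < cross (L.v j) (L.v (j + 1)) := by
  have h := L.ccw j
  rwa [L.legs j] at h

lemma v_ne_zero (j : Fin 4) : L.v j ≠ 0 := by
  intro h
  have := L.cross_pos j
  rw [h] at this
  simp [cross] at this

/-- The ratio of opposite legs. -/
def nu (j : Fin 4) : ℝ := cross (L.v (j + 1)) (L.v (j + 2)) / cross (L.v j) (L.v (j + 1))

lemma nu_pos (j : Fin 4) : 0 < L.nu j := by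
  have := L.cross_pos (j + 1)
  rw [add_assoc] at this
  exact div_pos this (L.cross_pos j)

lemma collinear_of_type (h : L.type = 4) (j : Fin 4) :
    Collinear ℝ {L.v (j - 1) + L.v0, L.v0, L.v (j + 1) + L.v0} := by
  have huniv : {j : Fin 4 | Collinear ℝ {L.v (j - 1) + L.v0, L.v0, L.v (j + 1) + L.v0}} = univ := by
    apply Set.eq_of_subset_of_ncard_le (subset_univ _)
    rw [Set.ncard_univ, Nat.card_fin]
    exact h.ge
  have : j ∈ (univ : Set (Fin 4)) := mem_univ j
  rwa [← huniv] at this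

variable {L}

/-- Collinearity removes the `v^{(j+1)}` component in the basis `v^{(j)}, v^{(j+1)}`. The remaining
factor is a ratio of positively oriented determinants with a minus sign. -/
lemma v_opposite (h : L.type = 4) (j : Fin 4) : L.v (j + 2) = -(L.nu j) • L.v j := by
  have h1 := cross_eq_zero_of_collinear (L.collinear_of_type h (j + 1))
  have e1 : j + 1 - 1 = j := add_sub_cancel_right j 1
  have e2 : j + 1 + 1 = j + 2 := by rw [add_assoc]; rfl
  rw [e1, e2] at h1
  have := eq_smul_add_smul (L.cross_pos j).ne' (L.v (j + 2))
  rw [h1, zero_div, zero_smul, add_zero, cross_comm, neg_div] at this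
  exact this

lemma nu_mul_nu (h : L.type = 4) (j : Fin 4) : L.nu j * L.nu (j + 2) = 1 := by
  have h1 := v_opposite h (j + 2)
  rw [v_opposite h j, show j + 2 + 2 = j by rw [add_assoc]; exact add_zero j, smul_smul] at h1
  have h2 : (L.nu (j + 2) * L.nu j - 1) • L.v j = 0 := by
    rw [sub_smul, one_smul, sub_eq_zero, eq_comm]
    convert h1 using 2
    ring
  rcases smul_eq_zero.1 h2 with h3 | h3
  · linarith
  · exact (L.v_ne_zero j h3).elim

/-- Adjacent legs span a positive area and opposite ones point in opposite directions. Legs being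
equal as sets thus forces equal labels, which is needed because index spaces are attached to edges
as point sets. -/
lemma leg_injective (h : L.type = 4) : Function.Injective L.leg := by
  intro a b hab
  have hm : L.v0 + L.v a ∈ L.leg b := by
    rw [← hab]; exact right_mem_segment _ _ _
  rw [leg, segment_eq_image'] at hm
  obtain ⟨t, ht, hx⟩ := hm
  have hv : L.v a = t • L.v b := by simpa using hx.symm
  rcases (by decide : ∀ a b : Fin 4, b = a ∨ b = a + 1 ∨ a = b + 1 ∨ b = a + 2) a b with
    rfl | rfl | rfl | rfl
  · rfl
  · have := L.cross_pos a
    rw [hv, cross_smul_left, cross_self_eq_zero, mul_zero] at this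
    exact (lt_irrefl _ this).elim
  · have := L.cross_pos b
    rw [hv, cross_smul_right, cross_self_eq_zero, mul_zero] at this
    exact (lt_irrefl _ this).elim
  · rw [v_opposite h a, smul_smul] at hv
    have h2 : (1 + t * L.nu a) • L.v a = 0 := by
      rw [add_smul, one_smul]
      nth_rw 1 [hv]
      module
    have := mul_nonneg ht.1 (L.nu_pos a).le
    rcases smul_eq_zero.1 h2 with h3 | h3
    · linarith
    · exact (L.v_ne_zero a h3).elim

/-- The coefficient `η` of the bilinear part `s t (η v^{(j)} + μ v^{(j+1)})` of the patch. -/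
def eta (L : InnerVertexFour D) (j : Fin 4) : ℝ :=
  cross (L.vt j - L.v j - L.v (j + 1)) (L.v (j + 1)) / cross (L.v j) (L.v (j + 1))

/-- The coefficient `μ` of the bilinear part `s t (η v^{(j)} + μ v^{(j+1)})` of the patch. -/
def mu (L : InnerVertexFour D) (j : Fin 4) : ℝ :=
  cross (L.v j) (L.vt j - L.v j - L.v (j + 1)) / cross (L.v j) (L.v (j + 1))

lemma vt_sub (L : InnerVertexFour D) (j : Fin 4) :
    L.vt j - L.v j - L.v (j + 1) = L.eta j • L.v j + L.mu j • L.v (j + 1) :=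
  eq_smul_add_smul (L.cross_pos j).ne' _

/-! ### Index spaces -/

variable {d k : ℕ}

/-- The spline coefficients of `Ω^{(j)}` counted from `v0`. -/
def loc (L : InnerVertexFour D) (b : D.Index d k → ℝ) (j : Fin 4)
    (i i' : Fin (maxIndex d k + 1)) : ℝ :=
  b (L.patch j, orientIndex (L.corner j) (L.swap j) (i, i'))

lemma loc_ofNat (L : InnerVertexFour D) (b : D.Index d k → ℝ) (j : Fin 4) (i i' : ℕ) :
    L.loc b j (Fin.ofNat _ i) (Fin.ofNat _ i') = b (L.localIndex d k j i i') := by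
  rw [loc, localIndex, orientIndex]
  cases L.swap j <;> simp [stepIndex, flipIndex]

lemma loc_sub (L : InnerVertexFour D) (b b' : D.Index d k → ℝ) (j : Fin 4)
    (i i' : Fin (maxIndex d k + 1)) : L.loc (b - b') j i i' = L.loc b j i i' - L.loc b' j i i' := rfl

lemma represents_star (hd : 3 ≤ d) {w : ℝ × ℝ → ℝ} {b : D.Index d k → ℝ}
    (h : D.Represents d k w b) (j : Fin 4) {ξ : ℝ × ℝ} (hξ : ξ ∈ unitSquare) :
    w ((L.star j).map ξ) = BSpline.tensor d k (L.loc b j) ξ := by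
  rw [star, ← Quad.map_orientParam, h _ _ (orientParam_mem _ _ hξ), splineFun_orientParam hd _ _ _ hξ]
  rfl

lemma exists_loc_index (L : InnerVertexFour D) (j : Fin 4) (x : SplineIndex d k) :
    ∃ i i', x = orientIndex (L.corner j) (L.swap j) (i, i') := by
  obtain ⟨⟨i, i'⟩, rfl⟩ := (orientIndex_bijective (L.corner j) (L.swap j)).2 x
  exact ⟨i, i', rfl⟩

/-- A side that equals a leg contains `v0`, so it is one of the two sides of the standard patch at
the origin. Injectivity of the legs identifies which label it carries. -/
lemma mem_edgeIndices_leg (h : L.type = 4) (a j : Fin 4) (i i' : Fin (maxIndex d k + 1)) :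
    (L.patch j, orientIndex (L.corner j) (L.swap j) (i, i')) ∈ D.edgeIndices d k (L.leg a) ↔
      (j = a ∧ (i' : ℕ) ≤ 2 ∧ awayFromEnds i) ∨ (j + 1 = a ∧ (i : ℕ) ≤ 2 ∧ awayFromEnds i') := by
  constructor
  · rintro ⟨s, hs, hx⟩
    dsimp only at hs hx
    obtain ⟨s', rfl, hs'⟩ := L.exists_side j s
    rw [hs'] at hs
    rw [orientIndex_mem_sideStrip] at hx
    have h0 : L.v0 ∈ (L.star j).side s' := by rw [hs]; exact L.v0_mem_leg a
    rcases L.side_eq_leg h0 with ⟨rfl, h1⟩ | ⟨rfl, h1⟩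
    · exact .inl ⟨leg_injective h (h1.symm.trans hs), hx⟩
    · exact .inr ⟨leg_injective h (h1.symm.trans hs), hx⟩
  · rintro (⟨rfl, hx⟩ | ⟨rfl, hx⟩)
    · refine ⟨orientSide (L.corner j) (L.swap j) (true, false), ?_, ?_⟩
      · exact (Quad.side_reorient _ _ _ _).symm.trans (L.star_side_first j)
      · exact (orientIndex_mem_sideStrip _ _ (true, false) _).2 hx
    · refine ⟨orientSide (L.corner j) (L.swap j) (false, false), ?_, ?_⟩
      · exact (Quad.side_reorient _ _ _ _).symm.trans (L.star_side_second j)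
      · exact (orientIndex_mem_sideStrip _ _ (false, false) _).2 hx

lemma exists_patch_of_mem_edgeIndices {a : Fin 4} {x : D.Index d k}
    (hx : x ∈ D.edgeIndices d k (L.leg a)) : ∃ j, L.patch j = x.1 := by
  obtain ⟨s, hs, -⟩ := hx
  exact L.exhaustive _ (Quad.side_subset_patch _ s (by rw [hs]; exact L.v0_mem_leg a))

lemma mem_vertexIndices (j : Fin 4) (i i' : Fin (maxIndex d k + 1)) :
    (L.patch j, orientIndex (L.corner j) (L.swap j) (i, i')) ∈ D.vertexIndices d k L.v0 ↔
      (i : ℕ) ≤ 2 ∧ (i' : ℕ) ≤ 2 := by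
  have key : nearEnd (L.corner j).1 (orientIndex (L.corner j) (L.swap j) (i, i')).1 ∧
      nearEnd (L.corner j).2 (orientIndex (L.corner j) (L.swap j) (i, i')).2 ↔
      (i : ℕ) ≤ 2 ∧ (i' : ℕ) ≤ 2 := by
    have h1 := fun (e : Bool) (i : Fin (maxIndex d k + 1)) => nearEnd_flipIndex e false i
    simp only [Bool.xor_false] at h1
    have h2 : ∀ i : Fin (maxIndex d k + 1), nearEnd false i ↔ (i : ℕ) ≤ 2 := fun i => Iff.rfl
    rw [orientIndex]
    cases L.swap j
    · simp [h1, h2]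
    · simp [h1, h2, and_comm]
  rw [← key]
  constructor
  · rintro ⟨c, hc, h1⟩
    have : c = L.corner j :=
      Quad.injective_of_injOn (D.injOn (L.patch j)) (hc.trans (L.corner_eq j).symm)
    rwa [this] at h1
  · intro h1
    exact ⟨L.corner j, L.corner_eq j, h1⟩

lemma exists_patch_of_mem_vertexIndices {x : D.Index d k} (hx : x ∈ D.vertexIndices d k L.v0) :
    ∃ j, L.patch j = x.1 := by
  obtain ⟨c, hc, -⟩ := hx
  exact L.exhaustive _ (by rw [← hc]; exact Quad.corner_mem_patch _ _)

lemma innerEdges_v0 : {Γ | Γ ∈ D.innerEdges ∧ L.v0 ∈ Γ} = range L.leg := by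
  ext Γ
  constructor
  · rintro ⟨⟨ℓ, ℓ', s, s', -, hs, -⟩, h0⟩
    rw [← hs] at h0
    obtain ⟨j, rfl⟩ := L.exhaustive ℓ (Quad.side_subset_patch _ s h0)
    obtain ⟨s'', -, hs''⟩ := L.exists_side j s
    rw [hs''] at h0 hs
    rcases L.side_eq_leg h0 with ⟨-, h1⟩ | ⟨-, h1⟩
    · exact ⟨j, h1.symm.trans hs⟩
    · exact ⟨j + 1, h1.symm.trans hs⟩
  · rintro ⟨a, rfl⟩
    refine ⟨?_, L.v0_mem_leg a⟩
    obtain ⟨j, rfl⟩ : ∃ j, a = j + 1 := ⟨a - 1, (sub_add_cancel a 1).symm⟩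
    refine ⟨L.patch j, L.patch (j + 1), orientSide (L.corner j) (L.swap j) (false, false),
      orientSide (L.corner (j + 1)) (L.swap (j + 1)) (true, false), ?_, ?_, ?_⟩
    · intro hc
      exact (by decide : ∀ j : Fin 4, j ≠ j + 1) j (L.patch_injective hc)
    · exact (Quad.side_reorient _ _ _ _).symm.trans (L.star_side_second j)
    · exact (Quad.side_reorient _ _ _ _).symm.trans (L.star_side_first (j + 1))

/-! ### Intersections of patches -/

/-- Such a patch does not contain `v0`, so it meets `Ω^{(j)}` in a vertex other than `v0` or in a
side avoiding `v0`. In the standard position these lie where one parameter equals 1. -/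
lemma mem_outer_side_of_notMem_range {j : Fin 4} {ℓ : Fin D.P} (hℓ : ∀ j', L.patch j' ≠ ℓ)
    {x : ℝ × ℝ} (hx : x ∈ (D.quad (L.patch j)).patch) (hx' : x ∈ (D.quad ℓ).patch) :
    ∃ ξ ∈ unitSquare, (L.star j).map ξ = x ∧ (ξ.1 = 1 ∨ ξ.2 = 1) := by
  have h0 : L.v0 ∉ (D.quad ℓ).patch := fun h => by
    obtain ⟨j', hj'⟩ := L.exhaustive ℓ h
    exact hℓ j' hj'
  rcases D.inter (L.patch j) ℓ (hℓ j) with h | ⟨c, c', hc, h⟩ | ⟨s, s', hs, h⟩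
  · have : x ∈ (∅ : Set (ℝ × ℝ)) := h ▸ ⟨hx, hx'⟩
    exact this.elim
  · have hxc : x ∈ ({D.quad (L.patch j) c} : Set (ℝ × ℝ)) := h ▸ ⟨hx, hx'⟩
    rw [mem_singleton_iff] at hxc
    rw [← L.star_patch j] at hx
    obtain ⟨ξ, hξ, rfl⟩ := hx
    have hc' : (D.quad (L.patch j)).map (orientParam (L.corner j) (L.swap j) ξ) =
        (D.quad (L.patch j)).map (Quad.bit c.1, Quad.bit c.2) := by
      rw [Quad.map_orientParam, Quad.map_bit]; exact hxc
    have he := D.injOn _ (orientParam_mem _ _ hξ) ⟨Quad.bit_mem _, Quad.bit_mem _⟩ hc'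
    refine ⟨ξ, hξ, rfl, ?_⟩
    by_contra hcon
    push Not at hcon
    have hb : ∀ (e e' : Bool) (y : ℝ), flipParam e y = Quad.bit e' → y ≠ 1 → y = 0 := by
      intro e e' y h1 h2
      cases e <;> cases e' <;> simp [flipParam, Quad.bit] at h1 <;> first | exact h1 | skip
      · exact (h2 h1).elim
      · exact (h2 (by linarith)).elim
    have hz : ξ = (0, 0) := by
      rw [orientParam] at he
      cases hsw : L.swap j <;> simp only [hsw, if_true, Bool.false_eq_true, if_false,
        Prod.mk.injEq] at he
      · exact Prod.ext (hb _ _ _ he.1 hcon.1) (hb _ _ _ he.2 hcon.2)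
      · exact Prod.ext (hb _ _ _ he.2 hcon.1) (hb _ _ _ he.1 hcon.2)
    rw [hz, star_map] at hx'
    apply h0
    simpa using hx'
  · have hxs : x ∈ (D.quad (L.patch j)).side s := h ▸ ⟨hx, hx'⟩
    have h0s : L.v0 ∉ (D.quad (L.patch j)).side s := fun h' => h0 (by
      rw [← h] at h'; exact h'.2)
    obtain ⟨⟨a, e⟩, -, hs'⟩ := L.exists_side j s
    rw [hs'] at hxs h0s
    cases e
    · exfalso
      cases a
      · rw [star_side_second] at h0s; exact h0s (L.v0_mem_leg _)
      · rw [star_side_first] at h0s; exact h0s (L.v0_mem_leg _)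
    · cases a
      · obtain ⟨t, ht, hx⟩ := Quad.mem_side_false hxs
        exact ⟨_, ⟨Quad.bit_mem true, ht⟩, hx, .inl rfl⟩
      · obtain ⟨t, ht, hx⟩ := Quad.mem_side_true hxs
        exact ⟨_, ⟨ht, Quad.bit_mem true⟩, hx, .inr rfl⟩

/-- Both patches contain `v0`. Their intersection is therefore `{v0}` or a common side through `v0`,
which is a leg of each. -/
lemma mem_leg_of_mem_patches (h4 : L.type = 4) {j j' : Fin 4} (hj : j ≠ j') {x : ℝ × ℝ}
    (hx : x ∈ (D.quad (L.patch j)).patch) (hx' : x ∈ (D.quad (L.patch j')).patch) :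
    x = L.v0 ∨ (j' = j + 1 ∧ x ∈ L.leg j') ∨ (j = j' + 1 ∧ x ∈ L.leg j) := by
  have hv : L.v0 ∈ (D.quad (L.patch j)).patch ∩ (D.quad (L.patch j')).patch :=
    ⟨L.v0_mem_patch j, L.v0_mem_patch j'⟩
  rcases D.inter (L.patch j) (L.patch j') (fun h => hj (L.patch_injective h)) with
    h | ⟨c, c', hc, h⟩ | ⟨s, s', hs, h⟩
  · rw [h] at hv
    exact hv.elim
  · have hxc : x ∈ ({D.quad (L.patch j) c} : Set (ℝ × ℝ)) := h ▸ ⟨hx, hx'⟩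
    rw [h] at hv
    exact .inl (hxc.trans hv.symm)
  · have hxs : x ∈ (D.quad (L.patch j)).side s := h ▸ ⟨hx, hx'⟩
    rw [h] at hv
    have hv' := hv
    rw [hs] at hv'
    obtain ⟨s1, -, h1⟩ := L.exists_side j s
    obtain ⟨s2, -, h2⟩ := L.exists_side j' s'
    rw [h1] at hv hxs
    rw [h2] at hv'
    have e12 : (L.star j).side s1 = (L.star j').side s2 := by rw [← h1, ← h2, hs]
    rcases L.side_eq_leg hv with ⟨-, g1⟩ | ⟨-, g1⟩ <;> rcases L.side_eq_leg hv' with ⟨-, g2⟩ | ⟨-, g2⟩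
    · exact (hj (leg_injective h4 (g1.symm.trans (e12.trans g2)))).elim
    · exact .inr (.inr ⟨leg_injective h4 (g1.symm.trans (e12.trans g2)), by rwa [← g1]⟩)
    · refine .inr (.inl ⟨(leg_injective h4 (g1.symm.trans (e12.trans g2))).symm, ?_⟩)
      rwa [← g2, ← e12]
    · exact (hj (add_right_cancel (leg_injective h4 (g1.symm.trans (e12.trans g2))))).elim

end InnerVertexFour

/-! ### Gluing of isogeometric functions around an inner vertex of valency four -/

namespace MultiPatchDomain

variable (D : MultiPatchDomain) {d k : ℕ}

lemma patch_subset_Omega (ℓ : Fin D.P) : (D.quad ℓ).patch ⊆ D.Omega :=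
  subset_iUnion (fun ℓ => (D.quad ℓ).patch) ℓ

lemma uniqueDiffOn_patch (ℓ : Fin D.P) : UniqueDiffOn ℝ (D.quad ℓ).patch :=
  uniqueDiffOn_image_of_det_ne_zero (Quad.contDiff_map _) uniqueDiffOn_unitSquare (D.regular ℓ)

lemma uniqueDiffOn_Omega : UniqueDiffOn ℝ D.Omega := fun x hx => by
  obtain ⟨ℓ, hℓ⟩ := mem_iUnion.1 hx
  exact (D.uniqueDiffOn_patch ℓ x hℓ).mono (D.patch_subset_Omega ℓ)

lemma isClosed_patch (ℓ : Fin D.P) : IsClosed (D.quad ℓ).patch :=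
  (isCompact_unitSquare.image (Quad.contDiff_map _).continuous).isClosed

/-- The isogeometric function on a patch. -/
def patchFun (b : D.Index d k → ℝ) (ℓ : Fin D.P) (x : ℝ × ℝ) : ℝ :=
  splineFun d k (fun i => b (ℓ, i)) (Function.invFunOn (D.quad ℓ).map unitSquare x)

lemma patchFun_map (b : D.Index d k → ℝ) (ℓ : Fin D.P) {ξ : ℝ × ℝ} (hξ : ξ ∈ unitSquare) :
    D.patchFun b ℓ ((D.quad ℓ).map ξ) = splineFun d k (fun i => b (ℓ, i)) ξ := by
  rw [patchFun, (D.injOn ℓ).leftInvOn_invFunOn hξ]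

lemma contDiffOn_patchFun (hd : 3 ≤ d) (b : D.Index d k → ℝ) (ℓ : Fin D.P) :
    ContDiffOn ℝ 2 (D.patchFun b ℓ) (D.quad ℓ).patch := by
  refine contDiffOn_of_comp (Quad.contDiff_map _) isCompact_unitSquare (D.injOn ℓ) (D.regular ℓ)
    (BSpline.contDiff_tensor (d := d) (k := k)
      (c := fun i i' => b (ℓ, orientIndex (false, false) false (i, i')))) fun ξ hξ => ?_
  rw [patchFun_map _ _ _ hξ]
  exact splineFun_orientParam hd (fun i => b (ℓ, i)) (false, false) false hξ

/-- Isogeometric functions on the patches whose derivatives agree on the intersections. -/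
lemma exists_represents_of_jet2 (hd : 3 ≤ d) (b : D.Index d k → ℝ)
    (h : ∀ ℓ ℓ' x, x ∈ (D.quad ℓ).patch → x ∈ (D.quad ℓ').patch →
      jet2 (D.patchFun b ℓ) (D.quad ℓ).patch x = jet2 (D.patchFun b ℓ') (D.quad ℓ').patch x) :
    ∃ w ∈ D.isoSpace d k, D.Represents d k w b := by
  have hrep : D.Represents d k (glue (fun ℓ => (D.quad ℓ).patch) (D.patchFun b)) b := by
    intro ℓ ξ hξ
    rw [glue_eq (s := fun ℓ => (D.quad ℓ).patch) (f := D.patchFun b) (i := ℓ)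
      (fun i j x hi hj => congrArg Prod.fst (h i j x hi hj)) (mem_image_of_mem _ hξ)]
    exact D.patchFun_map b ℓ hξ
  refine ⟨_, ⟨contDiffOn_glue D.isClosed_patch D.uniqueDiffOn_patch
    (D.contDiffOn_patchFun hd b) h, fun x hx => ?_, b, hrep, fun i hi => (hi trivial).elim⟩, hrep⟩
  rw [glue, dif_neg]
  rintro ⟨ℓ, hℓ⟩
  exact hx (D.patch_subset_Omega ℓ hℓ)

end MultiPatchDomain

namespace InnerVertexFour

variable {D : MultiPatchDomain} {L : InnerVertexFour D} {d k : ℕ}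

lemma patchFun_star (hd : 3 ≤ d) (b : D.Index d k → ℝ) (j : Fin 4) {ξ : ℝ × ℝ}
    (hξ : ξ ∈ unitSquare) :
    D.patchFun b (L.patch j) ((L.star j).map ξ) = BSpline.tensor d k (L.loc b j) ξ := by
  rw [star, ← Quad.map_orientParam, D.patchFun_map _ _ (orientParam_mem _ _ hξ),
    splineFun_orientParam hd _ _ _ hξ]
  rfl

/-- Comparison with a reference function `F` on `Ω`: a difference that is flat in parameters has
zero jet on the patch. The auxiliary `δ` is needed because `F` is smooth only on `Ω`, while flatness
concerns a function on the whole parameter plane. -/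
lemma jet2_patchFun_eq (hd : 3 ≤ d) {b : D.Index d k → ℝ} {j : Fin 4} {F δ : ℝ × ℝ → ℝ}
    (hF : ContDiffOn ℝ 2 F D.Omega) (hδ : ContDiff ℝ 2 δ)
    (h : ∀ ξ ∈ unitSquare, δ ξ = BSpline.tensor d k (L.loc b j) ξ - F ((L.star j).map ξ))
    {ξ : ℝ × ℝ} (hξ : ξ ∈ unitSquare) (hflat : Flat δ ξ) :
    jet2 (D.patchFun b (L.patch j)) (D.quad (L.patch j)).patch ((L.star j).map ξ) =
      jet2 F D.Omega ((L.star j).map ξ) := by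
  have hmem : (L.star j).map ξ ∈ (D.quad (L.patch j)).patch := by
    rw [← star_patch]; exact mem_image_of_mem _ hξ
  rw [← jet2_subset (D.patch_subset_Omega (L.patch j)) (D.uniqueDiffOn_patch _)
    D.uniqueDiffOn_Omega hF hmem]
  refine jet2_eq_of_sub (D.uniqueDiffOn_patch _) (D.contDiffOn_patchFun hd b _)
    (hF.mono (D.patch_subset_Omega _)) hmem ?_
  rw [← L.star_patch j]
  refine jet2_eq_zero_of_flat (Quad.contDiff_map _) isCompact_unitSquare uniqueDiffOn_unitSquare
    (L.star_injOn j) (L.star_regular j) hδ (fun ξ hξ => ?_) hξ hflat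
  rw [patchFun_star hd b j hξ, h ξ hξ]

lemma jet2_zero (s : Set (ℝ × ℝ)) (x : ℝ × ℝ) : jet2 (fun _ : ℝ × ℝ => (0 : ℝ)) s x = 0 := by
  have : fderivWithin ℝ (fun _ : ℝ × ℝ => (0 : ℝ)) s = fun _ => 0 :=
    funext fun x => by simp
  simp [jet2, this]

/-- Gluing criterion: for each leg `a` one reference function `F a` is matched to second order along
the leg from both sides, so the jets of the two patches agree there. On the outer sides the last
three rows of coefficients vanish and the jets are zero, as on all remaining patches. -/
lemma exists_represents (hd : 5 ≤ d) (h4 : L.type = 4) {b : D.Index d k → ℝ}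
    (hb : ∀ ℓ, (∀ j, L.patch j ≠ ℓ) → ∀ i, b (ℓ, i) = 0)
    (ho : ∀ j (i i' : Fin (maxIndex d k + 1)),
      (maxIndex d k < i + 3 ∨ maxIndex d k < i' + 3) → L.loc b j i i' = 0)
    {F : Fin 4 → ℝ × ℝ → ℝ} (hF : ∀ a, ContDiffOn ℝ 2 (F a) D.Omega)
    (h1 : ∀ j, ∃ δ : ℝ × ℝ → ℝ, ContDiff ℝ 2 δ ∧
      (∀ ξ ∈ unitSquare, δ ξ = BSpline.tensor d k (L.loc b j) ξ - F j ((L.star j).map ξ)) ∧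
      ∀ s ∈ Icc (0 : ℝ) 1, BSpline.HasJet (fun r => δ (s, r)) 0 0 0 0)
    (h2 : ∀ j, ∃ δ : ℝ × ℝ → ℝ, ContDiff ℝ 2 δ ∧
      (∀ ξ ∈ unitSquare, δ ξ = BSpline.tensor d k (L.loc b j) ξ - F (j + 1) ((L.star j).map ξ)) ∧
      ∀ t ∈ Icc (0 : ℝ) 1, BSpline.HasJet (fun r => δ (r, t)) 0 0 0 0) :
    ∃ w ∈ D.isoSpace d k, D.Represents d k w b := by
  have hd3 : 3 ≤ d := by omega
  set jet := fun ℓ x => jet2 (D.patchFun b ℓ) (D.quad ℓ).patch x with hjet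
  have jetF1 : ∀ j, ∀ x ∈ L.leg j, jet (L.patch j) x = jet2 (F j) D.Omega x := by
    intro j x hx
    obtain ⟨δ, c, e, hf⟩ := h1 j
    rw [← star_side_first] at hx
    obtain ⟨s, hs, rfl⟩ := Quad.mem_side_true hx
    rw [show Quad.bit false = 0 by simp [Quad.bit]]
    exact jet2_patchFun_eq hd3 (hF j) c e ⟨hs, ⟨le_rfl, zero_le_one⟩⟩
      (BSpline.flat_of_hasJet_snd c hf s hs)
  have jetF2 : ∀ j, ∀ x ∈ L.leg (j + 1), jet (L.patch j) x = jet2 (F (j + 1)) D.Omega x := by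
    intro j x hx
    obtain ⟨δ, c, e, hf⟩ := h2 j
    rw [← star_side_second] at hx
    obtain ⟨s, hs, rfl⟩ := Quad.mem_side_false hx
    rw [show Quad.bit false = 0 by simp [Quad.bit]]
    exact jet2_patchFun_eq hd3 (hF (j + 1)) c e ⟨⟨le_rfl, zero_le_one⟩, hs⟩
      (BSpline.flat_of_hasJet_fst c hf s hs)
  have jetO : ∀ j, ∀ ξ ∈ unitSquare, (ξ.1 = 1 ∨ ξ.2 = 1) →
      jet (L.patch j) ((L.star j).map ξ) = 0 := by
    intro j ξ hξ hξ1
    rw [← jet2_zero D.Omega ((L.star j).map ξ)]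
    refine jet2_patchFun_eq (F := fun _ => 0) hd3 contDiffOn_const
      (BSpline.contDiff_tensor (c := L.loc b j)) (fun ξ _ => (sub_zero _).symm) hξ ?_
    obtain ⟨s, t⟩ := ξ
    rcases hξ1 with rfl | rfl
    · refine BSpline.flat_of_hasJet_fst BSpline.contDiff_tensor (fun t _ => ?_) t hξ.2
      simp only [BSpline.tensor_swap _ t]
      exact BSpline.hasJet_spline_one hd fun i hi => BSpline.spline_eq_zero
        (fun i' => ho j i i' (.inl hi)) t
    · refine BSpline.flat_of_hasJet_snd BSpline.contDiff_tensor (fun s _ => ?_) s hξ.1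
      exact BSpline.hasJet_spline_one hd fun i hi => BSpline.spline_eq_zero
        (fun i' => ho j i' i (.inr hi)) s
  have jetN : ∀ ℓ, (∀ j, L.patch j ≠ ℓ) → ∀ x ∈ (D.quad ℓ).patch, jet ℓ x = 0 := by
    intro ℓ hℓ x hx
    rw [← jet2_zero (D.quad ℓ).patch x]
    exact jet2_congr (fun y _ => Finset.sum_eq_zero fun i _ => by
      dsimp only
      rw [hb ℓ hℓ i, zero_mul]) hx
  -- Patches that are not adjacent meet at `v0` only. There the agreement is passed on through the
  -- adjacent pairs.
  have jet0 : ∀ j j', jet (L.patch j) L.v0 = jet (L.patch j') L.v0 := by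
    have hs : ∀ j, jet (L.patch j) L.v0 = jet (L.patch (j + 1)) L.v0 := fun j => by
      rw [jetF2 j _ (L.v0_mem_leg _), jetF1 (j + 1) _ (L.v0_mem_leg _)]
    have h01 := hs 0
    have h12 := hs 1
    have h23 := hs 2
    have h : ∀ j, jet (L.patch j) L.v0 = jet (L.patch 0) L.v0 := by
      intro j
      fin_cases j
      · rfl
      · exact h01.symm
      · exact (h01.trans h12).symm
      · exact ((h01.trans h12).trans h23).symm
    exact fun j j' => (h j).trans (h j').symm
  have jetS : ∀ j ℓ, (∀ j', L.patch j' ≠ ℓ) → ∀ x ∈ (D.quad (L.patch j)).patch,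
      x ∈ (D.quad ℓ).patch → jet (L.patch j) x = jet ℓ x := by
    intro j ℓ hℓ x hx hx'
    obtain ⟨ξ, hξ, rfl, h⟩ := L.mem_outer_side_of_notMem_range hℓ hx hx'
    rw [jetO j ξ hξ h, jetN ℓ hℓ _ hx']
  refine D.exists_represents_of_jet2 hd3 b fun ℓ ℓ' x hx hx' => ?_
  change jet ℓ x = jet ℓ' x
  by_cases hℓ : ∃ j, L.patch j = ℓ
  · obtain ⟨j, rfl⟩ := hℓ
    by_cases hℓ' : ∃ j, L.patch j = ℓ'
    · obtain ⟨j', rfl⟩ := hℓ'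
      by_cases hj : j = j'
      · rw [hj]
      rcases mem_leg_of_mem_patches h4 hj hx hx' with rfl | ⟨rfl, h⟩ | ⟨rfl, h⟩
      · exact jet0 j j'
      · rw [jetF2 j x h, jetF1 _ x h]
      · rw [jetF2 j' x h, jetF1 _ x h]
    · exact jetS j ℓ' (by simpa using hℓ') x hx hx'
  · by_cases hℓ' : ∃ j, L.patch j = ℓ'
    · obtain ⟨j', rfl⟩ := hℓ'
      exact (jetS j' ℓ (by simpa using hℓ) x hx' hx).symm
    · rw [jetN ℓ (by simpa using hℓ) x hx, jetN ℓ' (by simpa using hℓ') x hx']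

end InnerVertexFour

namespace BSpline

variable {d k : ℕ}

/-! ### Derivatives of tensor-product splines along a side -/

/-- The derivatives of order `0`, `1`, `2` at `0` of the spline with coefficients `c`. -/
def endDeriv (d k : ℕ) (c : Fin (maxIndex d k + 1) → ℝ) : ℕ → ℝ
  | 0 => c (Fin.ofNat _ 0)
  | 1 => d / breakpoint k 0 * (c (Fin.ofNat _ 1) - c (Fin.ofNat _ 0))
  | _ => d * (d - 1) / breakpoint k 0 ^ 2 *
      (c (Fin.ofNat _ 2) - 2 * c (Fin.ofNat _ 1) + c (Fin.ofNat _ 0))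

lemma spline_endDeriv (c : Fin (maxIndex d k + 1) → Fin (maxIndex d k + 1) → ℝ) (m : ℕ) (x : ℝ) :
    spline d k (fun i => endDeriv d k (c i) m) x =
      endDeriv d k (fun i' => spline d k (fun i => c i i') x) m := by
  rcases m with _ | _ | m
  · rfl
  all_goals
    simp only [spline, endDeriv, Finset.mul_sum, ← Finset.sum_sub_distrib,
      ← Finset.sum_add_distrib]
    exact Finset.sum_congr rfl fun i _ => by ring

lemma hasJet_tensor (hd : 5 ≤ d) (c : Fin (maxIndex d k + 1) → Fin (maxIndex d k + 1) → ℝ) (s : ℝ) :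
    HasJet (fun r => tensor d k c (s, r)) 0 (spline d k (fun i => endDeriv d k (c i) 0) s)
      (spline d k (fun i => endDeriv d k (c i) 1) s)
      (spline d k (fun i => endDeriv d k (c i) 2) s) := by
  simp only [spline_endDeriv]
  exact hasJet_spline hd _

lemma coeff_eq_zero_of_hasJet (hd : 5 ≤ d) {c : Fin (maxIndex d k + 1) → ℝ}
    (h : HasJet (spline d k c) 0 0 0 0) {i : Fin (maxIndex d k + 1)} (hi : (i : ℕ) ≤ 2) :
    c i = 0 := by
  obtain ⟨c0, c1, c2⟩ := coeffs_of_derivs_zero hd c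
  rw [h.1] at c0 c1 c2
  rw [h.2.1] at c1 c2
  rw [h.2.2] at c2
  simp only [mul_zero, add_zero] at c1 c2
  have hv : ∀ m ≤ 2, (i : ℕ) = m → Fin.ofNat (maxIndex d k + 1) m = i := fun m hm h =>
    Fin.ext (by rw [h]; exact Nat.mod_eq_of_lt (by have := two_le_maxIndex (k := k) hd; omega))
  rcases (by omega : (i : ℕ) = 0 ∨ (i : ℕ) = 1 ∨ (i : ℕ) = 2) with h | h | h
  · rwa [hv 0 (by omega) h] at c0
  · rwa [hv 1 (by omega) h] at c1
  · rwa [hv 2 (by omega) h] at c2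

lemma endDeriv_eq_zero {c : Fin (maxIndex d k + 1) → ℝ} (hd : 5 ≤ d)
    (h : ∀ i : Fin (maxIndex d k + 1), (i : ℕ) ≤ 2 → c i = 0) (m : ℕ) : endDeriv d k c m = 0 := by
  have hn := two_le_maxIndex (k := k) hd
  have hv : ∀ m ≤ 2, c (Fin.ofNat (maxIndex d k + 1) m) = 0 := fun m hm =>
    h _ ((Nat.mod_eq_of_lt (by omega) : (Fin.ofNat (maxIndex d k + 1) m).val = m).le.trans hm)
  rcases m with _ | _ | m <;> simp only [endDeriv, hv 0 (by omega), hv 1 (by omega),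
    hv 2 (by omega)] <;> ring

/-- The derivatives on the leg of the function `W₀(X) + Y W₁(X) + Y² W₂(X) / 2` composed with a
bilinear mapping. -/
lemma hasJet_leg {W0 W1 W2 : ℝ → ℝ} (c0 : ContDiff ℝ 2 W0) (c1 : ContDiff ℝ 2 W1)
    (c2 : ContDiff ℝ 2 W2) (x μ η : ℝ) :
    HasJet (fun r => W0 (x + r * (x * η)) + (r * (1 + x * μ)) * W1 (x + r * (x * η))
        + (r * (1 + x * μ)) ^ 2 / 2 * W2 (x + r * (x * η))) 0 (W0 x)
      ((1 + x * μ) * W1 x + x * η * deriv W0 x)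
      ((1 + x * μ) ^ 2 * W2 x + 2 * (1 + x * μ) * (x * η) * deriv W1 x
          + (x * η) ^ 2 * deriv (deriv W0) x) := by
  have line : ∀ r, HasDerivAt (fun r => x + r * (x * η)) (x * η) r := fun r => by
    simpa using ((hasDerivAt_id r).mul_const (x * η)).const_add x
  have hc : ∀ {W : ℝ → ℝ}, ContDiff ℝ 2 W → ContDiff ℝ 2 (fun r => W (x + r * (x * η))) :=
    fun h => h.comp (contDiff_const.add (contDiff_id.mul contDiff_const))
  have jc : ∀ {W : ℝ → ℝ}, ContDiff ℝ 2 W → HasJet (fun r => W (x + r * (x * η))) 0 (W x)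
      (deriv W x * (x * η)) (deriv (deriv W) x * (x * η) * (x * η)) := by
    intro W hW
    have e1 : deriv (fun r => W (x + r * (x * η))) = fun r => deriv W (x + r * (x * η)) * (x * η) :=
      funext fun r => ((hW.differentiable two_ne_zero _).hasDerivAt.comp r (line r)).deriv
    refine ⟨by simp, by rw [e1]; simp, ?_⟩
    have e2 : HasDerivAt (fun r => deriv W (x + r * (x * η)) * (x * η)) _ 0 :=
      ((hW.differentiable_deriv _).hasDerivAt.comp 0 (line 0)).mul_const (x * η)
    rw [e1, e2.deriv]
    simp
  have jp : HasJet (fun r => r * (1 + x * μ)) 0 0 (1 + x * μ) 0 := by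
    have := hasJet_polynomial (Polynomial.X * Polynomial.C (1 + x * μ)) 0
    simpa using this
  have jq : HasJet (fun r => (r * (1 + x * μ)) ^ 2 / 2) 0 0 0 ((1 + x * μ) ^ 2) := by
    have := hasJet_polynomial (Polynomial.C ((1 + x * μ) ^ 2 / 2) * Polynomial.X * Polynomial.X) 0
    simp only [Polynomial.eval_mul, Polynomial.eval_C, Polynomial.eval_X, Polynomial.derivative_mul,
      Polynomial.derivative_C, Polynomial.derivative_X, Polynomial.derivative_add,
      Polynomial.derivative_zero, Polynomial.derivative_one, Polynomial.eval_add,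
      Polynomial.eval_zero, Polynomial.eval_one] at this
    convert this using 1
    · funext r; ring
    · ring
    · ring
    · ring
  have cp : ContDiff ℝ 2 (fun r : ℝ => r * (1 + x * μ)) := contDiff_id.mul contDiff_const
  have cq : ContDiff ℝ 2 (fun r : ℝ => (r * (1 + x * μ)) ^ 2 / 2) := (cp.pow 2).div_const 2
  have := ((jc c0).add (hc c0) (cp.mul (hc c1)) (jp.mul cp (hc c1) (jc c1))).add
    ((hc c0).add (cp.mul (hc c1))) (cq.mul (hc c2)) (jq.mul cq (hc c2) (jc c2))
  convert this using 1 <;> ring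

/-- Difference of a tensor-product spline and a function near a leg. -/
lemma hasJet_tensor_sub_leg (hd : 5 ≤ d) {W0 W1 W2 : ℝ → ℝ} (c0 : ContDiff ℝ 2 W0)
    (c1 : ContDiff ℝ 2 W1) (c2 : ContDiff ℝ 2 W2) {x μ η : ℝ}
    {c : Fin (maxIndex d k + 1) → Fin (maxIndex d k + 1) → ℝ} {C : ℕ → Fin (maxIndex d k + 1) → ℝ}
    (hc : ∀ m ≤ 2, ∀ i, c i (Fin.ofNat _ m) = C m i)
    (h0 : spline d k (C 0) x = W0 x)
    (h1 : d / breakpoint k 0 * (spline d k (C 1) x - spline d k (C 0) x) =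
        (1 + x * μ) * W1 x + x * η * deriv W0 x)
    (h2 : d * (d - 1) / breakpoint k 0 ^ 2 *
        (spline d k (C 2) x - 2 * spline d k (C 1) x + spline d k (C 0) x) =
        (1 + x * μ) ^ 2 * W2 x + 2 * (1 + x * μ) * (x * η) * deriv W1 x
          + (x * η) ^ 2 * deriv (deriv W0) x) :
    HasJet (fun r => tensor d k c (x, r) - (W0 (x + r * (x * η))
        + (r * (1 + x * μ)) * W1 (x + r * (x * η))
        + (r * (1 + x * μ)) ^ 2 / 2 * W2 (x + r * (x * η)))) 0 0 0 0 := by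
  have hS : ∀ m ≤ 2, spline d k (fun i => c i (Fin.ofNat _ m)) x = spline d k (C m) x := fun m hm => by
    rw [funext (hc m hm)]
  have j1 := hasJet_tensor hd c x
  simp only [spline_endDeriv] at j1
  simp only [endDeriv, hS 0 (by omega), hS 1 (by omega), hS 2 le_rfl, h0] at j1
  rw [h0] at h1 h2
  rw [h1, h2] at j1
  have hcc : ∀ {W : ℝ → ℝ}, ContDiff ℝ 2 W → ContDiff ℝ 2 (fun r => W (x + r * (x * η))) :=
    fun h => h.comp (contDiff_const.add (contDiff_id.mul contDiff_const))
  have cp : ContDiff ℝ 2 (fun r : ℝ => r * (1 + x * μ)) := contDiff_id.mul contDiff_const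
  have cq : ContDiff ℝ 2 (fun r : ℝ => (r * (1 + x * μ)) ^ 2 / 2) := (cp.pow 2).div_const 2
  have cf := ((hcc c0).add (cp.mul (hcc c1))).add (cq.mul (hcc c2))
  have ct : ContDiff ℝ 2 (fun r => tensor d k c (x, r)) :=
    contDiff_tensor.comp (contDiff_const.prodMk contDiff_id)
  have := j1.add ct (contDiff_const.mul cf) ((hasJet_leg c0 c1 c2 x μ η).const_mul cf (-1))
  convert this using 1
  · funext r; ring
  · ring
  · ring
  · ring

end BSpline

namespace InnerVertexFour

open BSpline

variable {D : MultiPatchDomain} {L : InnerVertexFour D} {d k : ℕ}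

/-- If the coefficients of `Ω^{(j)}` near `v0` vanish, then so do those of `Ω^{(j+1)}`. -/
lemma loc_eq_zero_next (hd : 5 ≤ d) (h4 : L.type = 4) {w : ℝ × ℝ → ℝ} (hw : w ∈ D.isoSpace d k)
    {b : D.Index d k → ℝ} (hb : D.Represents d k w b) {j : Fin 4}
    (h : ∀ i i' : Fin (maxIndex d k + 1), (i : ℕ) ≤ 2 → (i' : ℕ) ≤ 2 → L.loc b j i i' = 0)
    (i i' : Fin (maxIndex d k + 1)) (hi : (i : ℕ) ≤ 2) (hi' : (i' : ℕ) ≤ 2) :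
    L.loc b (j + 1) i i' = 0 := by
  have hd3 : 3 ≤ d := by omega
  have hwv : ContDiffAt ℝ 2 w L.v0 := hw.1.contDiffAt (mem_interior_iff_mem_nhds.1 L.inner)
  set c := fun i i' => L.loc b j i' i with hc
  set c' := L.loc b (j + 1) with hc'
  have hjet : ∀ m, HasJet (spline d k (fun i => endDeriv d k (c i) m)) 0 0 0 0 := fun m =>
    hasJet_spline_zero hd fun i hi => endDeriv_eq_zero hd (fun i' hi' => h i' i hi' hi) m
  -- The common leg is `v^{(j+1)}`. The parameters of `Ω^{(j)}` are exchanged so that the leg runs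
  -- in the first direction on both sides, and the transversal directions are `v^{(j)}` and
  -- `v^{(j+2)} = -ν_j v^{(j)}`.
  have key := leg_transfer hwv (V := L.v (j + 1)) (n := L.v j) (μ := L.eta j) (η := L.mu j)
    (lam := -L.nu j) (μ' := L.mu (j + 1)) (η' := L.eta (j + 1))
    (g := fun t r => tensor d k c (t, r)) (g' := fun t r => tensor d k c' (t, r))
    (fun t => contDiff_tensor.comp (contDiff_const.prodMk contDiff_id))
    (fun t => contDiff_tensor.comp (contDiff_const.prodMk contDiff_id))
    (hasJet_tensor hd c) (hasJet_tensor hd c')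
    (contDiff_spline _) (contDiff_spline _) (contDiff_spline _)
    (contDiff_spline _) (contDiff_spline _) (contDiff_spline _)
    (fun t ht r hr => ?_) (fun t ht r hr => ?_) (hjet 0) (hjet 1) (hjet 2)
  · have hm : ∀ m ≤ 2, endDeriv d k (c' i) m = 0 := fun m hm => by
      interval_cases m
      · exact coeff_eq_zero_of_hasJet hd key.1 hi
      · exact coeff_eq_zero_of_hasJet hd key.2.1 hi
      · exact coeff_eq_zero_of_hasJet hd key.2.2 hi
    have := hasJet_spline hd (c' i)
    have e0 := hm 0 (by omega)
    have e1 := hm 1 (by omega)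
    have e2 := hm 2 (by omega)
    simp only [endDeriv] at e0 e1 e2
    rw [e1, e2, e0] at this
    exact coeff_eq_zero_of_hasJet hd this hi'
  · have h1 := represents_star (L := L) hd3 hb j (ξ := (r, t)) ⟨hr, ht⟩
    rw [tensor_swap] at h1
    rw [← h1, star_map, vt_sub]
    congr 1
    module
  · have h1 := represents_star (L := L) hd3 hb (j + 1) (ξ := (t, r)) ⟨ht, hr⟩
    have e2 : j + 1 + 1 = j + 2 := by rw [add_assoc]; rfl
    rw [← h1, star_map, vt_sub, e2, v_opposite h4 j]
    congr 1
    module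

lemma loc_eq_zero_of_zero (hd : 5 ≤ d) (h4 : L.type = 4) {w : ℝ × ℝ → ℝ} (hw : w ∈ D.isoSpace d k)
    {b : D.Index d k → ℝ} (hb : D.Represents d k w b)
    (h : ∀ i i' : Fin (maxIndex d k + 1), (i : ℕ) ≤ 2 → (i' : ℕ) ≤ 2 → L.loc b 0 i i' = 0)
    (j : Fin 4) : ∀ i i' : Fin (maxIndex d k + 1), (i : ℕ) ≤ 2 → (i' : ℕ) ≤ 2 →
      L.loc b j i i' = 0 := by
  have h1 := loc_eq_zero_next hd h4 hw hb h
  have h2 := loc_eq_zero_next hd h4 hw hb h1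
  have h3 := loc_eq_zero_next hd h4 hw hb h2
  fin_cases j
  · exact h
  · exact h1
  · exact h2
  · exact h3

/-! ### Construction of isogeometric functions with prescribed derivatives at the vertex -/

/-- The mixed derivatives in the directions of the legs of `Ω^{(j)}` in terms of those for
`Ω^{(0)}`. -/
def jets (L : InnerVertexFour D) (J : ℕ → ℕ → ℝ) : Fin 4 → ℕ → ℕ → ℝ :=
  ![J, fun m i => (-L.nu 0) ^ i * J i m,
    fun m i => (-L.nu 1) ^ i * ((-L.nu 0) ^ m * J m i),
    fun m i => (-L.nu 2) ^ i * ((-L.nu 1) ^ m * ((-L.nu 0) ^ i * J i m))]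

/-- The first three steps hold by definition. The last step closes the cycle: the accumulated
factors are powers of `(-ν_0)(-ν_2)` and `(-ν_1)(-ν_3)`, both equal to 1. -/
lemma jets_succ (h4 : L.type = 4) (J : ℕ → ℕ → ℝ) (j : Fin 4) (m i : ℕ) :
    L.jets J (j + 1) m i = (-L.nu j) ^ i * L.jets J j i m := by
  fin_cases j
  · rfl
  · rfl
  · rfl
  · show J m i = (-L.nu 3) ^ i * ((-L.nu 2) ^ m * ((-L.nu 1) ^ i * ((-L.nu 0) ^ m * J m i)))
    have e1 : L.nu 0 * L.nu 2 = 1 := nu_mul_nu h4 0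
    have e2 : L.nu 1 * L.nu 3 = 1 := nu_mul_nu h4 1
    calc J m i = (L.nu 1 * L.nu 3) ^ i * (L.nu 0 * L.nu 2) ^ m * J m i := by rw [e1, e2]; simp
      _ = ((-L.nu 1) * (-L.nu 3)) ^ i * ((-L.nu 0) * (-L.nu 2)) ^ m * J m i := by
        rw [neg_mul_neg, neg_mul_neg]
      _ = _ := by rw [mul_pow, mul_pow]; ring

/-- Coefficient vectors with prescribed coefficients on the patches around the vertex. -/
lemma exists_loc_eq (L : InnerVertexFour D)
    (c : Fin 4 → Fin (maxIndex d k + 1) → Fin (maxIndex d k + 1) → ℝ) :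
    ∃ b : D.Index d k → ℝ, (∀ j, L.loc b j = c j) ∧
      ∀ ℓ, (∀ j, L.patch j ≠ ℓ) → ∀ i, b (ℓ, i) = 0 := by
  set f : Fin 4 × SplineIndex d k → D.Index d k := fun x =>
    (L.patch x.1, orientIndex (L.corner x.1) (L.swap x.1) x.2) with hf
  have hinj : Function.Injective f := by
    rintro ⟨j, x⟩ ⟨j', x'⟩ h
    rw [Prod.mk.injEq] at h
    obtain ⟨h1, h2⟩ := h
    obtain rfl : j = j' := L.patch_injective h1
    have h3 : x = x' := orientIndex_injective _ _ h2
    rw [h3]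
  refine ⟨Function.extend f (fun x => c x.1 x.2.1 x.2.2) 0, fun j => ?_, fun ℓ hℓ i => ?_⟩
  · funext i i'
    exact hinj.extend_apply (fun x => c x.1 x.2.1 x.2.2) 0 (j, i, i')
  · refine Function.extend_apply' _ _ _ ?_
    rintro ⟨x, hx⟩
    exact hℓ x.1 (congrArg Prod.fst hx)

/-- The function `W₀(X) + Y W₁(X) + Y² W₂(X) / 2` in the coordinates of the legs of `Ω^{(j)}`. -/
def legFun (L : InnerVertexFour D) (j : Fin 4) (W0 W1 W2 : ℝ → ℝ) (x : ℝ × ℝ) : ℝ :=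
  W0 (cross (x - L.v0) (L.v (j + 1)) / cross (L.v j) (L.v (j + 1)))
    + cross (L.v j) (x - L.v0) / cross (L.v j) (L.v (j + 1))
      * W1 (cross (x - L.v0) (L.v (j + 1)) / cross (L.v j) (L.v (j + 1)))
    + (cross (L.v j) (x - L.v0) / cross (L.v j) (L.v (j + 1))) ^ 2 / 2
      * W2 (cross (x - L.v0) (L.v (j + 1)) / cross (L.v j) (L.v (j + 1)))

lemma contDiff_legFun (L : InnerVertexFour D) (j : Fin 4) {W0 W1 W2 : ℝ → ℝ}
    (c0 : ContDiff ℝ 2 W0) (c1 : ContDiff ℝ 2 W1) (c2 : ContDiff ℝ 2 W2) :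
    ContDiff ℝ 2 (L.legFun j W0 W1 W2) := by
  have hX : ContDiff ℝ 2 fun x : ℝ × ℝ =>
      cross (x - L.v0) (L.v (j + 1)) / cross (L.v j) (L.v (j + 1)) := by
    unfold cross
    fun_prop
  have hY : ContDiff ℝ 2 fun x : ℝ × ℝ =>
      cross (L.v j) (x - L.v0) / cross (L.v j) (L.v (j + 1)) := by
    unfold cross
    fun_prop
  exact ((c0.comp hX).add (hY.mul (c1.comp hX))).add (((hY.pow 2).div_const 2).mul (c2.comp hX))

lemma legFun_apply (L : InnerVertexFour D) (j : Fin 4) (W0 W1 W2 : ℝ → ℝ) (X Y : ℝ) :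
    L.legFun j W0 W1 W2 (L.v0 + X • L.v j + Y • L.v (j + 1)) =
      W0 X + Y * W1 X + Y ^ 2 / 2 * W2 X := by
  have hne := (L.cross_pos j).ne'
  have e1 : L.v0 + X • L.v j + Y • L.v (j + 1) - L.v0 = X • L.v j + Y • L.v (j + 1) := by module
  rw [legFun, e1, cross_add_left, cross_add_right, cross_smul_left, cross_smul_left,
    cross_smul_right, cross_smul_right, cross_self_eq_zero, cross_self_eq_zero, mul_zero, mul_zero,
    add_zero, zero_add, mul_div_cancel_right₀ _ hne, mul_div_cancel_right₀ _ hne]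

/-- Leg functions with the prescribed derivatives fix three rows of coefficients along each leg, and
all other coefficients are zero. The leg functions themselves are the `C²` reference functions for
gluing. -/
lemma exists_of_jets (hd : d = 5 ∨ d = 6) (hk : 7 ≤ d + k) (h4 : L.type = 4) (J : ℕ → ℕ → ℝ) :
    ∃ w ∈ D.isoSpace d k, ∃ b, D.Represents d k w b ∧
      (∀ ℓ, (∀ j, L.patch j ≠ ℓ) → ∀ i, b (ℓ, i) = 0) ∧
      (∀ j (i i' : Fin (maxIndex d k + 1)), L.loc b j i i' ≠ 0 →
        ((i : ℕ) ≤ 2 ∧ (i' : ℕ) + 3 ≤ maxIndex d k) ∨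
          ((i' : ℕ) ≤ 2 ∧ (i : ℕ) + 3 ≤ maxIndex d k)) ∧
      ∀ j, ∀ i ≤ 2, ∀ i' ≤ 2, L.loc b j (Fin.ofNat _ i) (Fin.ofNat _ i') =
        cornerCoeff d k (L.jets J j) (L.mu j) (L.eta j) i i' := by
  have hd5 : 5 ≤ d := by omega
  have hn : 5 ≤ maxIndex d k := hd5.trans (Nat.le_add_right _ _)
  have hval : ∀ m ≤ 2, (Fin.ofNat (maxIndex d k + 1) m).val = m := fun m hm =>
    Nat.mod_eq_of_lt (by omega)
  choose W0 W1 W2 hW using fun j => exists_isLegData hd hk (L.jets J j)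
  choose C a0 a1 a2 a3 a4 using fun j => (hW j).exists_coeffs hd5 (L.mu j) (L.eta j)
  -- The data of leg `j + 1` seen from `Ω^{(j)}`, with exchanged parameters. The transversal
  -- coordinate is rescaled because `v^{(j)} = -ν_j⁻¹ v^{(j+2)}`.
  have hW' : ∀ j, IsLegData d k (fun m i => L.jets J j i m) (W0 (j + 1))
      (fun x => -(L.nu j)⁻¹ * W1 (j + 1) x) (fun x => (-(L.nu j)⁻¹) ^ 2 * W2 (j + 1) x) := fun j => by
    have := (hW (j + 1)).scale (-(L.nu j)⁻¹)
    have hn0 := (L.nu_pos j).ne'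
    convert this using 3 with m i
    rw [jets_succ h4, ← mul_assoc, ← mul_pow, neg_mul_neg, inv_mul_cancel₀ hn0, one_pow, one_mul]
  choose C' a0' a1' a2' a3' a4' using fun j => (hW' j).exists_coeffs hd5 (L.eta j) (L.mu j)
  -- The rows along the first leg take precedence. In the corner block they coincide with the rows
  -- of the second leg, as `hC'` checks.
  set c : Fin 4 → Fin (maxIndex d k + 1) → Fin (maxIndex d k + 1) → ℝ := fun j i i' =>
    if (i' : ℕ) ≤ 2 then C j i' i else if (i : ℕ) ≤ 2 then C' j i i' else 0 with hc
  have hC : ∀ j, ∀ m ≤ 2, ∀ i, c j i (Fin.ofNat _ m) = C j m i := fun j m hm i => by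
    simp only [hc]
    rw [hval m hm, if_pos hm]
  have hC' : ∀ j, ∀ m ≤ 2, ∀ i, c j (Fin.ofNat _ m) i = C' j m i := fun j m hm i => by
    by_cases hi : (i : ℕ) ≤ 2
    · have e : i = Fin.ofNat _ (i : ℕ) := Fin.ext (hval _ hi).symm
      rw [e, hC j _ hi, a4 j m hm _ hi, a4' j _ hi m hm, cornerCoeff_swap _ _ _ hm hi]
    · simp only [hc]
      rw [if_neg hi, hval m hm, if_pos hm]
  obtain ⟨b, hb, hb0⟩ := L.exists_loc_eq c
  have ho : ∀ j (i i' : Fin (maxIndex d k + 1)), L.loc b j i i' ≠ 0 →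
        ((i : ℕ) ≤ 2 ∧ (i' : ℕ) + 3 ≤ maxIndex d k) ∨
          ((i' : ℕ) ≤ 2 ∧ (i : ℕ) + 3 ≤ maxIndex d k) := by
    intro j i i' h
    rw [hb] at h
    by_contra hcon
    push Not at hcon
    apply h
    simp only [hc]
    split_ifs with h1 h2
    · exact a3 j _ _ (hcon.2 h1)
    · exact a3' j _ _ (hcon.1 h2)
    · rfl
  have cW := fun j => (hW j).contDiff
  have cW' := fun j => (hW' j).contDiff
  have hsum : ∀ {W : ℝ → ℝ} (μ η : ℝ), ContDiff ℝ 2 W →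
      ContDiff ℝ 2 (fun ξ : ℝ × ℝ => W (ξ.1 + ξ.2 * (ξ.1 * η))) := fun μ η h =>
    h.comp (by fun_prop)
  have hδ : ∀ {U0 U1 U2 : ℝ → ℝ} (μ η : ℝ), ContDiff ℝ 2 U0 → ContDiff ℝ 2 U1 → ContDiff ℝ 2 U2 →
      ContDiff ℝ 2 (fun ξ : ℝ × ℝ => U0 (ξ.1 + ξ.2 * (ξ.1 * η))
        + (ξ.2 * (1 + ξ.1 * μ)) * U1 (ξ.1 + ξ.2 * (ξ.1 * η))
        + (ξ.2 * (1 + ξ.1 * μ)) ^ 2 / 2 * U2 (ξ.1 + ξ.2 * (ξ.1 * η))) := by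
    intro U0 U1 U2 μ η h0 h1 h2
    have hp : ContDiff ℝ 2 (fun ξ : ℝ × ℝ => ξ.2 * (1 + ξ.1 * μ)) := by fun_prop
    exact ((hsum μ η h0).add (hp.mul (hsum μ η h1))).add
      (((hp.pow 2).div_const 2).mul (hsum μ η h2))
  obtain ⟨w, hw, hwb⟩ := exists_represents hd5 h4 hb0
    (fun j i i' h => by
      by_contra hne
      rcases ho j i i' hne with h' | h' <;> omega)
    (F := fun a => L.legFun a (W0 a) (W1 a) (W2 a))
    (fun a => (L.contDiff_legFun a (cW a).1 (cW a).2.1 (cW a).2.2).contDiffOn)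
    (fun j => by
      refine ⟨_, (contDiff_tensor (c := L.loc b j)).sub
        (hδ (L.mu j) (L.eta j) (cW j).1 (cW j).2.1 (cW j).2.2), fun ξ _ => ?_,
        fun s hs => hasJet_tensor_sub_leg hd5 (cW j).1 (cW j).2.1 (cW j).2.2
        (by rw [hb]; exact hC j) (a0 j s hs) (a1 j s hs) (a2 j s hs)⟩
      obtain ⟨s, t⟩ := ξ
      have e : (L.star j).map (s, t) = L.v0 + (s + t * (s * L.eta j)) • L.v j
          + (t * (1 + s * L.mu j)) • L.v (j + 1) := by
        rw [star_map, vt_sub]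
        module
      dsimp only
      rw [e, legFun_apply])
    (fun j => by
      refine ⟨_, ((contDiff_tensor (c := fun i i' => L.loc b j i' i)).sub
        (hδ (L.eta j) (L.mu j) (cW' j).1 (cW' j).2.1 (cW' j).2.2)).comp
        (contDiff_snd.prodMk contDiff_fst), fun ξ _ => ?_,
        fun s hs => hasJet_tensor_sub_leg hd5 (cW' j).1 (cW' j).2.1 (cW' j).2.2
        (by rw [hb]; exact hC' j) (a0' j s hs) (a1' j s hs) (a2' j s hs)⟩
      obtain ⟨s, t⟩ := ξ
      have hn0 := (L.nu_pos j).ne'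
      have e : (L.star j).map (s, t) = L.v0 + (t + s * (t * L.mu j)) • L.v (j + 1)
          + (-(L.nu j)⁻¹ * (s * (1 + t * L.eta j))) • L.v (j + 1 + 1) := by
        have e2 : j + 1 + 1 = j + 2 := by rw [add_assoc]; rfl
        have e3 : L.v j = (-(L.nu j)⁻¹) • L.v (j + 1 + 1) := by
          rw [e2, v_opposite h4 j, smul_smul, neg_mul_neg, inv_mul_cancel₀ hn0, one_smul]
        rw [star_map, vt_sub]
        nth_rw 1 2 [e3]
        module
      dsimp only [Function.comp_def]
      rw [e, legFun_apply, tensor_swap s t]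
      ring)
  refine ⟨w, hw, b, hwb, hb0, ho, fun j i hi i' hi' => ?_⟩
  rw [hb, hC j i' hi', a4 j i hi i' hi']

end InnerVertexFour

/-! ### Arbitrary corner coefficients are realized by suitable derivatives. -/

namespace BSpline

variable {d k : ℕ}

lemma exists_endCoeff_eq (hd : 5 ≤ d) (y : ℕ → ℝ) : ∃ f : ℕ → ℝ, ∀ i ≤ 2, endCoeff d k f i = y i := by
  have hd0 : (d : ℝ) ≠ 0 := by positivity
  have hd1 : (d : ℝ) - 1 ≠ 0 := by
    have : (5 : ℝ) ≤ d := by exact_mod_cast hd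
    linarith
  have hτ := (breakpoint_pos k 0).ne'
  refine ⟨fun m => if m = 0 then y 0 else if m = 1 then d / breakpoint k 0 * (y 1 - y 0) else
    d * (d - 1) / breakpoint k 0 ^ 2 * (y 2 - 2 * y 1 + y 0), fun i hi => ?_⟩
  interval_cases i <;> simp [endCoeff] <;> field_simp <;> ring

/-- For each `m'` the system is triangular in `m` with unit diagonal, so it is solved recursively:
first order one, then order two with the order-one terms moved to the right-hand side. -/
lemma exists_bilinearJet_eq (B : ℕ → ℕ → ℝ) (μ η : ℝ) :
    ∃ J : ℕ → ℕ → ℝ, ∀ m, ∀ m' ≤ 2, bilinearJet J μ η m m' = B m m' := by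
  let J1 : ℕ → ℝ := fun m => Nat.rec (motive := fun _ => ℝ) (B 0 1)
    (fun n r => B (n + 1) 1 - (n + 1) * μ * r - (n + 1) * η * B (n + 1) 0) m
  have hJ1 : ∀ m, J1 m + m * μ * J1 (m - 1) + m * η * B m 0 = B m 1 := by
    intro m
    cases m with
    | zero => simp [J1]
    | succ n =>
      have : J1 (n + 1) = B (n + 1) 1 - (n + 1) * μ * J1 n - (n + 1) * η * B (n + 1) 0 := rfl
      rw [this]
      push_cast
      ring
  let R : ℕ → ℝ := fun m => B m 2 - 2 * m * η * J1 m - 2 * m * (m - 1) * η * μ * J1 (m - 1)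
    - m * (m - 1) * η ^ 2 * B m 0
  have h2 : ∃ J2 : ℕ → ℝ, ∀ m, J2 m + 2 * m * μ * J2 (m - 1)
      + m * (m - 1) * μ ^ 2 * J2 (m - 2) = R m := by
    -- The recursion has depth two, so the pair carries the current and the previous value. The
    -- initial second entry 0 is harmless, since its factor `(n + 1) * n` vanishes at `n = 0`.
    let P : ℕ → ℝ × ℝ := fun m => Nat.rec (motive := fun _ => ℝ × ℝ) (R 0, 0)
      (fun n p => (R (n + 1) - 2 * (n + 1) * μ * p.1 - (n + 1) * n * μ ^ 2 * p.2, p.1)) m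
    have hP : ∀ n, P (n + 1) = (R (n + 1) - 2 * (n + 1) * μ * (P n).1
      - (n + 1) * n * μ ^ 2 * (P n).2, (P n).1) := fun n => rfl
    refine ⟨fun m => (P m).1, fun m => ?_⟩
    rcases m with _ | _ | m
    · simp [P]
    · simp [hP]
    · have e1 : m + 1 + 1 - 1 = m + 1 := rfl
      have e2 : m + 1 + 1 - 2 = m := rfl
      dsimp only
      rw [e1, e2, hP (m + 1)]
      have e3 : (P (m + 1)).2 = (P m).1 := by rw [hP m]
      rw [e3]
      push_cast
      ring
  obtain ⟨J2, hJ2⟩ := h2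
  refine ⟨fun m m' => if m' = 0 then B m 0 else if m' = 1 then J1 m else J2 m, fun m m' hm' => ?_⟩
  interval_cases m'
  · simp [bilinearJet]
  · simpa [bilinearJet] using hJ1 m
  · have := hJ2 m
    simp only [bilinearJet, if_true, if_neg one_ne_zero, if_neg two_ne_zero]
    norm_num
    simp only [R] at this
    linarith

lemma exists_cornerCoeff_eq (hd : 5 ≤ d) (y : ℕ → ℕ → ℝ) (μ η : ℝ) :
    ∃ J : ℕ → ℕ → ℝ, ∀ i ≤ 2, ∀ i' ≤ 2, cornerCoeff d k J μ η i i' = y i i' := by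
  choose f hf using fun i => exists_endCoeff_eq (k := k) hd (y i)
  choose g hg using fun m' => exists_endCoeff_eq (k := k) hd (fun i => f i m')
  obtain ⟨J, hJ⟩ := exists_bilinearJet_eq (fun m m' => g m' m) μ η
  refine ⟨J, fun i hi i' hi' => ?_⟩
  rw [← hf i i' hi', cornerCoeff]
  have hcongr : ∀ (F G : ℕ → ℝ), (∀ m ≤ 2, F m = G m) → ∀ i, endCoeff d k F i = endCoeff d k G i := by
    intro F G h i
    rcases i with _ | _ | i <;> simp [endCoeff, h 0, h 1, h 2]
  refine hcongr _ _ (fun m' hm' => ?_) _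
  rw [← hg m' i hi]
  exact hcongr _ _ (fun m _ => hJ m m' hm') _

end BSpline

/-! ### Minimal determining sets in linear algebra -/

/-- If no smaller set determines the elements of a space of vectors, then these elements take
arbitrary values on a determining set. -/
lemma exists_eqOn_of_minimal {ι : Type*} [Finite ι] (W : Submodule ℝ (ι → ℝ)) {M : Set ι}
    (h1 : ∀ b ∈ W, (∀ x ∈ M, b x = 0) → b = 0)
    (h2 : ∀ M' ⊆ M, (∀ b ∈ W, (∀ x ∈ M', b x = 0) → b = 0) → M.ncard ≤ M'.ncard) (t : ι → ℝ) :
    ∃ b ∈ W, ∀ x ∈ M, b x = t x := by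
  classical
  let r : (ι → ℝ) →ₗ[ℝ] (M → ℝ) := LinearMap.funLeft ℝ ℝ (Subtype.val : M → ι)
  have hfin : Fintype M := Fintype.ofFinite M
  by_cases htop : W.map r = ⊤
  · have : r t ∈ W.map r := by rw [htop]; trivial
    obtain ⟨b, hb, hbt⟩ := this
    exact ⟨b, hb, fun x hx => congrFun hbt ⟨x, hx⟩⟩
  · exfalso
    -- If the restrictions to `M` did not fill all value vectors, a nonzero functional would vanish
    -- on them. It expresses the value at some `x ∈ M` through the others, so `M \ {x}` would still
    -- determine, contrary to minimality.
    obtain ⟨f, hf, hle⟩ := Submodule.exists_le_ker_of_lt_top _ (lt_top_iff_ne_top.2 htop)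
    have hex : ∃ x, f (Pi.single x 1) ≠ 0 := by
      by_contra hcon
      push Not at hcon
      apply hf
      refine LinearMap.pi_ext' fun x => LinearMap.ext_ring ?_
      simpa using hcon x
    obtain ⟨x, hx⟩ := hex
    have hlt : (M \ {(x : ι)}).ncard < M.ncard := Set.ncard_sdiff_singleton_lt_of_mem x.2
    refine absurd (h2 _ sdiff_subset fun b hb h => h1 b hb fun y hy => ?_) (not_le.2 hlt)
    by_cases hyx : y = x
    · have e : r b = b x • Pi.single x (1 : ℝ) := by
        funext z
        by_cases hz : z = x
        · rw [hz]; simp [r, LinearMap.funLeft]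
        · have h0 := h z ⟨z.2, fun h' => hz (Subtype.ext h')⟩
          simp [r, LinearMap.funLeft, h0, Pi.single_eq_of_ne hz]
      have h0 : f (r b) = 0 := hle ⟨b, hb, rfl⟩
      rw [e, map_smul, smul_eq_mul] at h0
      rw [hyx]
      exact (mul_eq_zero.1 h0).resolve_right hx
    · exact h y ⟨hy, hyx⟩

/-! ### Coefficient vectors of smooth isogeometric functions. -/

namespace MultiPatchDomain

variable {D : MultiPatchDomain} {d k : ℕ}

lemma Represents.add {w w' : ℝ × ℝ → ℝ} {b b' : D.Index d k → ℝ} (h : D.Represents d k w b)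
    (h' : D.Represents d k w' b') : D.Represents d k (w + w') (b + b') := fun ℓ ξ hξ => by
  simp only [Pi.add_apply, h ℓ ξ hξ, h' ℓ ξ hξ, splineFun, add_mul, Finset.sum_add_distrib]

lemma Represents.smul {w : ℝ × ℝ → ℝ} {b : D.Index d k → ℝ} (h : D.Represents d k w b) (a : ℝ) :
    D.Represents d k (a • w) (a • b) := fun ℓ ξ hξ => by
  simp only [Pi.smul_apply, smul_eq_mul, h ℓ ξ hξ, splineFun, mul_assoc, Finset.mul_sum]

lemma Represents.sub {w w' : ℝ × ℝ → ℝ} {b b' : D.Index d k → ℝ} (h : D.Represents d k w b)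
    (h' : D.Represents d k w' b') : D.Represents d k (w - w') (b - b') := by
  have := h.add (h'.smul (-1))
  simpa [sub_eq_add_neg] using this

lemma represents_zero : D.Represents d k 0 0 := fun ℓ ξ _ => by simp [splineFun]

lemma Represents.sum {ι : Type*} (s : Finset ι) {w : ι → ℝ × ℝ → ℝ} {b : ι → D.Index d k → ℝ}
    (h : ∀ i, D.Represents d k (w i) (b i)) :
    D.Represents d k (∑ i ∈ s, w i) (∑ i ∈ s, b i) := by
  classical
  induction s using Finset.induction_on with
  | empty => simpa using represents_zero
  | insert i s hi ih =>
    rw [Finset.sum_insert hi, Finset.sum_insert hi]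
    exact (h i).add ih

lemma Represents.unique (hd : 3 ≤ d) {w : ℝ × ℝ → ℝ} {b b' : D.Index d k → ℝ}
    (h : D.Represents d k w b) (h' : D.Represents d k w b') : b = b' := by
  funext x
  obtain ⟨ℓ, i, i'⟩ := x
  have hz := h.sub h'
  have := BSpline.coeff_eq_zero_of_tensor (d := d) (k := k)
    (c := fun i i' => (b - b') (ℓ, orientIndex (false, false) false (i, i'))) (fun ξ hξ => by
      rw [← splineFun_orientParam hd (fun i => (b - b') (ℓ, i)) (false, false) false hξ,
        ← hz ℓ _ (orientParam_mem _ _ hξ), sub_self]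
      rfl) i i'
  exact sub_eq_zero.1 this

variable (D d k) in
/-- The coefficient vectors of the globally `C²`-smooth isogeometric functions which vanish outside
of `S`. -/
def coeffSpace (S : Set (D.Index d k)) : Submodule ℝ (D.Index d k → ℝ) where
  carrier := {b | (∃ w ∈ D.isoSpace d k, D.Represents d k w b) ∧ ∀ x ∉ S, b x = 0}
  zero_mem' := ⟨⟨0, Submodule.zero_mem _, represents_zero⟩, fun _ _ => rfl⟩
  add_mem' := by
    rintro b b' ⟨⟨w, hw, h⟩, h0⟩ ⟨⟨w', hw', h'⟩, h0'⟩
    exact ⟨⟨w + w', Submodule.add_mem _ hw hw', h.add h'⟩, fun x hx => by simp [h0 x hx, h0' x hx]⟩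
  smul_mem' := by
    rintro a b ⟨⟨w, hw, h⟩, h0⟩
    exact ⟨⟨a • w, Submodule.smul_mem _ a hw, h.smul a⟩, fun x hx => by simp [h0 x hx]⟩

/-- Its role is to correct a function on `M` by one supported on a single edge, so that the
difference belongs to the vertex space. -/
lemma exists_eqOn_minimalDeterminingSet {Γ : Set (ℝ × ℝ)} {M : Set (D.Index d k)}
    (hM : D.IsMinimalDeterminingSet d k Γ M) (t : D.Index d k → ℝ) :
    ∃ b, (∃ w ∈ D.isoSpace d k, D.Represents d k w b) ∧ (∀ x ∉ D.edgeIndices d k Γ, b x = 0) ∧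
      ∀ x ∈ M, b x = t x := by
  obtain ⟨b, ⟨h1, h2⟩, h3⟩ := exists_eqOn_of_minimal (D.coeffSpace d k (D.edgeIndices d k Γ))
    (M := M) (fun b ⟨⟨w, hw, hb⟩, h0⟩ h => hM.1.2 w hw b hb h0 h)
    (fun M' hM' h => hM.2 M' ⟨hM'.trans hM.1.1, fun w hw b hb h0 h' => h b ⟨⟨w, hw, hb⟩, h0⟩ h'⟩) t
  exact ⟨b, h1, h2, h3⟩

lemma supportedSpace_le_isoSpace (S : Set (D.Index d k)) :
    D.supportedSpace d k S ≤ D.isoSpace d k := by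
  rintro w ⟨h1, h2, b, hb, -⟩
  exact ⟨h1, h2, b, hb, fun i hi => (hi trivial).elim⟩

lemma mem_supportedSpace {S : Set (D.Index d k)} {w : ℝ × ℝ → ℝ} (hw : w ∈ D.isoSpace d k)
    {b : D.Index d k → ℝ} (hb : D.Represents d k w b) (h : ∀ i ∉ S, b i = 0) :
    w ∈ D.supportedSpace d k S := ⟨hw.1, hw.2.1, b, hb, h⟩

lemma eq_zero_of_represents_zero {w : ℝ × ℝ → ℝ} (hw : w ∈ D.isoSpace d k)
    (h : D.Represents d k w 0) : w = 0 := by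
  funext x
  by_cases hx : x ∈ D.Omega
  · obtain ⟨ℓ, ξ, hξ, rfl⟩ := mem_iUnion.1 hx
    rw [h ℓ ξ hξ]
    simp [splineFun]
  · exact hw.2.1 x hx

/-- The coefficients of an isogeometric function. -/
def toCoeff (hd : 3 ≤ d) (S : Set (D.Index d k)) :
    D.supportedSpace d k S →ₗ[ℝ] (D.Index d k → ℝ) where
  toFun w := w.2.2.2.choose
  map_add' w w' := (w + w').2.2.2.choose_spec.1.unique hd
    (w.2.2.2.choose_spec.1.add w'.2.2.2.choose_spec.1)
  map_smul' a w := (a • w).2.2.2.choose_spec.1.unique hd (w.2.2.2.choose_spec.1.smul a)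

lemma toCoeff_spec (hd : 3 ≤ d) {S : Set (D.Index d k)} (w : D.supportedSpace d k S) :
    D.Represents d k w (toCoeff hd S w) ∧ ∀ x ∉ S, toCoeff hd S w x = 0 := w.2.2.2.choose_spec

end MultiPatchDomain

namespace InnerVertexFour

open BSpline

variable {D : MultiPatchDomain} {L : InnerVertexFour D} {d k : ℕ}

lemma eq_ofNat_val (i : Fin (maxIndex d k + 1)) : i = Fin.ofNat (maxIndex d k + 1) (i : ℕ) :=
  Fin.ext (Nat.mod_eq_of_lt i.2).symm

/-- The coefficients near `v0` of every `C²`-smooth isogeometric function are determined by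
derivatives at `v0`. -/
lemma exists_jets (hd : d = 5 ∨ d = 6) (hk : 7 ≤ d + k) (h4 : L.type = 4) {w : ℝ × ℝ → ℝ}
    (hw : w ∈ D.isoSpace d k) {b : D.Index d k → ℝ} (hb : D.Represents d k w b) :
    ∃ J : ℕ → ℕ → ℝ, ∀ j, ∀ i ≤ 2, ∀ i' ≤ 2, L.loc b j (Fin.ofNat _ i) (Fin.ofNat _ i') =
      cornerCoeff d k (L.jets J j) (L.mu j) (L.eta j) i i' := by
  have hd5 : 5 ≤ d := by omega
  have hn := two_le_maxIndex (k := k) hd5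
  -- `J` is chosen to fit the given function on `Ω^{(0)}`. The difference to the constructed
  -- function has zero corner block there, hence on all four patches.
  obtain ⟨J, hJ⟩ := exists_cornerCoeff_eq (k := k) hd5
    (fun i i' => L.loc b 0 (Fin.ofNat _ i) (Fin.ofNat _ i')) (L.mu 0) (L.eta 0)
  obtain ⟨w', hw', b', hb', -, -, hc⟩ := exists_of_jets hd hk h4 J
  refine ⟨J, fun j i hi i' hi' => ?_⟩
  have hz := loc_eq_zero_of_zero hd5 h4 (Submodule.sub_mem _ hw hw') (hb.sub hb')
    (fun i i' hi hi' => by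
      rw [loc_sub, sub_eq_zero, eq_ofNat_val i, eq_ofNat_val i', hc 0 _ hi _ hi']
      exact (hJ _ hi _ hi').symm) j (Fin.ofNat _ i) (Fin.ofNat _ i')
    ((Nat.mod_le _ _).trans hi) ((Nat.mod_le _ _).trans hi')
  rw [loc_sub, sub_eq_zero] at hz
  rw [hz, hc j i hi i' hi']

/-! ### Restriction to an edge -/

lemma edge_unique (h4 : L.type = 4) {a a' : Fin 4} {x : D.Index d k}
    (h : x ∈ D.edgeIndices d k (L.leg a)) (h' : x ∈ D.edgeIndices d k (L.leg a')) : a = a' := by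
  obtain ⟨ℓ, y⟩ := x
  obtain ⟨j, rfl⟩ := exists_patch_of_mem_edgeIndices h
  obtain ⟨i, i', rfl⟩ := L.exists_loc_index j y
  rw [mem_edgeIndices_leg h4] at h h'
  unfold awayFromEnds at h h'
  rcases h with ⟨rfl, h1, h2⟩ | ⟨rfl, h1, h2⟩ <;> rcases h' with ⟨rfl, h3, h4⟩ | ⟨rfl, h3, h4⟩
  · rfl
  · omega
  · omega
  · rfl

open Classical in
/-- If the coefficients near `v0` vanish, then the coefficients in the index space of an edge belong
to a `C²`-smooth function. -/
lemma exists_restrict_edge (hd : 5 ≤ d) (h4 : L.type = 4) {w : ℝ × ℝ → ℝ}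
    (hw : w ∈ D.isoSpace d k) {b : D.Index d k → ℝ} (hb : D.Represents d k w b)
    (hs : ∀ x, b x ≠ 0 → ∃ a, x ∈ D.edgeIndices d k (L.leg a)) (a : Fin 4) :
    ∃ w' ∈ D.isoSpace d k, D.Represents d k w'
      (fun x => if x ∈ D.edgeIndices d k (L.leg a) then b x else 0) := by
  set b' : D.Index d k → ℝ := fun x => if x ∈ D.edgeIndices d k (L.leg a) then b x else 0 with hb'
  have hloc : ∀ j (i i' : Fin (maxIndex d k + 1)), L.loc b' j i i' =
      if (j = a ∧ (i' : ℕ) ≤ 2 ∧ awayFromEnds i) ∨ (j + 1 = a ∧ (i : ℕ) ≤ 2 ∧ awayFromEnds i')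
      then L.loc b j i i' else 0 := fun j i i' => by
    simp only [hb', loc, mem_edgeIndices_leg h4]
  have hs' : ∀ j (i i' : Fin (maxIndex d k + 1)), L.loc b j i i' ≠ 0 →
      ((i' : ℕ) ≤ 2 ∧ awayFromEnds i) ∨ ((i : ℕ) ≤ 2 ∧ awayFromEnds i') := fun j i i' h => by
    obtain ⟨a', ha'⟩ := hs _ h
    rw [mem_edgeIndices_leg h4] at ha'
    rcases ha' with ⟨-, h⟩ | ⟨-, h⟩
    · exact .inl h
    · exact .inr h
  have hn : 5 ≤ maxIndex d k := hd.trans (Nat.le_add_right _ _)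
  have hj1 : ∀ j : Fin 4, j + 1 ≠ j := by decide
  -- The reference function is `w` on the leg `a` and zero on the other legs. Near `a` nothing
  -- relevant is cut off, since all coefficients near `v0` vanish and the strips of different legs
  -- are disjoint.
  refine exists_represents hd h4 (fun ℓ hℓ i => ?_) (fun j i i' h => ?_)
    (F := fun a' => if a' = a then w else fun _ => 0) (fun a' => ?_) (fun j => ?_) (fun j => ?_)
  · simp only [hb']
    split_ifs with h
    · obtain ⟨j, hj⟩ := exists_patch_of_mem_edgeIndices h
      exact (hℓ j hj).elim
    · rfl
  · rw [hloc]
    split_ifs with h'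
    · by_contra hne
      unfold awayFromEnds at h'
      omega
    · rfl
  · split_ifs
    · exact hw.1
    · exact contDiffOn_const
  · by_cases hj : j = a
    · refine ⟨tensor d k (fun i i' => L.loc b' j i i' - L.loc b j i i'), contDiff_tensor,
        fun ξ hξ => ?_, fun s _ => ?_⟩
      · rw [tensor_sub, if_pos hj, represents_star (by omega) hb j hξ]
      · refine hasJet_spline_zero hd fun i' hi' => spline_eq_zero (fun i => ?_) s
        dsimp only
        rw [hloc, sub_eq_zero]
        split_ifs with h
        · rfl
        · by_contra hne
          unfold awayFromEnds at *
          rcases hs' j i i' (Ne.symm hne) with h' | h'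
          · exact h (.inl ⟨hj, h'⟩)
          · omega
    · refine ⟨tensor d k (L.loc b' j), contDiff_tensor, fun ξ hξ => ?_, fun s _ => ?_⟩
      · rw [if_neg hj, sub_zero]
      · refine hasJet_spline_zero hd fun i' hi' => spline_eq_zero (fun i => ?_) s
        rw [hloc, if_neg]
        unfold awayFromEnds
        rintro (h | h)
        · exact hj h.1
        · omega
  · by_cases hj : j + 1 = a
    · refine ⟨tensor d k (fun i i' => L.loc b' j i i' - L.loc b j i i'), contDiff_tensor,
        fun ξ hξ => ?_, fun s _ => ?_⟩
      · rw [tensor_sub, if_pos hj, represents_star (by omega) hb j hξ]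
      · simp only [tensor_swap _ s]
        refine hasJet_spline_zero hd fun i hi => spline_eq_zero (fun i' => ?_) s
        dsimp only
        rw [hloc, sub_eq_zero]
        split_ifs with h
        · rfl
        · by_contra hne
          unfold awayFromEnds at *
          rcases hs' j i i' (Ne.symm hne) with h' | h'
          · omega
          · exact h (.inr ⟨hj, h'⟩)
    · refine ⟨tensor d k (L.loc b' j), contDiff_tensor, fun ξ hξ => ?_, fun s _ => ?_⟩
      · rw [if_neg hj, sub_zero]
      · simp only [tensor_swap _ s]
        refine hasJet_spline_zero hd fun i hi => spline_eq_zero (fun i' => ?_) s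
        dsimp only
        rw [hloc, if_neg]
        unfold awayFromEnds
        rintro (h | h)
        · omega
        · exact hj h.1

/-! ### The dimension of the vertex space -/

lemma vertexSpace_eq (M : Set (ℝ × ℝ) → Set (D.Index d k)) : D.vertexSpace d k M L.v0 =
    D.supportedSpace d k (D.vertexIndices d k L.v0 ∪
      ⋃ a, D.edgeIndices d k (L.leg a) \ M (L.leg a)) := by
  rw [MultiPatchDomain.vertexSpace, innerEdges_v0, biUnion_range]

/-- The coefficients of `Ω^{(0)}` near `v0`. -/
def cornerMap (L : InnerVertexFour D) (d k : ℕ) : (D.Index d k → ℝ) →ₗ[ℝ] (Fin 3 × Fin 3 → ℝ) where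
  toFun b p := L.loc b 0 (Fin.ofNat _ p.1) (Fin.ofNat _ p.2)
  map_add' _ _ := rfl
  map_smul' _ _ := rfl

/-- Evaluation of the nine coefficients of `Ω^{(0)}` near `v0` is an isomorphism. Neither direction
depends on which minimal determining sets are chosen. -/
lemma finrank_vertexSpace (hd : d = 5 ∨ d = 6) (hk : 7 ≤ d + k) (h4 : L.type = 4)
    {M : Set (ℝ × ℝ) → Set (D.Index d k)}
    (hM : ∀ Γ ∈ D.innerEdges, D.IsMinimalDeterminingSet d k Γ (M Γ)) :
    Module.finrank ℝ (D.vertexSpace d k M L.v0) = 9 := by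
  classical
  have hd5 : 5 ≤ d := by omega
  have hd3 : 3 ≤ d := by omega
  have hM' : ∀ a, D.IsMinimalDeterminingSet d k (L.leg a) (M (L.leg a)) := fun a =>
    hM _ (((innerEdges_v0 (L := L)).symm ▸ mem_range_self a :
      L.leg a ∈ {Γ | Γ ∈ D.innerEdges ∧ L.v0 ∈ Γ}).1)
  rw [vertexSpace_eq]
  set S := D.vertexIndices d k L.v0 ∪ ⋃ a, D.edgeIndices d k (L.leg a) \ M (L.leg a) with hS
  set T := (L.cornerMap d k).comp (MultiPatchDomain.toCoeff hd3 S) with hT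
  have hinj : Function.Injective T := by
    rw [← LinearMap.ker_eq_bot, LinearMap.ker_eq_bot']
    intro w hTw
    obtain ⟨hb, hsupp⟩ := MultiPatchDomain.toCoeff_spec hd3 w
    set b := MultiPatchDomain.toCoeff hd3 S w with hbdef
    have hw : (w : ℝ × ℝ → ℝ) ∈ D.isoSpace d k := D.supportedSpace_le_isoSpace S w.2
    have h0 : ∀ i i' : Fin (maxIndex d k + 1), (i : ℕ) ≤ 2 → (i' : ℕ) ≤ 2 → L.loc b 0 i i' = 0 := by
      intro i i' hi hi'
      have := congrFun hTw (⟨i, by omega⟩, ⟨i', by omega⟩)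
      rw [eq_ofNat_val i, eq_ofNat_val i']
      exact this
    have hz := loc_eq_zero_of_zero hd5 h4 hw hb h0
    have hmem : ∀ x, b x ≠ 0 → ∃ a, x ∈ D.edgeIndices d k (L.leg a) \ M (L.leg a) := by
      intro x hx
      have hxS : x ∈ S := by
        by_contra h
        exact hx (hsupp x h)
      rcases hxS with h | h
      · exfalso
        obtain ⟨ℓ, y⟩ := x
        obtain ⟨j, rfl⟩ := exists_patch_of_mem_vertexIndices h
        obtain ⟨i, i', rfl⟩ := L.exists_loc_index j y
        rw [mem_vertexIndices] at h
        exact hx (hz j i i' h.1 h.2)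
      · exact mem_iUnion.1 h
    have hb0 : b = 0 := by
      funext x
      by_contra hx
      obtain ⟨a, ha, -⟩ := hmem x hx
      -- Once the vertex coefficients vanish, the function is a sum of smooth pieces on single
      -- edges. Each piece vanishes on its determining set and is therefore zero.
      obtain ⟨w', hw', hb'⟩ := exists_restrict_edge hd5 h4 hw hb
        (fun x hx => (hmem x hx).imp fun a h => h.1) a
      have := (hM' a).1.2 w' hw' _ hb' (fun x hx => if_neg hx) (fun x hxM => ?_)
      · have hx' := congrFun this x
        rw [if_pos ha] at hx'
        exact hx hx'
      · split_ifs with hxa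
        · by_contra hne
          obtain ⟨a', ha', hn⟩ := hmem x hne
          rw [edge_unique h4 hxa ha'] at hxM
          exact hn hxM
        · rfl
    rw [hb0] at hb
    exact Subtype.ext (MultiPatchDomain.eq_zero_of_represents_zero hw hb)
  have hsurj : Function.Surjective T := by
    intro y
    obtain ⟨J, hJ⟩ := exists_cornerCoeff_eq (k := k) hd5
      (fun i i' => y (Fin.ofNat 3 i, Fin.ofNat 3 i')) (L.mu 0) (L.eta 0)
    obtain ⟨w, hw, b, hb, hb0, hsupp, hc⟩ := exists_of_jets hd hk h4 J
    -- The constructed function may be nonzero on the sets `M`. These values are removed by edge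
    -- functions, which do not touch the corner block.
    choose b' hb' h0' hM0 using fun a => MultiPatchDomain.exists_eqOn_minimalDeterminingSet (hM' a) b
    choose w' hw' hr' using hb'
    have hrep : D.Represents d k (w - ∑ a, w' a) (b - ∑ a, b' a) :=
      hb.sub (MultiPatchDomain.Represents.sum _ hr')
    have hmem : w - ∑ a, w' a ∈ D.isoSpace d k :=
      Submodule.sub_mem _ hw (Submodule.sum_mem _ fun a _ => hw' a)
    have hzero : ∀ x ∉ S, (b - ∑ a, b' a) x = 0 := by
      intro x hx
      rw [hS, mem_union, not_or, mem_iUnion, not_exists] at hx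
      obtain ⟨hx1, hx2⟩ := hx
      rw [Pi.sub_apply, Finset.sum_apply]
      by_cases hex : ∃ a, x ∈ D.edgeIndices d k (L.leg a)
      · obtain ⟨a, ha⟩ := hex
        have hxM : x ∈ M (L.leg a) := by
          by_contra h
          exact hx2 a ⟨ha, h⟩
        rw [Finset.sum_eq_single a (fun a' _ hne => h0' a' x fun h => hne (edge_unique h4 h ha))
          (fun h => (h (Finset.mem_univ a)).elim), hM0 a x hxM, sub_self]
      · rw [Finset.sum_eq_zero fun a _ => h0' a x fun h => hex ⟨a, h⟩, sub_zero]
        obtain ⟨ℓ, z⟩ := x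
        by_cases hℓ : ∃ j, L.patch j = ℓ
        · obtain ⟨j, rfl⟩ := hℓ
          obtain ⟨i, i', rfl⟩ := L.exists_loc_index j z
          by_contra hne
          apply hex
          rw [mem_vertexIndices] at hx1
          rcases hsupp j i i' hne with h | h
          · refine ⟨j + 1, (mem_edgeIndices_leg h4 _ _ _ _).2 (.inr ⟨rfl, h.1, ?_, h.2⟩)⟩
            omega
          · refine ⟨j, (mem_edgeIndices_leg h4 _ _ _ _).2 (.inl ⟨rfl, h.1, ?_, h.2⟩)⟩
            omega
        · exact hb0 ℓ (by simpa using hℓ) z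
    refine ⟨⟨_, MultiPatchDomain.mem_supportedSpace hmem hrep hzero⟩, ?_⟩
    have hco := (MultiPatchDomain.toCoeff_spec hd3
      ⟨_, MultiPatchDomain.mem_supportedSpace hmem hrep hzero⟩).1.unique hd3 hrep
    funext p
    rw [hT, LinearMap.comp_apply, hco]
    have hp1 : (p.1 : ℕ) ≤ 2 := by omega
    have hp2 : (p.2 : ℕ) ≤ 2 := by omega
    have e1 : L.loc b 0 (Fin.ofNat _ p.1) (Fin.ofNat _ p.2) = y p := by
      rw [hc 0 _ hp1 _ hp2]
      refine (hJ _ hp1 _ hp2).trans ?_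
      congr 1
      exact Prod.ext (Fin.ext (Nat.mod_eq_of_lt p.1.2)) (Fin.ext (Nat.mod_eq_of_lt p.2.2))
    show L.loc (b - ∑ a, b' a) 0 _ _ = y p
    rw [loc_sub, e1, sub_eq_self, loc, Finset.sum_apply]
    refine Finset.sum_eq_zero fun a _ => h0' a _ fun h => ?_
    rw [mem_edgeIndices_leg h4] at h
    have v1 := (Nat.mod_le (p.1 : ℕ) (maxIndex d k + 1)).trans hp1
    have v2 := (Nat.mod_le (p.2 : ℕ) (maxIndex d k + 1)).trans hp2
    rcases h with ⟨-, -, h, -⟩ | ⟨-, -, h, -⟩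
    · exact absurd (h.trans v1) (by norm_num)
    · exact absurd (h.trans v2) (by norm_num)
  rw [(LinearEquiv.ofBijective T ⟨hinj, hsurj⟩).finrank_eq]
  simp

end InnerVertexFour

/-! ### The twelve linear forms -/

namespace TypeFour

variable {d k : ℕ} {v vt : Fin 4 → ℝ × ℝ}

lemma pos_sub (j : Fin 4) : pos (j + 1) - 2 = pos j + 2 ∧ pos (j + 1) - 4 = pos j ∧
    pos (j + 1) - 3 = pos j + 1 := by
  revert j
  decide

lemma eTilde_apply (j : Fin 4) (x : ZMod 16 → ℝ) : eTilde v (j + 1) x =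
    1 / 2 * psi v (j + 1) (j + 2) * x (pos j + 2) + 1 / 2 * psi v j (j + 1) * x (pos (j + 1)) := by
  have e : j + 1 + 1 = j + 2 := by rw [add_assoc]; rfl
  rw [eTilde, (pos_sub j).1, add_sub_cancel_right, e]
  rfl

lemma eBar_apply (j : Fin 4) (x : ZMod 16 → ℝ) : eBar v (j + 1) x =
    psi v j (j + 1) ^ 2 * psi v (j + 2) (j + 1) * x (pos (j + 1) + 2)
      + psi v (j + 1) (j + 2) ^ 3 * x (pos j) := by
  have e : j + 1 + 1 = j + 2 := by rw [add_assoc]; rfl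
  rw [eBar, (pos_sub j).2.1, add_sub_cancel_right, e]
  rfl

lemma eHat_apply (j : Fin 4) (x : ZMod 16 → ℝ) : eHat d k v vt (j + 1) x =
    (3 * cross (v (j + 1)) (vt (j + 1)) + 7 * psi v (j + 2) (j + 1)) * psi v (j + 2) (j + 1) ^ 2
        * x (pos j)
      - 2 * psi v (j + 2) (j + 1) ^ 3 * x (pos j + 1)
      + 4 * psi v (j + 2) (j + 1) ^ 3 * x (pos j + 2)
      + 2 * psi v (j + 1) j ^ 2 * psi v (j + 2) (j + 1) * x (pos (j + 1) + 1)
      + C1 d k v vt (j + 1) * x (pos (j + 1)) + C2 d k v vt (j + 1) * x (pos (j + 1) + 2) := by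
  have e : j + 1 + 1 = j + 2 := by rw [add_assoc]; rfl
  rw [eHat, (pos_sub j).1, (pos_sub j).2.1, (pos_sub j).2.2, add_sub_cancel_right, e]
  rfl

/-- Evaluation at unit vectors is triangular in a suitable order. The positions 1, 5, 9,
coefficients of type `(2,2)`, isolate the three `ê` one after another. The positions 0, 2, 14, 12,
4, 8 then determine the remaining six coefficients. -/
lemma linearIndependent_firstNine (h : ∀ j, psi v j (j + 1) ≠ 0) :
    LinearIndependent ℝ (firstNine d k v vt) := by
  have hψ : ∀ j, psi v (j + 2) (j + 1) ≠ 0 := fun j => by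
    have e : j + 1 + 1 = j + 2 := by rw [add_assoc]; rfl
    have := h (j + 1)
    rw [e, psi, cross_comm] at this
    exact neg_ne_zero.1 this
  rw [Fintype.linearIndependent_iff]
  intro g hg
  have key : ∀ x : ZMod 16 → ℝ,
      g 0 * eTilde v (0 + 1) x + g 1 * eBar v (0 + 1) x + g 2 * eHat d k v vt (0 + 1) x
      + g 3 * eTilde v (1 + 1) x + g 4 * eBar v (1 + 1) x + g 5 * eHat d k v vt (1 + 1) x
      + g 6 * eTilde v (2 + 1) x + g 7 * eBar v (2 + 1) x + g 8 * eHat d k v vt (2 + 1) x = 0 := by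
    intro x
    have := LinearMap.congr_fun hg x
    rw [Fin.sum_univ_castSucc, Fin.sum_univ_eight] at this
    exact this
  simp only [eTilde_apply, eBar_apply, eHat_apply] at key
  have hs : ∀ m n : ZMod 16, (Pi.single m 1 : ZMod 16 → ℝ) n = if n = m then 1 else 0 := fun m n =>
    Pi.single_apply m 1 n
  have p0 : pos 0 = 0 := by decide
  have p1 : pos (0 + 1) = 4 := by decide
  have p1' : pos 1 = 4 := by decide
  have p2 : pos (1 + 1) = 8 := by decide
  have p2' : pos 2 = 8 := by decide
  have p3 : pos (2 + 1) = 12 := by decide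
  simp only [p0, p1, p1', p2, p2', p3] at key
  have h12 : psi v 1 2 ≠ 0 := h 1
  have h23 : psi v 2 3 ≠ 0 := h 2
  have s12 : psi v 2 1 ≠ 0 := hψ 0
  have s23 : psi v 3 2 ≠ 0 := hψ 1
  have s30 : psi v 0 3 ≠ 0 := hψ 2
  have g2 : g 2 = 0 := by
    have := key (Pi.single 1 1)
    simp only [hs] at this
    simpa +decide [s12] using this
  have g5 : g 5 = 0 := by
    have := key (Pi.single 5 1)
    simp only [hs, g2] at this
    simpa +decide [s23] using this
  have g8 : g 8 = 0 := by
    have := key (Pi.single 9 1)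
    simp only [hs, g2, g5] at this
    simpa +decide [s30] using this
  simp only [g2, g5, g8, zero_mul, add_zero] at key
  have g1 : g 1 = 0 := by
    have := key (Pi.single 0 1)
    simp only [hs] at this
    simpa +decide [h12] using this
  have g0 : g 0 = 0 := by
    have := key (Pi.single 2 1)
    simp only [hs, g1] at this
    simpa +decide [h12] using this
  have g7 : g 7 = 0 := by
    have := key (Pi.single 14 1)
    simp only [hs, g0, g1] at this
    simpa +decide [h23, s30] using this
  have g6 : g 6 = 0 := by
    have := key (Pi.single 12 1)
    simp only [hs, g0, g1, g7] at this
    simpa +decide [h23] using this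
  have g4 : g 4 = 0 := by
    have := key (Pi.single 4 1)
    simp only [hs, g0, g1, g6, g7] at this
    simpa +decide [h23] using this
  have g3 : g 3 = 0 := by
    have := key (Pi.single 8 1)
    simp only [hs, g0, g1, g4, g6, g7] at this
    simpa +decide [h12] using this
  intro i
  fin_cases i <;> assumption

end TypeFour

/-! ### The edge equations as transformation rules across a leg. -/

namespace InnerVertexFour

open TypeFour

variable {D : MultiPatchDomain} {L : InnerVertexFour D} {d k : ℕ}

lemma psi_eq (h4 : L.type = 4) (j : Fin 4) :
    psi L.v (j + 1) (j + 2) = L.nu j * psi L.v j (j + 1) ∧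
    psi L.v (j + 2) (j + 1) = -(L.nu j * psi L.v j (j + 1)) ∧
    psi L.v (j + 1) j = - psi L.v j (j + 1) := by
  refine ⟨?_, ?_, cross_comm _ _⟩
  · rw [psi, psi, v_opposite h4 j, cross_smul_right, cross_comm (L.v (j + 1))]
    ring
  · rw [psi, psi, v_opposite h4 j, cross_smul_left, neg_mul]

/-- The factor `κ`. -/
def kappa (d k : ℕ) : ℝ := 1 / (((d : ℝ) - 1) * ((k : ℝ) + 1))

/-- The mixed derivative of order `(2, 2)` in terms of the coefficients of the second ring, up to
a common factor. -/
def mixed (L : InnerVertexFour D) (d k : ℕ) (x : ZMod 16 → ℝ) (j : Fin 4) : ℝ :=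
  (x (pos j + 1) - 2 * (x (pos j) + x (pos j + 2))) / kappa d k
    - 4 * L.mu j * x (pos j + 2) - 4 * L.eta j * x (pos j)

/-- Modulo `ẽ` and `ē`, the long equation `ê` only says that the formal derivative of order `(2,2)`
is multiplied by `ν_j ^ 2`. The constants `C₁`, `C₂` and the vertices `ṽ` enter solely through `μ`
and `η` in passing from coefficients to derivatives. -/
lemma eHat_eq (h4 : L.type = 4) (hd : 2 ≤ d) (j : Fin 4) (x : ZMod 16 → ℝ)
    (h1 : x (pos (j + 1)) = -L.nu j * x (pos j + 2))
    (h2 : x (pos (j + 1) + 2) = L.nu j ^ 2 * x (pos j)) :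
    eHat d k L.v L.vt (j + 1) x = -2 * L.nu j * psi L.v j (j + 1) ^ 3 * kappa d k *
      (L.mixed d k x (j + 1) - L.nu j ^ 2 * L.mixed d k x j) := by
  have e : j + 1 + 1 = j + 2 := by rw [add_assoc]; rfl
  have hd1 : (0 : ℝ) < (d : ℝ) - 1 := by
    have : (2 : ℝ) ≤ d := by exact_mod_cast hd
    linarith
  have hκ : kappa d k ≠ 0 := by unfold kappa; positivity
  have t1 : L.vt (j + 1) = (1 + L.eta (j + 1)) • L.v (j + 1) + (1 + L.mu (j + 1)) • L.v (j + 2) := by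
    have := L.vt_sub (j + 1)
    rw [e] at this
    rw [add_smul, add_smul, one_smul, one_smul, add_add_add_comm, ← this]
    abel
  have t0 : L.vt j = (1 + L.eta j) • L.v j + (1 + L.mu j) • L.v (j + 1) := by
    have := L.vt_sub j
    rw [add_smul, add_smul, one_smul, one_smul, add_add_add_comm, ← this]
    abel
  have c0 : cross (L.v j) (L.v (j + 2)) = 0 := by
    rw [v_opposite h4 j, cross_smul_right, cross_self_eq_zero, mul_zero]
  obtain ⟨s1, s2, s3⟩ := psi_eq h4 j
  have s1' : cross (L.v (j + 1)) (L.v (j + 2)) = L.nu j * psi L.v j (j + 1) := s1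
  have s3' : cross (L.v (j + 1)) (L.v j) = - psi L.v j (j + 1) := s3
  have hX : cross (L.v (j + 1)) (L.vt (j + 1)) =
      (1 + L.mu (j + 1)) * (L.nu j * psi L.v j (j + 1)) := by
    rw [t1, cross_add_right, cross_smul_right, cross_smul_right, cross_self_eq_zero, s1']
    ring
  have hX1 : cross (L.vt j) (L.v (j + 2)) = (1 + L.mu j) * (L.nu j * psi L.v j (j + 1)) := by
    rw [t0, cross_add_left, cross_smul_left, cross_smul_left, c0, s1']
    ring
  have hX2 : cross (L.v j) (L.vt (j + 1)) = (1 + L.eta (j + 1)) * psi L.v j (j + 1) := by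
    rw [t1, cross_add_right, cross_smul_right, cross_smul_right, c0, psi]
    ring
  have hX3 : cross (L.v (j + 1)) (L.vt j) = -(1 + L.eta j) * psi L.v j (j + 1) := by
    rw [t0, cross_add_right, cross_smul_right, cross_smul_right, cross_self_eq_zero, s3']
    ring
  have h8 : 8 / (((d : ℝ) - 1) * ((k : ℝ) + 1)) = 8 * kappa d k := by rw [kappa]; ring
  have m0 : x (pos j + 1) = 2 * (x (pos j) + x (pos j + 2)) + kappa d k *
      (L.mixed d k x j + 4 * L.mu j * x (pos j + 2) + 4 * L.eta j * x (pos j)) := by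
    rw [mixed]
    field_simp
    ring
  have m1 : x (pos (j + 1) + 1) = 2 * (x (pos (j + 1)) + x (pos (j + 1) + 2)) + kappa d k *
      (L.mixed d k x (j + 1) + 4 * L.mu (j + 1) * x (pos (j + 1) + 2)
        + 4 * L.eta (j + 1) * x (pos (j + 1))) := by
    rw [mixed]
    field_simp
    ring
  rw [eHat_apply, m0, m1, C1, C2, h8, add_sub_cancel_right, e, hX, hX1, hX2, hX3, s1, s2, s3, h1, h2]
  ring

/-- The three equations of an edge in terms of the derivatives of the two adjacent patches. -/
lemma edgeEquations_iff (h4 : L.type = 4) (hd : 2 ≤ d) (j : Fin 4) (x : ZMod 16 → ℝ) :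
    (∀ i, edgeEquations d k L.v L.vt (j + 1) i x = 0) ↔
      x (pos (j + 1)) = -L.nu j * x (pos j + 2) ∧ x (pos (j + 1) + 2) = L.nu j ^ 2 * x (pos j) ∧
        L.mixed d k x (j + 1) = L.nu j ^ 2 * L.mixed d k x j := by
  have hA : psi L.v j (j + 1) ≠ 0 := (L.cross_pos j).ne'
  have hν := (L.nu_pos j).ne'
  have hd1 : (0 : ℝ) < (d : ℝ) - 1 := by
    have : (2 : ℝ) ≤ d := by exact_mod_cast hd
    linarith
  have hκ : kappa d k ≠ 0 := by unfold kappa; positivity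
  obtain ⟨s1, s2, -⟩ := psi_eq h4 j
  have hT : eTilde L.v (j + 1) x = 1 / 2 * psi L.v j (j + 1) *
      (x (pos (j + 1)) - -L.nu j * x (pos j + 2)) := by rw [eTilde_apply, s1]; ring
  have hB : eBar L.v (j + 1) x = -(L.nu j * psi L.v j (j + 1) ^ 3) *
      (x (pos (j + 1) + 2) - L.nu j ^ 2 * x (pos j)) := by rw [eBar_apply, s1, s2]; ring
  have hall : (∀ i, edgeEquations d k L.v L.vt (j + 1) i x = 0) ↔ eTilde L.v (j + 1) x = 0 ∧
      eBar L.v (j + 1) x = 0 ∧ eHat d k L.v L.vt (j + 1) x = 0 := by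
    rw [Fin.forall_fin_succ, Fin.forall_fin_two]
    rfl
  have hT' : eTilde L.v (j + 1) x = 0 ↔ x (pos (j + 1)) = -L.nu j * x (pos j + 2) := by
    rw [hT, mul_eq_zero, sub_eq_zero, or_iff_right (by positivity)]
  have hB' : eBar L.v (j + 1) x = 0 ↔ x (pos (j + 1) + 2) = L.nu j ^ 2 * x (pos j) := by
    rw [hB, mul_eq_zero, sub_eq_zero, or_iff_right (by simp [hν, hA])]
  rw [hall, hT', hB']
  refine and_congr_right fun h1 => and_congr_right fun h2 => ?_
  rw [eHat_eq h4 hd j x h1 h2, mul_eq_zero, sub_eq_zero, or_iff_right (by simp [hν, hA, hκ])]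

/-- Composing the rules of three edges gives the inverse of the fourth, because opposite ratios
multiply to 1. -/
lemma equations_of_firstNine (h4 : L.type = 4) (hd : 2 ≤ d) {x : ZMod 16 → ℝ}
    (h : ∀ i, firstNine d k L.v L.vt i x = 0) : ∀ y, equations d k L.v L.vt y x = 0 := by
  have h1 : ∀ i, edgeEquations d k L.v L.vt (0 + 1) i x = 0 := by
    intro i
    fin_cases i
    exacts [h 0, h 1, h 2]
  have h2 : ∀ i, edgeEquations d k L.v L.vt (1 + 1) i x = 0 := by
    intro i
    fin_cases i
    exacts [h 3, h 4, h 5]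
  have h3 : ∀ i, edgeEquations d k L.v L.vt (2 + 1) i x = 0 := by
    intro i
    fin_cases i
    exacts [h 6, h 7, h 8]
  have h0 : ∀ i, edgeEquations d k L.v L.vt (3 + 1) i x = 0 := by
    obtain ⟨a1, b1, c1⟩ := (edgeEquations_iff h4 hd 0 x).1 h1
    obtain ⟨a2, b2, c2⟩ := (edgeEquations_iff h4 hd 1 x).1 h2
    obtain ⟨a3, b3, c3⟩ := (edgeEquations_iff h4 hd 2 x).1 h3
    have e02 : L.nu 0 * L.nu 2 = 1 := nu_mul_nu h4 0
    have e13 : L.nu 1 * L.nu 3 = 1 := nu_mul_nu h4 1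
    simp only [show (0 + 1 : Fin 4) = 1 from rfl, show (1 + 1 : Fin 4) = 2 from rfl,
      show (2 + 1 : Fin 4) = 3 from rfl] at a1 b1 c1 a2 b2 c2 a3 b3 c3
    rw [edgeEquations_iff h4 hd 3 x, show (3 + 1 : Fin 4) = 0 from rfl]
    have f02 : L.nu 2 = (L.nu 0)⁻¹ := (inv_eq_of_mul_eq_one_right e02).symm
    have f13 : L.nu 3 = (L.nu 1)⁻¹ := (inv_eq_of_mul_eq_one_right e13).symm
    have n0 := (L.nu_pos 0).ne'
    have n1 := (L.nu_pos 1).ne'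
    refine ⟨?_, ?_, ?_⟩
    · rw [b3, a2, b1, f02, f13]
      field_simp
    · rw [a3, b2, a1, f02, f13]
      field_simp
    · rw [c3, c2, c1, f02, f13]
      field_simp
  rintro ⟨j, i⟩
  fin_cases j
  exacts [h0 i, h1 i, h2 i, h3 i]

/-- Duality: a linear form vanishing on the common kernel of finitely many forms is a combination of
them. -/
lemma equations_mem_span (h4 : L.type = 4) (hd : 2 ≤ d) (y : Fin 4 × Fin 3) :
    equations d k L.v L.vt y ∈ Submodule.span ℝ (range (firstNine d k L.v L.vt)) := by
  refine mem_span_of_iInf_ker_le_ker fun x hx => ?_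
  rw [Submodule.mem_iInf] at hx
  exact equations_of_firstNine h4 hd hx y

lemma finrank_span_equations (h4 : L.type = 4) (hd : 2 ≤ d) :
    Module.finrank ℝ (Submodule.span ℝ (range (equations d k L.v L.vt))) = 9 := by
  have hli : LinearIndependent ℝ (firstNine d k L.v L.vt) :=
    linearIndependent_firstNine fun j => (L.cross_pos j).ne'
  have he : Submodule.span ℝ (range (equations d k L.v L.vt)) =
      Submodule.span ℝ (range (firstNine d k L.v L.vt)) := by
    refine le_antisymm (Submodule.span_le.2 ?_) (Submodule.span_mono ?_)
    · rintro _ ⟨y, rfl⟩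
      exact equations_mem_span h4 hd y
    · rintro _ ⟨i, rfl⟩
      fin_cases i
      exacts [⟨(1, 0), rfl⟩, ⟨(1, 1), rfl⟩, ⟨(1, 2), rfl⟩, ⟨(2, 0), rfl⟩, ⟨(2, 1), rfl⟩,
        ⟨(2, 2), rfl⟩, ⟨(3, 0), rfl⟩, ⟨(3, 1), rfl⟩, ⟨(3, 2), rfl⟩]
  rw [he, finrank_span_eq_card hli, Fintype.card_fin]

/-! ### The equations for isogeometric functions -/

lemma secondRing_apply (L : InnerVertexFour D) (b : D.Index d k → ℝ) (j : Fin 4) :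
    L.secondRing d k b (pos j) = b (L.localIndex d k j 2 1) ∧
    L.secondRing d k b (pos j + 1) = b (L.localIndex d k j 2 2) ∧
    L.secondRing d k b (pos j + 2) = b (L.localIndex d k j 1 2) := by
  fin_cases j <;> exact ⟨rfl, rfl, rfl⟩

/-- When the coefficients in `Ξ₁` vanish, the second ring is a common multiple `r` of the formal
derivatives of orders `(2,1)`, `(1,2)`, `(2,2)`, the last one via `mixed`. The equations become the
rule `jets_succ`. -/
lemma equations_eq_zero (hd : d = 5 ∨ d = 6) (hk : 7 ≤ d + k) (h4 : L.type = 4) {w : ℝ × ℝ → ℝ}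
    (hw : w ∈ D.isoSpace d k) {b : D.Index d k → ℝ} (hb : D.Represents d k w b)
    (hΞ : L.XiOneVanishes d k b) (y : Fin 4 × Fin 3) :
    equations d k L.v L.vt y (L.secondRing d k b) = 0 := by
  have hd5 : 5 ≤ d := by omega
  have hd0 : (d : ℝ) ≠ 0 := by positivity
  have hd1 : (0 : ℝ) < (d : ℝ) - 1 := by
    have : (5 : ℝ) ≤ d := by exact_mod_cast hd5
    linarith
  obtain ⟨J, hJ⟩ := exists_jets hd hk h4 hw hb
  have hJ' : ∀ j, ∀ i ≤ 2, ∀ i' ≤ 2, b (L.localIndex d k j i i') =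
      BSpline.cornerCoeff d k (L.jets J j) (L.mu j) (L.eta j) i i' := fun j i hi i' hi' => by
    rw [← L.loc_ofNat b j i i', hJ j i hi i' hi']
  set τ := BSpline.breakpoint k 0 with hτ
  have hτ0 : τ ≠ 0 := (BSpline.breakpoint_pos k 0).ne'
  have hτκ : kappa d k = τ / (d - 1) := by
    rw [kappa, hτ, BSpline.breakpoint]
    have : (k : ℝ) + 1 ≠ 0 := by positivity
    field_simp
    simp
  -- The six vanishing corner coefficients of each patch form a triangular system for the
  -- derivatives of total order at most two.
  have hlow : ∀ j, L.jets J j 0 0 = 0 ∧ L.jets J j 1 0 = 0 ∧ L.jets J j 0 1 = 0 ∧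
      L.jets J j 2 0 = 0 ∧ L.jets J j 0 2 = 0 ∧ L.jets J j 1 1 = 0 := by
    intro j
    have hc : ∀ i ≤ 2, ∀ i' ≤ 2, (i, i') ≠ (2, 1) → (i, i') ≠ (1, 2) → (i, i') ≠ (2, 2) →
        BSpline.cornerCoeff d k (L.jets J j) (L.mu j) (L.eta j) i i' = 0 :=
      fun i hi i' hi' n1 n2 n3 => by rw [← hJ' j i hi i' hi', hΞ j i hi i' hi' n1 n2 n3]
    have c00 := hc 0 (by omega) 0 (by omega) (by decide) (by decide) (by decide)
    have c10 := hc 1 (by omega) 0 (by omega) (by decide) (by decide) (by decide)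
    have c01 := hc 0 (by omega) 1 (by omega) (by decide) (by decide) (by decide)
    have c20 := hc 2 (by omega) 0 (by omega) (by decide) (by decide) (by decide)
    have c02 := hc 0 (by omega) 2 (by omega) (by decide) (by decide) (by decide)
    have c11 := hc 1 (by omega) 1 (by omega) (by decide) (by decide) (by decide)
    simp only [BSpline.cornerCoeff, BSpline.endCoeff, BSpline.bilinearJet, ← hτ] at c00 c10 c01 c20 c02 c11
    have z00 : L.jets J j 0 0 = 0 := c00
    simp [z00, hτ0, hd0] at c10 c01
    simp [z00, c10, c01, hτ0, hd0, hd1.ne'] at c20 c02 c11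
    exact ⟨z00, c10, c01, c20, c02, c11⟩
  set r : ℝ := τ ^ 3 / (d ^ 2 * (d - 1)) with hr
  have hr0 : r ≠ 0 := by rw [hr]; have := hd1.ne'; positivity
  have hring : ∀ j, L.secondRing d k b (pos j) = r * L.jets J j 2 1 ∧
      L.secondRing d k b (pos j + 2) = r * L.jets J j 1 2 ∧
      L.mixed d k (L.secondRing d k b) j = r * L.jets J j 2 2 := by
    intro j
    obtain ⟨z00, z10, z01, z20, z02, z11⟩ := hlow j
    obtain ⟨e1, e2, e3⟩ := L.secondRing_apply b j
    have f1 : b (L.localIndex d k j 2 1) = r * L.jets J j 2 1 := by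
      rw [hJ' j 2 le_rfl 1 (by omega)]
      simp only [BSpline.cornerCoeff, BSpline.endCoeff, BSpline.bilinearJet, ← hτ]
      norm_num [z00, z10, z01, z20, z02, z11, -mul_eq_mul_right_iff, -mul_eq_mul_left_iff]
      rw [hr]
      field_simp
    have f2 : b (L.localIndex d k j 1 2) = r * L.jets J j 1 2 := by
      rw [hJ' j 1 (by omega) 2 le_rfl]
      simp only [BSpline.cornerCoeff, BSpline.endCoeff, BSpline.bilinearJet, ← hτ]
      norm_num [z00, z10, z01, z20, z02, z11, -mul_eq_mul_right_iff, -mul_eq_mul_left_iff]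
      rw [hr]
      field_simp
    have f3 : b (L.localIndex d k j 2 2) = 2 * (r * L.jets J j 2 1 + r * L.jets J j 1 2) +
        kappa d k * (r * L.jets J j 2 2 + 4 * L.mu j * (r * L.jets J j 1 2)
          + 4 * L.eta j * (r * L.jets J j 2 1)) := by
      rw [hJ' j 2 le_rfl 2 le_rfl, hτκ]
      simp only [BSpline.cornerCoeff, BSpline.endCoeff, BSpline.bilinearJet, ← hτ]
      norm_num [z00, z10, z01, z20, z02, z11, -mul_eq_mul_right_iff, -mul_eq_mul_left_iff]
      rw [hr]
      field_simp
      ring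
    refine ⟨e1.trans f1, e3.trans f2, ?_⟩
    have hκ : kappa d k ≠ 0 := by rw [hτκ]; exact div_ne_zero hτ0 hd1.ne'
    rw [mixed, e1, e2, e3, f3, f1, f2]
    field_simp
    ring
  obtain ⟨j, i⟩ := y
  obtain ⟨j, rfl⟩ : ∃ j', j = j' + 1 := ⟨j - 1, (sub_add_cancel j 1).symm⟩
  refine (edgeEquations_iff h4 (by omega) j _).2 ?_ i
  obtain ⟨p1, p2, p3⟩ := hring j
  obtain ⟨q1, q2, q3⟩ := hring (j + 1)
  rw [p1, p2, p3, q1, q2, q3, jets_succ h4, jets_succ h4, jets_succ h4]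
  refine ⟨by ring, by ring, by ring⟩

/-- This is the only relation among the four consecutive determinants that the explicit coefficients
of `ē^{(4)}` and `ẽ^{(4)}` need. It expresses that one turn around the vertex closes up. -/
lemma psi_cyclic (h4 : L.type = 4) : psi L.v 0 1 * psi L.v 2 3 = psi L.v 1 2 * psi L.v 3 0 := by
  have h0 : psi L.v 1 2 = L.nu 0 * psi L.v 0 1 := (psi_eq h4 0).1
  have h1 : psi L.v 2 3 = L.nu 1 * psi L.v 1 2 := (psi_eq h4 1).1
  have h2 : psi L.v 3 0 = L.nu 2 * psi L.v 2 3 := (psi_eq h4 2).1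
  have e02 : L.nu 0 * L.nu 2 = 1 := nu_mul_nu h4 0
  rw [h2, h1, h0]
  linear_combination (-(psi L.v 0 1 ^ 2 * L.nu 0 * L.nu 1)) * e02

end InnerVertexFour

/-! ### Coefficients of the three dependent equations. -/

namespace TypeFour

/-- The coefficients of the last equation `ē` in terms of the first nine equations. -/
def alpha (v : Fin 4 → ℝ × ℝ) : Fin 3 → ℝ :=
  ![2 * psi v 3 0 ^ 2 * psi v 1 0 / psi v 1 2,
    -(psi v 3 0 ^ 2 * psi v 1 0 * psi v 0 1) / (psi v 1 2 * psi v 2 3 ^ 3),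
    2 * psi v 0 1 ^ 3 / psi v 2 3]

/-- The coefficients of the last equation `ẽ` in terms of the first nine equations. -/
def beta (v : Fin 4 → ℝ × ℝ) : Fin 3 → ℝ :=
  ![psi v 3 0 / (2 * psi v 1 2 ^ 3),
    -(psi v 0 1 * psi v 3 0 ^ 3) / (psi v 2 3 ^ 2 * psi v 0 3 * psi v 1 2),
    psi v 0 1 / (2 * psi v 2 3 ^ 2 * psi v 0 3)]

variable {v : Fin 4 → ℝ × ℝ}

lemma psi_comm (i j : Fin 4) : psi v i j = - psi v j i := cross_comm _ _

lemma eBar_zero_eq (h : ∀ j, psi v j (j + 1) ≠ 0)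
    (hc : psi v 0 1 * psi v 2 3 = psi v 1 2 * psi v 3 0) :
    eBar v 0 = alpha v 0 • eTilde v 1 + alpha v 1 • eBar v 2 + alpha v 2 • eTilde v 3 := by
  have h01 : psi v 0 1 ≠ 0 := h 0
  have h12 : psi v 1 2 ≠ 0 := h 1
  have h23 : psi v 2 3 ≠ 0 := h 2
  have h30 : psi v 3 0 ≠ 0 := h 3
  refine LinearMap.ext fun x => ?_
  have e0 : eBar v 0 x = psi v 3 0 ^ 2 * psi v 1 0 * x (pos 0 + 2) + psi v 0 1 ^ 3 * x (pos 3) :=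
    eBar_apply 3 x
  have e1 : eTilde v 1 x = 1 / 2 * psi v 1 2 * x (pos 0 + 2) + 1 / 2 * psi v 0 1 * x (pos 1) :=
    eTilde_apply 0 x
  have e2 : eBar v 2 x = psi v 1 2 ^ 2 * psi v 3 2 * x (pos 2 + 2) + psi v 2 3 ^ 3 * x (pos 1) :=
    eBar_apply 1 x
  have e3 : eTilde v 3 x = 1 / 2 * psi v 3 0 * x (pos 2 + 2) + 1 / 2 * psi v 2 3 * x (pos 3) :=
    eTilde_apply 2 x
  simp only [LinearMap.add_apply, LinearMap.smul_apply, smul_eq_mul, e0, e1, e2, e3]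
  have a0 : alpha v 0 = 2 * psi v 3 0 ^ 2 * psi v 1 0 / psi v 1 2 := rfl
  have a1 : alpha v 1 = -(psi v 3 0 ^ 2 * psi v 1 0 * psi v 0 1) / (psi v 1 2 * psi v 2 3 ^ 3) := rfl
  have a2 : alpha v 2 = 2 * psi v 0 1 ^ 3 / psi v 2 3 := rfl
  rw [a0, a1, a2, psi_comm 1 0, psi_comm 3 2]
  have h30' : psi v 3 0 = psi v 0 1 * psi v 2 3 / psi v 1 2 := by rw [hc]; field_simp
  rw [h30']
  field_simp
  ring

lemma eTilde_zero_eq (h : ∀ j, psi v j (j + 1) ≠ 0)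
    (hc : psi v 0 1 * psi v 2 3 = psi v 1 2 * psi v 3 0) :
    eTilde v 0 = beta v 0 • eBar v 1 + beta v 1 • eTilde v 2 + beta v 2 • eBar v 3 := by
  have h01 : psi v 0 1 ≠ 0 := h 0
  have h12 : psi v 1 2 ≠ 0 := h 1
  have h23 : psi v 2 3 ≠ 0 := h 2
  have h30 : psi v 3 0 ≠ 0 := h 3
  refine LinearMap.ext fun x => ?_
  have e0 : eTilde v 0 x = 1 / 2 * psi v 0 1 * x (pos 3 + 2) + 1 / 2 * psi v 3 0 * x (pos 0) :=
    eTilde_apply 3 x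
  have e1 : eBar v 1 x = psi v 0 1 ^ 2 * psi v 2 1 * x (pos 1 + 2) + psi v 1 2 ^ 3 * x (pos 0) :=
    eBar_apply 0 x
  have e2 : eTilde v 2 x = 1 / 2 * psi v 2 3 * x (pos 1 + 2) + 1 / 2 * psi v 1 2 * x (pos 2) :=
    eTilde_apply 1 x
  have e3 : eBar v 3 x = psi v 2 3 ^ 2 * psi v 0 3 * x (pos 3 + 2) + psi v 3 0 ^ 3 * x (pos 2) :=
    eBar_apply 2 x
  simp only [LinearMap.add_apply, LinearMap.smul_apply, smul_eq_mul, e0, e1, e2, e3]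
  have a0 : beta v 0 = psi v 3 0 / (2 * psi v 1 2 ^ 3) := rfl
  have a1 : beta v 1 = -(psi v 0 1 * psi v 3 0 ^ 3) / (psi v 2 3 ^ 2 * psi v 0 3 * psi v 1 2) := rfl
  have a2 : beta v 2 = psi v 0 1 / (2 * psi v 2 3 ^ 2 * psi v 0 3) := rfl
  rw [a0, a1, a2, psi_comm 0 3, psi_comm 2 1]
  have h30' : psi v 3 0 = psi v 0 1 * psi v 2 3 / psi v 1 2 := by rw [hc]; field_simp
  rw [h30']
  field_simp
  ring

open Classical in
/-- The coefficients of the last equation `ê` in terms of the first nine equations. -/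
def gamma (d k : ℕ) (v vt : Fin 4 → ℝ × ℝ) : Fin 9 → ℝ :=
  -- The choice depends only on `d`, `k` and the vertices, since these alone enter the existence
  -- statement. Zero is a default for configurations where no such combination exists.
  if h : ∃ g : Fin 9 → ℝ, eHat d k v vt 0 = ∑ i, g i • firstNine d k v vt i then h.choose else 0

lemma eHat_zero_eq {d k : ℕ} {v vt : Fin 4 → ℝ × ℝ}
    (h : eHat d k v vt 0 ∈ Submodule.span ℝ (range (firstNine d k v vt))) :
    eHat d k v vt 0 = ∑ i, gamma d k v vt i • firstNine d k v vt i := by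
  obtain ⟨g, hg⟩ := (Submodule.mem_span_range_iff_exists_fun ℝ).1 h
  have hex : ∃ g : Fin 9 → ℝ, eHat d k v vt 0 = ∑ i, g i • firstNine d k v vt i := ⟨g, hg.symm⟩
  rw [gamma, dif_pos hex]
  exact hex.choose_spec

end TypeFour

end

open TypeFour in
theorem mainTheorem5 :
    ∃ α β : (Fin 4 → ℝ × ℝ) → (Fin 4 → ℝ × ℝ) → Fin 3 → ℝ,
    ∀ d k : ℕ, (d = 5 ∨ d = 6) → 7 ≤ d + k →
    ∃ γ : (Fin 4 → ℝ × ℝ) → (Fin 4 → ℝ × ℝ) → Fin 9 → ℝ,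
    ∀ (D : MultiPatchDomain) (L : InnerVertexFour D), L.type = 4 →
      -- the twelve equations are constraints for the `C²`-smooth isogeometric functions whose
      -- coefficients in `Ξ₁` vanish
      (∀ w ∈ D.isoSpace d k, ∀ b, D.Represents d k w b → L.XiOneVanishes d k b →
        ∀ x, equations d k L.v L.vt x (L.secondRing d k b) = 0) ∧
      -- exactly nine of them are linearly independent
      Module.finrank ℝ (Submodule.span ℝ (Set.range (equations d k L.v L.vt))) = 9 ∧
      LinearIndependent ℝ (firstNine d k L.v L.vt) ∧
      -- the dimension of the vertex space is nine
      (∀ M : Set (ℝ × ℝ) → Set (D.Index d k),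
        (∀ Γ ∈ D.innerEdges, D.IsMinimalDeterminingSet d k Γ (M Γ)) →
        Module.finrank ℝ (D.vertexSpace d k M L.v0) = 9) ∧
      -- the last three equations in terms of the first nine
      eBar L.v 0 = α L.v L.vt 0 • eTilde L.v 1 + α L.v L.vt 1 • eBar L.v 2
        + α L.v L.vt 2 • eTilde L.v 3 ∧
      eTilde L.v 0 = β L.v L.vt 0 • eBar L.v 1 + β L.v L.vt 1 • eTilde L.v 2
        + β L.v L.vt 2 • eBar L.v 3 ∧
      eHat d k L.v L.vt 0 = ∑ i, γ L.v L.vt i • firstNine d k L.v L.vt i := by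
  -- `alpha` and `beta` are fixed before `d` and `k` are given. They involve only the determinants
  -- of the legs and not the opposite vertices.
  refine ⟨fun v _ => alpha v, fun v _ => beta v, fun d k hd hk => ⟨fun v vt => gamma d k v vt,
    fun D L h4 => ?_⟩⟩
  have hψ : ∀ j, psi L.v j (j + 1) ≠ 0 := fun j => (L.cross_pos j).ne'
  have hc := InnerVertexFour.psi_cyclic h4
  have hd2 : 2 ≤ d := by omega
  exact ⟨fun w hw b hb hΞ x => InnerVertexFour.equations_eq_zero hd hk h4 hw hb hΞ x,
    InnerVertexFour.finrank_span_equations h4 hd2, linearIndependent_firstNine hψ,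
    fun M hM => InnerVertexFour.finrank_vertexSpace hd hk h4 hM,
    eBar_zero_eq hψ hc, eTilde_zero_eq hψ hc,
    eHat_zero_eq (InnerVertexFour.equations_mem_span h4 hd2 (0, 2))⟩
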